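/- **Model.** An algorithm has a private memory and an outsourced memory (on a server); the cells of both hold words of $O(w)$ bits. It is one fixed, deterministic algorithm, whose request and update rules are computable functions. It repeatedly determines from the contents of its private memory a request (read cell $a$, write a word to cell $a$, or halt) and then, from these contents and the word that was read, the new contents of its private memory. Time is the number of accesses to the outsourced memory (I/Os with blocks of size $B=1$), computation inside the private memory is not charged, and the size of the private memory is the number of words kept in it between accesses. The algorithm is data-oblivious if, for given public parameters, the sequence of its accesses (addresses, and whether each access is a read or a write) is the same for all contents of the outsourced memory. **Cuckoo tables.** Let $n$ distinct items $x_1,\dots,x_n$ with hash values $h_1(x_i),h_2(x_i)\in\{0,\dots,m-1\}$ be given. A two-table cuckoo hash table with stash of size $s$ consists of two tables $T_1,T_2$ of $m$ cells each and a stash of $s$ cells; each item is stored in exactly one cell, namely in $T_1[h_1(x_i)]$, in $T_2[h_2(x_i)]$ or in a cell of the stash; each cell holds at most one item and is empty otherwise. The stash size $s$ is *sufficient* for the given hash values if such an arrangement exists. **Theorem.** Let $r>1$, $K\in\mathbb N$ and $A\in\mathbb R$ be constants. There are an algorithm and a constant $C\ge 1$, depending only on $r,K,A$, such that the following holds for all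 $n,m,s,w\in\mathbb N$ with $n,w\ge 1$, $n\le 2^w$, table size $m\le Kn$ (so that the two tables have size $O(n)$) and stash size $s\le A(\log n+1)$ (that is, $s=O(\log n)$). The private memory initially holds the public parameters $n,m,s,w$. 1. On memories of words of $Cw$ bits, the algorithm is data-oblivious. 2. For all initial contents of the outsourced memory with words of $Cw$ bits, it halts after at most $C(n+s)$ accesses, never keeps more than $C\,n^{1/r}$ words in its private memory, accesses only the first $C(n+s)$ cells of the outsourced memory, and all words in both memories always have at most $Cw$ bits. 3. If the outsourced memory initially holds $n$ distinct items $x_i\in\{1,\dots,2^w-1\}$ together with arbitrary hash values $h_1(x_i),h_2(x_i)\in\{0,\dots,m-1\}$ (and is blank otherwise), then all its words have at most $Cw$ bits; and whenever the stash size $s$ is sufficient for these hash values, the outsourced memory finally holds a two-table cuckoo hash table with stash of size $s$ for these items (first $T_1$, then $T_2$, then the stash, with $0$ in empty cells). -/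

import Mathlib

/-! ### Two-table cuckoo hashing with a stash -/

namespace Cuckoo

/-- The cells of a two-table cuckoo hash table with tables `T₁`, `T₂` of `m` cells each and a
stash of `s` cells. -/
abbrev Loc (m s : ℕ) : Type := Fin m ⊕ Fin m ⊕ Fin s

/-- A legal placement of `n` items with hash values `h₁ i`, `h₂ i`: different items are in different
cells, an item in `T₁` is at its `h₁`-cell, an item in `T₂` is at its `h₂`-cell (and an item
may be anywhere in the stash). -/
structure IsPlacement {n m s : ℕ} (h₁ h₂ : Fin n → Fin m) (place : Fin n → Loc m s) : Prop where
  injective : Function.Injective place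
  table₁ : ∀ i j, place i = Sum.inl j → h₁ i = j
  table₂ : ∀ i j, place i = Sum.inr (Sum.inl j) → h₂ i = j

/-- A stash of size `s` is sufficient for the given hash values. -/
def StashSuffices {n m : ℕ} (h₁ h₂ : Fin n → Fin m) (s : ℕ) : Prop :=
  ∃ place : Fin n → Loc m s, IsPlacement h₁ h₂ place

/-- The outsourced memory that contains the input and is otherwise blank: the cells
`3 i, 3 i + 1, 3 i + 2` hold the `i`-th item and its two hash values. -/
def inputMemory {n m : ℕ} (x : Fin n → ℕ) (h₁ h₂ : Fin n → Fin m) (a : ℕ) : ℕ :=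
  if h : a / 3 < n then
    if a % 3 = 0 then x ⟨a / 3, h⟩
    else if a % 3 = 1 then h₁ ⟨a / 3, h⟩
    else h₂ ⟨a / 3, h⟩
  else 0

/-- Where the finished table is stored: first `T₁`, then `T₂`, then the stash. -/
def Loc.addr {m s : ℕ} : Loc m s → ℕ
  | Sum.inl j => j
  | Sum.inr (Sum.inl j) => m + j
  | Sum.inr (Sum.inr k) => 2 * m + k

/-- The memory `mem` holds a cuckoo hash table with stash for the items `x`: each item is stored in
exactly one cell, according to a legal placement, and all the other cells are empty (hold `0`). -/
def HoldsTable {n m : ℕ} (x : Fin n → ℕ) (h₁ h₂ : Fin n → Fin m) (s : ℕ) (mem : ℕ → ℕ) : Prop :=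
  ∃ place : Fin n → Loc m s, IsPlacement h₁ h₂ place ∧
    (∀ i, mem (place i).addr = x i) ∧
    (∀ l, l ∉ Set.range place → mem l.addr = 0)

end Cuckoo

/-! ### Algorithms with a small private memory and a large outsourced memory -/

/-- A (uniform, deterministic) algorithm in the external-memory model with blocks of one cell.
The private memory is a list of words. From its contents the algorithm computes its next request to
the outsourced memory: `none` means halt, `some (a, none)` means read cell `a`, and
`some (a, some v)` means write `v` to cell `a`; after the access it computes the new contents of the
private memory from the old contents and the word that was read (`0` for a write). -/
structure Algorithm where
  request : List ℕ → Option (ℕ × Option ℕ)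
  update : List ℕ → ℕ → List ℕ
  computable_request : Computable request
  computable_update : Computable₂ update

namespace Algorithm

/-- A configuration: the private memory and the outsourced memory. -/
structure Config where
  priv : List ℕ
  mem : ℕ → ℕ

/-- One access to the outsourced memory (a halted algorithm stays as it is). -/
def step (P : Algorithm) (c : Config) : Config :=
  match P.request c.priv with
  | none => c
  | some (a, none) => ⟨P.update c.priv (c.mem a), c.mem⟩
  | some (a, some v) => ⟨P.update c.priv 0, Function.update c.mem a v⟩

/-- The configuration after `t` accesses, from the private memory `params` and the outsourced
memory `mem`. -/
def run (P : Algorithm) (params : List ℕ) (mem : ℕ → ℕ) (t : ℕ) : Config :=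
  P.step^[t] ⟨params, mem⟩

/-- What the server sees at time `t`: nothing, if the algorithm has halted; otherwise the address
that is accessed, and whether the access is a write. -/
def access (P : Algorithm) (params : List ℕ) (mem : ℕ → ℕ) (t : ℕ) : Option (ℕ × Bool) :=
  (P.request (P.run params mem t).priv).map fun q => (q.1, q.2.isSome)

/-- The algorithm halts after at most `T` accesses. -/
def HaltsWithin (P : Algorithm) (params : List ℕ) (mem : ℕ → ℕ) (T : ℕ) : Prop :=
  P.request (P.run params mem T).priv = none

/-- All words in the private memory and in the outsourced memory have at most `b` bits, at all
times. -/
def WordsBounded (P : Algorithm) (params : List ℕ) (mem : ℕ → ℕ) (b : ℕ) : Prop :=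
  ∀ t, (∀ q ∈ (P.run params mem t).priv, q < 2 ^ b) ∧ ∀ a, (P.run params mem t).mem a < 2 ^ b

/-- The private memory never holds more than `M` words. -/
def PrivateSpaceBounded (P : Algorithm) (params : List ℕ) (mem : ℕ → ℕ) (M : ℝ) : Prop :=
  ∀ t, ((P.run params mem t).priv.length : ℝ) ≤ M

/-- Only the first `N` cells of the outsourced memory are accessed. -/
def OutsourcedSpaceBounded (P : Algorithm) (params : List ℕ) (mem : ℕ → ℕ) (N : ℕ) : Prop :=
  ∀ t, ∀ q ∈ P.access params mem t, q.1 < N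

/-- Data-obliviousness on memories of `b`-bit words: the access sequence is the same for all
contents of the outsourced memory. -/
def DataOblivious (P : Algorithm) (params : List ℕ) (b : ℕ) : Prop :=
  ∀ mem mem' : ℕ → ℕ, (∀ a, mem a < 2 ^ b) → (∀ a, mem' a < 2 ^ b) →
    P.access params mem = P.access params mem'

end Algorithm

/-! ### Circuits with gates of large fan-in -/

/-! Items are the edges and table cells the vertices of a graph: an item joins its cell in T₁ to its
cell in T₂. A placement matches edges to distinct endpoints and sends the unmatched edges to the
stash. If stash size s is sufficient, some matching misses at most s edges, hence so does every
maximum matching; it is enough to find one.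

Matchings are found by contraction. Every vertex that has an edge is offered one of its edges. Given
a two-colouring, a vertex of colour `false` whose offered edge leads to colour `true` chooses this
edge and is merged into its other end (the head), so the chosen edges form stars whose heads choose
nothing. Contracting p chosen edges removes them and lowers the matching number by at most p
(`IsMatching.contract_one`). Conversely every matching of the contracted graph lifts to one with at
least p more edges (`isMatching_lift`, `size_lift`): a chosen edge is matched to the vertex that
chose it, unless that vertex is taken, and then the head is free. So maximum matchings lift to
maximum matchings (`Good.lift`). In a family of O(q) affine colourings the best one separates a
constant fraction of the offered pairs (`exists_colorings`, `exists_good_coloring`). As long as the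
number of edges exceeds O(s) and the size of one gate, a round therefore leaves a constant factor
fewer edges, and the costs form a geometric series (`exists_step_matching`).

All this is done by circuits whose gates read O(n^(1/r)) wires. Such gates sort polynomially many
values at constant cost per value (`sortsUpTo`): after sorting q consecutive blocks and then the
residue classes modulo q, wrongly ordered positions are less than q² apart, and two rounds of
overlapping windows finish. Sorting yields lookup in association lists (`exists_step_lookup`), from
which offers, contractions, compaction and the final table are built.

A circuit becomes a straight-line program with fixed addresses, whose writes are tabulated functions
of the private words (`exists_of_derives`). Its existence is proved nonconstructively, but
correctness of a program for given parameters is a finite, primitive recursive check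
(`primrecPred_isCorrect`), so a program can be found by search (`exists_search`). The machine
recomputes the program from the public parameters at every access; hence its access sequence depends
on them alone. -/

namespace Circuit

/-- `Derives L B S c S'`: from the wires `S` (words as functions of the input) one gets the wires
`S'` by gates that read at most `L` wires and produce words below `B`; the cost `c` counts the wires
that are read and produced. -/
inductive Derives {Ω : Type} (L B : ℕ) (S : Set (Ω → ℕ)) : ℕ → Set (Ω → ℕ) → Prop
  | refl : Derives L B S 0 S
  | gate {c : ℕ} {S' : Set (Ω → ℕ)} (h : Derives L B S c S') (fs : List (Ω → ℕ))
      (hfs : ∀ f ∈ fs, f ∈ S') (hL : fs.length ≤ L) (gs : List (List ℕ → ℕ))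
      (hgs : ∀ g ∈ gs, ∀ l, g l < B) :
      Derives L B S (c + (fs.length + gs.length))
        (S' ∪ {u | ∃ g ∈ gs, u = fun ω => g (fs.map (· ω))})

/-- The wires `S'` can be derived from `S` at cost at most `c`. -/
def Step {Ω : Type} (L B c : ℕ) (S S' : Set (Ω → ℕ)) : Prop :=
  ∃ c' ≤ c, Derives L B S c' S'

/-- The value `f` is determined by one of the wires in `S`. -/
def Avail {Ω : Type} {α : Type*} (S : Set (Ω → ℕ)) (f : Ω → α) : Prop :=
  ∃ u ∈ S, ∀ ω ω', u ω = u ω' → f ω = f ω'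

section

variable {Ω : Type} {L B : ℕ} {S S' S'' : Set (Ω → ℕ)}

theorem Derives.trans {c d : ℕ} (h : Derives L B S c S') (h' : Derives L B S' d S'') :
    Derives L B S (c + d) S'' := by
  induction h' with
  | refl => exact h
  | gate _ fs hfs hL gs hgs ih =>
    rw [← add_assoc]
    exact ih.gate fs hfs hL gs hgs

theorem Derives.subset {c : ℕ} (h : Derives L B S c S') : S ⊆ S' := by
  induction h with
  | refl => exact subset_rfl
  | gate _ fs hfs hL gs hgs ih => exact ih.trans Set.subset_union_left

theorem Step.refl (c : ℕ) : Step L B c S S := ⟨0, Nat.zero_le _, .refl⟩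

theorem Step.trans {c d : ℕ} (h : Step L B c S S') (h' : Step L B d S' S'') :
    Step L B (c + d) S S'' := by
  obtain ⟨c', hc, h⟩ := h
  obtain ⟨d', hd, h'⟩ := h'
  exact ⟨c' + d', by omega, h.trans h'⟩

theorem Step.subset {c : ℕ} (h : Step L B c S S') : S ⊆ S' := by
  obtain ⟨c', -, h⟩ := h
  exact h.subset

theorem Step.mono {c d : ℕ} (h : Step L B c S S') (hcd : c ≤ d) : Step L B d S S' := by
  obtain ⟨c', hc, h⟩ := h
  exact ⟨c', hc.trans hcd, h⟩

theorem Avail.mono {α : Type*} {f : Ω → α} (h : Avail S f) (hS : S ⊆ S') : Avail S' f := by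
  obtain ⟨u, hu, h⟩ := h
  exact ⟨u, hS hu, h⟩

theorem Avail.step {α : Type*} {f : Ω → α} {c : ℕ} (h : Avail S f) (hS : Step L B c S S') :
    Avail S' f := h.mono hS.subset

theorem Avail.of_det {α β : Type*} {f : Ω → α} (h : Avail S f) {g : Ω → β}
    (hg : ∀ ω ω', f ω = f ω' → g ω = g ω') : Avail S g := by
  obtain ⟨u, hu, h⟩ := h
  exact ⟨u, hu, fun ω ω' e => hg _ _ (h _ _ e)⟩

theorem Avail.map {α β : Type*} {f : Ω → α} (h : Avail S f) (g : α → β) :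
    Avail S (fun ω => g (f ω)) :=
  h.of_det fun _ _ e => congrArg g e

theorem avail_const {β : Type*} (hS : S.Nonempty) (b : β) : Avail S (fun _ => b) := by
  obtain ⟨u, hu⟩ := hS
  exact ⟨u, hu, fun _ _ _ => rfl⟩

/-- A gate: values that are determined by at most `L` available values can be made available. -/
theorem exists_step_gate {ι κ : Type*} [Fintype ι] [Fintype κ] {α : ι → Type*} {β : Type*}
    [Finite β] (hι : Fintype.card ι ≤ L) (hβ : Nat.card β ≤ B) (hB : 0 < B)
    {x : ∀ i, Ω → α i} (hx : ∀ i, Avail S (x i)) {y : κ → Ω → β}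
    (hy : ∀ k ω ω', (∀ i, x i ω = x i ω') → y k ω = y k ω') :
    ∃ S', Step L B (Fintype.card ι + Fintype.card κ) S S' ∧ ∀ k, Avail S' (y k) := by
  classical
  choose u hu hux using hx
  let e : β → ℕ := fun b => Finite.equivFin β b
  have he : Function.Injective e := fun a b h =>
    (Finite.equivFin β).injective (Fin.ext h)
  have heB : ∀ b, e b < B := fun b => (Finite.equivFin β b).2.trans_le hβ
  let fs : List (Ω → ℕ) := Finset.univ.toList.map u
  -- A gate must be a function of the words that it reads. On a tuple that occurs, it is evaluated
  -- at any input producing this tuple, which is harmless by `hy`; other tuples get `0`.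
  let g : κ → List ℕ → ℕ := fun k l =>
    if h : ∃ ω, fs.map (· ω) = l then e (y k h.choose) else 0
  have hg : ∀ k ω, g k (fs.map (· ω)) = e (y k ω) := by
    intro k ω
    have h : ∃ ω', fs.map (· ω') = fs.map (· ω) := ⟨ω, rfl⟩
    simp only [g, dif_pos h]
    congr 1
    refine hy k _ _ fun i => hux i _ _ ?_
    have := h.choose_spec
    rw [List.map_inj_left] at this
    exact this (u i) (by simp [fs])
  refine ⟨_, ⟨0 + (fs.length + (Finset.univ.toList.map g).length), ?_, Derives.gate .refl fs
    (by simp [fs, hu]) (by simpa [fs] using hι) (Finset.univ.toList.map g) ?_⟩, fun k => ?_⟩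
  · simp [fs]
  · intro g' hg' l
    obtain ⟨k, -, rfl⟩ := List.mem_map.1 hg'
    simp only [g]
    split_ifs
    exacts [heB _, hB]
  · refine ⟨fun ω => g k (fs.map (· ω)), Or.inr ⟨g k, by simp, rfl⟩, fun ω ω' h => he ?_⟩
    simpa only [hg] using h

/-- Values that are determined by two available values. -/
theorem exists_step_gate_two {α₁ α₂ β : Type*} [Finite β] (hL : 2 ≤ L) (hβ : Nat.card β ≤ B)
    (hB : 0 < B) {f : Ω → α₁} {g : Ω → α₂} (hf : Avail S f) (hg : Avail S g) (G : α₁ → α₂ → β) :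
    ∃ S', Step L B 3 S S' ∧ Avail S' (fun ω => G (f ω) (g ω)) := by
  obtain ⟨S', h, h'⟩ := exists_step_gate (ι := Bool) (κ := Unit) (S := S) (L := L) (B := B)
    (x := fun i ω => cond i (Sum.inl (f ω)) (Sum.inr (g ω) : α₁ ⊕ α₂))
    (y := fun _ ω => G (f ω) (g ω)) (by simpa using hL) hβ hB
    (by rintro (_ | _); exacts [hg.map _, hf.map _])
    (by
      intro _ ω ω' h
      have h1 := h true
      have h2 := h false
      simp only [cond_true, cond_false, Sum.inl.injEq, Sum.inr.injEq] at h1 h2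
      rw [h1, h2])
  exact ⟨S', by simpa using h, h' ()⟩

/-- Doing a finite family of derivations one after the other. -/
theorem exists_step_forall {ι : Type*} [Fintype ι] (c : ι → ℕ) (P : ι → Set (Ω → ℕ) → Prop)
    (hP : ∀ i S S', S ⊆ S' → P i S → P i S')
    (h : ∀ i S₁, S ⊆ S₁ → ∃ S', Step L B (c i) S₁ S' ∧ P i S') :
    ∃ S', Step L B (∑ i, c i) S S' ∧ ∀ i, P i S' := by
  classical
  suffices H : ∀ T : Finset ι, ∃ S', Step L B (∑ i ∈ T, c i) S S' ∧ ∀ i ∈ T, P i S' by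
    simpa using H Finset.univ
  intro T
  induction T using Finset.induction_on with
  | empty => exact ⟨S, .refl _, by simp⟩
  | insert i T hi ih =>
    obtain ⟨S₁, h₁, h₁'⟩ := ih
    obtain ⟨S₂, h₂, h₂'⟩ := h i S₁ h₁.subset
    refine ⟨S₂, (h₁.trans h₂).mono (by rw [Finset.sum_insert hi, add_comm]), ?_⟩
    intro j hj
    rcases Finset.mem_insert.1 hj with rfl | hj
    exacts [h₂', hP _ _ _ h₂.subset (h₁' j hj)]

/-- Pointwise operations on two families. -/
theorem exists_step_zip {ι : Type*} [Fintype ι] {α₁ α₂ β : Type*} [Finite β] (hL : 2 ≤ L)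
    (hβ : Nat.card β ≤ B) (hB : 0 < B) {f : ι → Ω → α₁} {g : ι → Ω → α₂}
    (hf : ∀ i, Avail S (f i)) (hg : ∀ i, Avail S (g i)) (G : ι → α₁ → α₂ → β) :
    ∃ S', Step L B (3 * Fintype.card ι) S S' ∧ ∀ i, Avail S' (fun ω => G i (f i ω) (g i ω)) := by
  obtain ⟨S', h, h'⟩ := exists_step_forall (S := S) (L := L) (B := B) (fun _ : ι => 3)
    (fun i S' => Avail S' (fun ω => G i (f i ω) (g i ω))) (fun i S S' hS h => h.mono hS)
    (fun i S₁ hS => exists_step_gate_two hL hβ hB ((hf i).mono hS) ((hg i).mono hS) (G i))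
  exact ⟨S', h.mono (by simp [mul_comm]), h'⟩

/-- A sequential scan: the states of an automaton that reads the available values. -/
theorem exists_step_scan {N : ℕ} {α σ : Type*} [Finite σ] (hL : 2 ≤ L) (hσ : Nat.card σ ≤ B)
    (hB : 0 < B) {x : ℕ → Ω → α} (hx : ∀ i < N, Avail S (x i)) {st : ℕ → Ω → σ}
    (h0 : Avail S (st 0)) (f : α → σ → σ) (hst : ∀ i < N, ∀ ω, st (i + 1) ω = f (x i ω) (st i ω)) :
    ∃ S', Step L B (3 * N) S S' ∧ ∀ i ≤ N, Avail S' (st i) := by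
  induction N with
  | zero => exact ⟨S, .refl _, by simpa using h0⟩
  | succ N ih =>
    obtain ⟨S₁, h₁, h₁'⟩ := ih (fun i hi => hx i (by omega)) (fun i hi => hst i (by omega))
    obtain ⟨S₂, h₂, h₂'⟩ := exists_step_gate_two hL hσ hB ((hx N (by omega)).step h₁)
      (h₁' N le_rfl) f
    refine ⟨S₂, (h₁.trans h₂).mono (by omega), fun i hi => ?_⟩
    rcases Nat.lt_or_eq_of_le hi with hi | rfl
    · exact (h₁' i (by omega)).step h₂
    · have : st (N + 1) = fun ω => f (x N ω) (st N ω) := funext (hst N (by omega))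
      rw [this]
      exact h₂'

end

end Circuit

/-! ### Sorting -/

namespace Circuit

/-- `y` arises from `x` by sorting each of the blocks (the fibres of `blk`). -/
structure SortedWithin {ι α τ : Type*} [LE ι] (blk : ι → τ) (key : α → ℕ) (x y : ι → α) :
    Prop where
  perm : ∃ σ : Equiv.Perm ι, (∀ i, blk (σ i) = blk i) ∧ ∀ i, y i = x (σ i)
  mono : ∀ i j, blk i = blk j → i ≤ j → key (y i) ≤ key (y j)

/-- Two positions are in the wrong order only if their distance is less than `D`. -/
def NearlySorted {N : ℕ} {α : Type*} (key : α → ℕ) (D : ℕ) (x : Fin N → α) : Prop :=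
  ∀ p p' : Fin N, key (x p) < key (x p') → (p : ℕ) < p' + D

section

variable {α τ : Type*} {key : α → ℕ}

theorem SortedWithin.card_eq {ι : Type*} [LE ι] [Fintype ι] [DecidableEq τ] {blk : ι → τ}
    {x y : ι → α} (h : SortedWithin blk key x y) (b : τ) (P : α → Prop) [DecidablePred P] :
    (Finset.univ.filter fun i => blk i = b ∧ P (y i)).card =
      (Finset.univ.filter fun i => blk i = b ∧ P (x i)).card := by
  obtain ⟨σ, hσ, hy⟩ := h.perm
  refine Finset.card_bij (fun i _ => σ i) ?_ (fun _ _ _ _ h => σ.injective h) ?_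
  · intro i hi
    simpa [hσ, hy] using hi
  · intro i hi
    refine ⟨σ.symm i, ?_, by simp⟩
    have := hσ (σ.symm i)
    simp only [Equiv.apply_symm_apply] at this
    simpa [hy, ← this] using hi

variable {N : ℕ}

/-- In a block that is sorted, small values are spread evenly over the residue classes. -/
theorem card_class_le {r q t : ℕ} (hq : 0 < q) {x y : Fin N → α}
    (h : SortedWithin (fun i : Fin N => (i : ℕ) / r) key x y) (c j j' : ℕ) (hj : j < q)
    (hj' : j' < q) :
    (Finset.univ.filter fun i : Fin N =>
        ((i : ℕ) % q = j ∧ key (y i) < t) ∧ (i : ℕ) / r = c).card ≤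
      (Finset.univ.filter fun i : Fin N =>
        ((i : ℕ) % q = j' ∧ key (y i) < t) ∧ (i : ℕ) / r = c).card + 1 := by
  set T := Finset.univ.filter fun i : Fin N =>
        ((i : ℕ) % q = j ∧ key (y i) < t) ∧ (i : ℕ) / r = c with hT
  rcases T.eq_empty_or_nonempty with h0 | h0
  · simp [h0]
  have hm := T.max'_mem h0
  set u := T.max' h0 with hu
  rw [← Finset.card_erase_add_one hm]
  refine Nat.add_le_add_right ?_ 1
  have hu' : ((u : ℕ) % q = j ∧ key (y u) < t) ∧ (u : ℕ) / r = c := by simpa [hT] using hm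
  have key1 : ∀ i ∈ T.erase u, (i : ℕ) % q = j ∧ (i : ℕ) / r = c ∧ (i : ℕ) + q ≤ u := by
    intro i hi
    have hne := Finset.ne_of_mem_erase hi
    have hiT := Finset.mem_of_mem_erase hi
    have hle : i ≤ u := T.le_max' i hiT
    have hi' : ((i : ℕ) % q = j ∧ key (y i) < t) ∧ (i : ℕ) / r = c := by simpa [hT] using hiT
    refine ⟨hi'.1.1, hi'.2, ?_⟩
    have hlt : (i : ℕ) < u := lt_of_le_of_ne hle (by simpa [Fin.ext_iff] using hne)
    have hmod : (i : ℕ) ≡ u [MOD q] := hi'.1.1.trans hu'.1.1.symm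
    have hdvd := (Nat.modEq_iff_dvd' hlt.le).1 hmod
    have := Nat.le_of_dvd (by omega) hdvd
    omega
  -- Shifting by the residue of j' - j, which is less than q, moves class j into class j'. Every
  -- element except the largest, u, is at most u - q, so its shift stays below u: in the same block,
  -- and with a small key because the block is sorted.
  have hδ : (j' + q - j) % q < q := Nat.mod_lt _ hq
  have hN : ∀ i ∈ T.erase u, (i : ℕ) + (j' + q - j) % q < N := by
    intro i hi
    have := (key1 i hi).2.2
    have := u.2
    omega
  refine Finset.card_le_card_of_injOn
    (fun i => if hi : i ∈ T.erase u then ⟨(i : ℕ) + (j' + q - j) % q, hN i hi⟩ else i) ?_ ?_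
  · intro i hi
    have hi : i ∈ T.erase u := hi
    obtain ⟨h1, h2, h3⟩ := key1 i hi
    simp only [hi, dite_true]
    have hmod : ((i : ℕ) + (j' + q - j) % q) % q = j' := by
      rw [Nat.add_mod, Nat.mod_mod, ← Nat.add_mod]
      have hi0 := Nat.div_add_mod (i : ℕ) q
      rw [h1] at hi0
      have : (i : ℕ) + (j' + q - j) = j' + q * ((i : ℕ) / q + 1) := by
        rw [mul_add]; omega
      rw [this, Nat.add_mul_mod_self_left, Nat.mod_eq_of_lt hj']
    have hdiv : ((i : ℕ) + (j' + q - j) % q) / r = c := by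
      apply le_antisymm
      · rw [← hu'.2]; exact Nat.div_le_div_right (by omega)
      · rw [← h2]; exact Nat.div_le_div_right (by omega)
    simp only [Finset.coe_filter, Finset.mem_univ, true_and, Set.mem_ofPred_eq]
    refine ⟨⟨hmod, lt_of_le_of_lt (h.mono _ u ?_ ?_) hu'.1.2⟩, hdiv⟩
    · exact hdiv.trans hu'.2.symm
    · rw [Fin.le_def]; simp only; omega
  · intro i hi i' hi' heq
    have hi : i ∈ T.erase u := hi
    have hi' : i' ∈ T.erase u := hi'
    simp only [hi, hi', dite_true, Fin.mk.injEq, add_left_inj] at heq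
    exact Fin.ext heq

/-- Sorting `q` consecutive blocks, and then the residue classes modulo `q`, sorts nearly. -/
theorem nearlySorted_of_blocks_of_classes {q r : ℕ} (hq : 0 < q) (hr : N ≤ q * r)
    {x y z : Fin N → α} (h : SortedWithin (fun i : Fin N => (i : ℕ) / r) key x y)
    (h' : SortedWithin (fun i : Fin N => (i : ℕ) % q) key y z) :
    NearlySorted key (q * q) z := by
  intro p p' hpp
  set t := key (z p') with ht
  have e := h'.card_eq ((p : ℕ) % q) (fun a => key a < t)
  have e' := h'.card_eq ((p' : ℕ) % q) (fun a => key a < t)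
  -- The class of p is sorted and p has a key below t, so all p / q + 1 positions of the class up to
  -- p have one. Since p' has key t, only the p' / q earlier positions of its class can have smaller
  -- keys.
  have h1 : (p : ℕ) / q + 1 ≤
      (Finset.univ.filter fun i : Fin N => (i : ℕ) % q = (p : ℕ) % q ∧ key (z i) < t).card := by
    have hp := Nat.div_add_mod (p : ℕ) q
    have hbd : ∀ k ∈ Finset.range ((p : ℕ) / q + 1), q * k + (p : ℕ) % q ≤ p := by
      intro k hk
      have : q * k ≤ q * ((p : ℕ) / q) :=
        Nat.mul_le_mul_left q (by have := Finset.mem_range.1 hk; omega)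
      omega
    calc (p : ℕ) / q + 1 = (Finset.range ((p : ℕ) / q + 1)).card := (Finset.card_range _).symm
      _ ≤ _ := by
        refine Finset.card_le_card_of_injOn (fun k => if hk : k ∈ Finset.range ((p : ℕ) / q + 1)
          then ⟨q * k + (p : ℕ) % q, (hbd k hk).trans_lt p.2⟩ else p) ?_ ?_
        · intro k hk
          have hk : k ∈ Finset.range ((p : ℕ) / q + 1) := hk
          have hmod : (q * k + (p : ℕ) % q) % q = (p : ℕ) % q := by
            rw [Nat.mul_add_mod, Nat.mod_mod]
          simp only [hk, dite_true, Finset.coe_filter, Finset.mem_univ, true_and,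
            Set.mem_ofPred_eq]
          exact ⟨hmod, lt_of_le_of_lt (h'.mono _ p hmod (Fin.le_def.2 (hbd k hk))) hpp⟩
        · intro k hk k' hk' heq
          have hk : k ∈ Finset.range ((p : ℕ) / q + 1) := hk
          have hk' : k' ∈ Finset.range ((p : ℕ) / q + 1) := hk'
          simp only [hk, hk', dite_true, Fin.mk.injEq, add_left_inj] at heq
          exact Nat.eq_of_mul_eq_mul_left hq heq
  have h2 : (Finset.univ.filter fun i : Fin N =>
      (i : ℕ) % q = (p' : ℕ) % q ∧ key (z i) < t).card ≤ (p' : ℕ) / q := by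
    calc _ ≤ (Finset.range ((p' : ℕ) / q)).card := by
          refine Finset.card_le_card_of_injOn (fun i => (i : ℕ) / q) ?_ ?_
          · intro i hi
            simp only [Finset.coe_filter, Finset.mem_univ, true_and, Set.mem_ofPred_eq] at hi
            have hlt : (i : ℕ) < p' := by
              by_contra hle
              have := h'.mono p' i hi.1.symm (Fin.le_def.2 (not_lt.1 hle))
              omega
            have h3 := Nat.div_add_mod (i : ℕ) q
            have h4 := Nat.div_add_mod (p' : ℕ) q
            rw [hi.1] at h3
            have : q * ((i : ℕ) / q) < q * ((p' : ℕ) / q) := by omega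
            simpa using Nat.lt_of_mul_lt_mul_left this
          · intro i hi i' hi' heq
            simp only [Finset.coe_filter, Finset.mem_univ, true_and, Set.mem_ofPred_eq] at hi hi'
            have h3 := Nat.div_add_mod (i : ℕ) q
            have h4 := Nat.div_add_mod (i' : ℕ) q
            simp only at heq
            rw [heq, hi.1] at h3
            rw [hi'.1] at h4
            exact Fin.ext (h3.symm.trans h4)
      _ = _ := Finset.card_range _
  -- Before the classes are sorted, each of the at most q sorted blocks contributes at most one more
  -- small key to one class than to another. Sorting a class does not change its count, so p / q + 1
  -- ≤ p' / q + q.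
  have h3 : (Finset.univ.filter fun i : Fin N =>
        (i : ℕ) % q = (p : ℕ) % q ∧ key (y i) < t).card ≤
      (Finset.univ.filter fun i : Fin N =>
        (i : ℕ) % q = (p' : ℕ) % q ∧ key (y i) < t).card + q := by
    have hmaps : ∀ i : Fin N, (i : ℕ) / r ∈ Finset.range q := fun i =>
      Finset.mem_range.2 (Nat.div_lt_of_lt_mul (by
        have := i.2; rw [mul_comm] at hr; omega))
    rw [Finset.card_eq_sum_card_fiberwise (f := fun i : Fin N => (i : ℕ) / r)
        (t := Finset.range q) (fun i _ => hmaps i),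
      Finset.card_eq_sum_card_fiberwise (f := fun i : Fin N => (i : ℕ) / r)
        (t := Finset.range q) (fun i _ => hmaps i)]
    calc _ ≤ ∑ c ∈ Finset.range q, (((Finset.univ.filter fun i : Fin N =>
            (i : ℕ) % q = (p' : ℕ) % q ∧ key (y i) < t).filter
              fun i : Fin N => (i : ℕ) / r = c).card + 1) := by
          refine Finset.sum_le_sum fun c _ => ?_
          rw [Finset.filter_filter, Finset.filter_filter]
          exact card_class_le hq h c _ _ (Nat.mod_lt _ hq) (Nat.mod_lt _ hq)
      _ = _ := by rw [Finset.sum_add_distrib]; simp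
  have h4 : (p : ℕ) / q + 1 ≤ (p' : ℕ) / q + q := by omega
  have h5 := Nat.div_add_mod (p : ℕ) q
  have h6 := Nat.div_add_mod (p' : ℕ) q
  have h7 := Nat.mod_lt (p : ℕ) hq
  have h8 := Nat.mul_le_mul_left q h4
  rw [mul_add, mul_add] at h8
  omega

/-- Sorting within blocks keeps a sequence nearly sorted. -/
theorem NearlySorted.sortedWithin {D : ℕ} {x y : Fin N → α} (hx : NearlySorted key D x)
    {blk : Fin N → τ} (h : SortedWithin blk key x y) : NearlySorted key D y := by
  classical
  intro p p' hpp
  obtain ⟨σ, hσ, hy⟩ := h.perm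
  rcases le_or_gt p p' with hle | hlt
  · have : p ≠ p' := by rintro rfl; exact lt_irrefl _ hpp
    have : (p : ℕ) < p' := lt_of_le_of_ne hle (by simpa [Fin.ext_iff] using this)
    omega
  -- If x had only keys below key (y p') up to position p', the values of y from p' on in its block
  -- would all come from positions after p': an injection of a finite set into a smaller one. The
  -- position g' below is the mirror image.
  obtain ⟨g, hg, hgx⟩ : ∃ g ≤ p', key (y p') ≤ key (x g) := by
    by_contra! hcon
    have hsub : (Finset.univ.filter fun i => blk i = blk p' ∧ p' ≤ i).card ≤
        ((Finset.univ.filter fun i => blk i = blk p' ∧ p' ≤ i).erase p').card := by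
      refine Finset.card_le_card_of_injOn σ ?_ σ.injective.injOn
      intro i hi
      simp only [Finset.coe_filter, Finset.mem_univ, true_and, Set.mem_ofPred_eq] at hi
      have h1 : p' < σ i := by
        by_contra hle
        have h2 := hcon (σ i) (not_lt.1 hle)
        have h3 := h.mono p' i hi.1.symm hi.2
        rw [hy i] at h3
        omega
      simp [hσ, hi.1, h1.le, h1.ne']
    have hmem : p' ∈ Finset.univ.filter fun i => blk i = blk p' ∧ p' ≤ i := by simp
    have := Finset.card_erase_lt_of_mem hmem
    omega
  obtain ⟨g', hg', hgx'⟩ : ∃ g', p ≤ g' ∧ key (x g') ≤ key (y p) := by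
    by_contra! hcon
    have hsub : (Finset.univ.filter fun i => blk i = blk p ∧ i ≤ p).card ≤
        ((Finset.univ.filter fun i => blk i = blk p ∧ i ≤ p).erase p).card := by
      refine Finset.card_le_card_of_injOn σ ?_ σ.injective.injOn
      intro i hi
      simp only [Finset.coe_filter, Finset.mem_univ, true_and, Set.mem_ofPred_eq] at hi
      have h1 : σ i < p := by
        by_contra hle
        have h2 := hcon (σ i) (not_lt.1 hle)
        have h3 := h.mono i p hi.1 hi.2
        rw [hy i] at h3
        omega
      simp [hσ, hi.1, h1.le, h1.ne]
    have hmem : p ∈ Finset.univ.filter fun i => blk i = blk p ∧ i ≤ p := by simp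
    have := Finset.card_erase_lt_of_mem hmem
    omega
  have := hx g' g (by omega)
  have h1 : (g : ℕ) ≤ p' := hg
  have h2 : (p : ℕ) ≤ g' := hg'
  omega

/-- Two rounds of overlapping windows sort a nearly sorted sequence. -/
theorem NearlySorted.sorted {D : ℕ} {x y z : Fin N → α} (hx : NearlySorted key D x)
    (h : SortedWithin (fun i : Fin N => (i : ℕ) / (2 * D)) key x y)
    (h' : SortedWithin (fun i : Fin N => ((i : ℕ) + D) / (2 * D)) key y z) (p p' : Fin N)
    (hpp : p ≤ p') : key (z p) ≤ key (z p') := by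
  by_contra! hcon
  obtain ⟨σ, hσ, hz⟩ := h'.perm
  by_cases hb : ((p : ℕ) + D) / (2 * D) = ((p' : ℕ) + D) / (2 * D)
  · exact absurd (h'.mono p p' hb hpp) (by omega)
  have hle : ((p : ℕ) + D) / (2 * D) ≤ ((p' : ℕ) + D) / (2 * D) :=
    Nat.div_le_div_right (by have : (p : ℕ) ≤ p' := hpp; omega)
  have hw : ((σ p : ℕ) + D) / (2 * D) < ((σ p' : ℕ) + D) / (2 * D) := by
    have h1 : ((σ p : ℕ) + D) / (2 * D) = ((p : ℕ) + D) / (2 * D) := hσ p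
    have h2 : ((σ p' : ℕ) + D) / (2 * D) = ((p' : ℕ) + D) / (2 * D) := hσ p'
    omega
  set u : ℕ := (σ p : ℕ) with hu
  set u' : ℕ := (σ p' : ℕ) with hu'
  have huu : u < u' := by
    by_contra hge
    exact absurd (Nat.div_le_div_right (c := 2 * D) (show u' + D ≤ u + D by omega)) (by omega)
  have hnear : u' < u + D := hx.sortedWithin h (σ p') (σ p) (by rw [← hz, ← hz]; exact hcon)
  have hD : 0 < 2 * D := by omega
  have hne : u / (2 * D) ≠ u' / (2 * D) := by
    intro heq
    have := h.mono (σ p) (σ p') heq (Fin.le_def.2 huu.le)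
    rw [← hz, ← hz] at this
    omega
  have hlt : u / (2 * D) < u' / (2 * D) :=
    lt_of_le_of_ne (Nat.div_le_div_right huu.le) hne
  -- The boundary 2 D (u' / (2 D)) separates u from u' and is less than D away from both, so both
  -- lie in one window of the shifted partition, against `hw`.
  have h1 : u < 2 * D * (u' / (2 * D)) := by
    have := (Nat.div_lt_iff_lt_mul hD).1 hlt
    rwa [mul_comm] at this
  have h2 : 2 * D * (u' / (2 * D)) ≤ u' := Nat.mul_div_le _ _
  have h3 : (u + D) / (2 * D) = u' / (2 * D) := by
    apply Nat.div_eq_of_lt_le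
    · rw [mul_comm]; omega
    · rw [Nat.succ_mul, mul_comm]; omega
  have h4 : (u' + D) / (2 * D) = u' / (2 * D) := by
    apply Nat.div_eq_of_lt_le
    · rw [mul_comm]; omega
    · rw [Nat.succ_mul, mul_comm]; omega
  omega

end

/-! ### Sorting circuits with constant cost per value -/

/-- Families of at most `n₀` available values can be sorted at cost `c` per value. -/
def SortsUpTo {α : Type} (Ω : Type) (L B : ℕ) (key : α → ℕ) (n₀ c : ℕ) : Prop :=
  ∀ M ≤ n₀, ∀ (S : Set (Ω → ℕ)) (x : Fin M → Ω → α), (∀ i, Avail S (x i)) →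
    ∃ S', Step L B (c * M) S S' ∧ ∃ y : Fin M → Ω → α, (∀ i, Avail S' (y i)) ∧
      ∀ ω, ∃ σ : Equiv.Perm (Fin M), (∀ i, y i ω = x (σ i) ω) ∧
        ∀ i j, i ≤ j → key (y i ω) ≤ key (y j ω)

section

variable {Ω : Type} {α : Type} {L B : ℕ} {key : α → ℕ}

/-- Gluing injective maps on the fibres. -/
theorem exists_perm_of_fibers {ι τ : Type*} [Finite ι] (blk : ι → τ)
    (s : ∀ b, {i // blk i = b} → {i // blk i = b}) (hs : ∀ b, Function.Injective (s b)) :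
    ∃ σ : Equiv.Perm ι, ∀ i, σ i = (s (blk i) ⟨i, rfl⟩).1 := by
  let F : ι → ι := fun i => (s (blk i) ⟨i, rfl⟩).1
  have hF : ∀ b i (hi : blk i = b), F i = (s b ⟨i, hi⟩).1 := by rintro _ i rfl; rfl
  have hinj : Function.Injective F := by
    intro i j hij
    have h1 : blk (F i) = blk i := (s (blk i) ⟨i, rfl⟩).2
    have h2 : blk (F j) = blk j := (s (blk j) ⟨j, rfl⟩).2
    have h3 : blk i = blk j := by rw [← h1, hij, h2]
    rw [hF (blk j) i h3, hF (blk j) j rfl] at hij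
    exact congrArg Subtype.val (hs _ (Subtype.ext hij))
  exact ⟨Equiv.ofBijective F (Finite.injective_iff_bijective.1 hinj), fun i => rfl⟩

/-- The cost of sorting is linear in the number of values, so treating the blocks one after the
other still costs `c` per value. -/
theorem SortsUpTo.within {n₀ c N t : ℕ} (H : SortsUpTo Ω L B key n₀ c) (blk : Fin N → Fin t)
    (hblk : ∀ b, Fintype.card {i // blk i = b} ≤ n₀) {S : Set (Ω → ℕ)} {x : Fin N → Ω → α}
    (hx : ∀ i, Avail S (x i)) :
    ∃ S', Step L B (c * N) S S' ∧ ∃ y : Fin N → Ω → α, (∀ i, Avail S' (y i)) ∧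
      ∀ ω, SortedWithin blk key (fun i => x i ω) (fun i => y i ω) := by
  let e : ∀ b, Fin (Fintype.card {i // blk i = b}) ≃o {i // blk i = b} := fun b =>
    Fintype.orderIsoFinOfCardEq _ rfl
  obtain ⟨S', h, hy⟩ := exists_step_forall (S := S) (L := L) (B := B)
    (fun b => c * Fintype.card {i // blk i = b})
    (fun b S' => ∃ y : Fin (Fintype.card {i // blk i = b}) → Ω → α, (∀ i, Avail S' (y i)) ∧
      ∀ ω, ∃ σ : Equiv.Perm (Fin (Fintype.card {i // blk i = b})),
        (∀ i, y i ω = x (e b (σ i)).1 ω) ∧ ∀ i j, i ≤ j → key (y i ω) ≤ key (y j ω))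
    (fun b S S' hS ⟨y, hy, h⟩ => ⟨y, fun i => (hy i).mono hS, h⟩)
    (fun b S₁ hS => H _ (hblk b) S₁ (fun i => x (e b i).1) (fun i => (hx _).mono hS))
  choose y hy hσ using hy
  have hsum : ∑ b, c * Fintype.card {i // blk i = b} = c * N := by
    rw [← Finset.mul_sum, ← Fintype.card_sigma, Fintype.card_congr (Equiv.sigmaFiberEquiv blk),
      Fintype.card_fin]
  rw [hsum] at h
  refine ⟨S', h, fun i => y (blk i) ((e _).symm ⟨i, rfl⟩), fun i => hy _ _, fun ω => ⟨?_, ?_⟩⟩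
  · choose σ hσ1 hσ2 using fun b => hσ b ω
    obtain ⟨τ, hτ⟩ := exists_perm_of_fibers blk (fun b i => e b (σ b ((e b).symm i)))
      (fun b => (e b).injective.comp ((σ b).injective.comp (e b).symm.injective))
    refine ⟨τ, fun i => ?_, fun i => ?_⟩
    · rw [hτ]; exact (e (blk i) (σ (blk i) ((e (blk i)).symm ⟨i, rfl⟩))).2
    · simp only [hσ1, hτ]
  · have hF : ∀ b i (hi : blk i = b), y (blk i) ((e _).symm ⟨i, rfl⟩) ω =
        y b ((e b).symm ⟨i, hi⟩) ω := by rintro _ i rfl; rfl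
    intro i j hij hle
    simp only
    rw [hF _ i hij]
    obtain ⟨σ, -, hσ2⟩ := hσ (blk j) ω
    exact hσ2 _ _ ((e (blk j)).symm.monotone (by simpa using hle))

/-- The cost per value of sorting `q ^ j * (2 * q ^ 2)` values. -/
def sortCost : ℕ → ℕ
  | 0 => 2
  | j + 1 => 2 * sortCost j + 4

theorem sortsUpTo_gate [Finite α] (hB : 0 < B) (hα : Nat.card α ≤ B) {n₀ : ℕ} (hn₀ : n₀ ≤ L) :
    SortsUpTo Ω L B key n₀ 2 := by
  intro M hM S x hx
  let y : Fin M → Ω → α := fun i ω => x (Tuple.sort (fun j => key (x j ω)) i) ω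
  obtain ⟨S', h, hy⟩ := exists_step_gate (L := L) (B := B) (by simpa using hM.trans hn₀) hα hB hx
    (y := y) (by
      intro k ω ω' h
      simp only [y, h])
  refine ⟨S', by simpa [two_mul] using h, y, hy, fun ω => ⟨Tuple.sort fun j => key (x j ω),
    fun i => rfl, fun i j hij => ?_⟩⟩
  exact Tuple.monotone_sort (fun j => key (x j ω)) hij

/-- A set of naturals in an interval of length `n` has at most `n` elements. -/
theorem card_le_of_interval {N n a : ℕ} {P : Fin N → Prop} [DecidablePred P]
    (h : ∀ i, P i → a ≤ (i : ℕ) ∧ (i : ℕ) < a + n) : Fintype.card {i // P i} ≤ n := by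
  rw [Fintype.card_subtype]
  calc _ ≤ (Finset.Ico a (a + n)).card := by
        refine Finset.card_le_card_of_injOn (fun i => (i : ℕ)) ?_ Fin.val_injective.injOn
        intro i hi
        simpa using h i (by simpa using hi)
    _ = n := by simp

theorem card_block_le {N n b : ℕ} (a : ℕ) (hn : 0 < n) :
    Fintype.card {i : Fin N // ((i : ℕ) + a) / n = b} ≤ n := by
  refine card_le_of_interval (a := b * n - a) fun i hi => ?_
  have h1 := Nat.div_add_mod ((i : ℕ) + a) n
  have h2 := Nat.mod_lt ((i : ℕ) + a) hn
  rw [hi, mul_comm] at h1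
  omega

theorem card_class_le_ceil {N q r b : ℕ} (hr : N ≤ q * r) :
    Fintype.card {i : Fin N // (i : ℕ) % q = b} ≤ r := by
  rw [Fintype.card_subtype]
  calc _ ≤ (Finset.range r).card := by
        refine Finset.card_le_card_of_injOn (fun i => (i : ℕ) / q) ?_ ?_
        · intro i _
          simpa using Nat.div_lt_of_lt_mul (i.2.trans_le hr)
        · intro i hi j hj hij
          simp only [Finset.coe_filter, Finset.mem_univ, true_and, Set.mem_ofPred_eq] at hi hj
          have h1 := Nat.div_add_mod (i : ℕ) q
          have h2 := Nat.div_add_mod (j : ℕ) q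
          simp only at hij
          rw [hij, hi] at h1
          rw [hj] at h2
          exact Fin.ext (h1.symm.trans h2)
    _ = r := by simp

/-- Sorting with gates that read `2 * q ^ 2` values. -/
theorem sortsUpTo [Finite α] (hB : 0 < B) (hα : Nat.card α ≤ B) {q : ℕ} (hq : 0 < q)
    (hL : 2 * (q * q) ≤ L) (j : ℕ) :
    SortsUpTo Ω L B key (q ^ j * (2 * (q * q))) (sortCost j) := by
  induction j with
  | zero => exact sortsUpTo_gate hB hα (by simpa using hL)
  | succ j ih =>
    have hG : SortsUpTo Ω L B key (2 * (q * q)) 2 := sortsUpTo_gate hB hα hL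
    have hqq : 0 < q * q := Nat.mul_pos hq hq
    intro N hN S x hx
    set r := q ^ j * (2 * (q * q)) with hr
    have hNr : N ≤ q * r := by rw [hr, ← mul_assoc, ← pow_succ']; exact hN
    have hr0 : 0 < r := Nat.mul_pos (pow_pos hq _) (by omega)
    have hbd : ∀ (i : Fin N) (a n : ℕ), ((i : ℕ) + a) / n < N + a + 1 := fun i a n =>
      (Nat.div_le_self _ _).trans_lt (by omega)
    -- Blocks of length r and, because N ≤ q r, residue classes modulo q have at most r elements, so
    -- the induction hypothesis covers both rounds. Afterwards positions in the wrong order are less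
    -- than q² apart, and two rounds of windows of 2 q² values, one gate per window, complete the
    -- sorting.
    obtain ⟨S₁, h₁, y₁, hy₁, hs₁⟩ := ih.within
      (fun i : Fin N => (⟨((i : ℕ) + 0) / r, hbd i 0 r⟩ : Fin (N + 0 + 1)))
      (fun b => by simpa [Fin.ext_iff] using card_block_le (N := N) (b := b) 0 hr0) hx
    obtain ⟨S₂, h₂, y₂, hy₂, hs₂⟩ := ih.within
      (fun i : Fin N => (⟨(i : ℕ) % q, Nat.mod_lt _ hq⟩ : Fin q))
      (fun b => by simpa [Fin.ext_iff] using card_class_le_ceil (N := N) (b := b) hNr) hy₁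
    obtain ⟨S₃, h₃, y₃, hy₃, hs₃⟩ := hG.within
      (fun i : Fin N => (⟨((i : ℕ) + 0) / (2 * (q * q)), hbd i 0 _⟩ : Fin (N + 0 + 1)))
      (fun b => by
        simpa [Fin.ext_iff] using card_block_le (N := N) (b := b) 0 (by omega : 0 < 2 * (q * q)))
      hy₂
    obtain ⟨S₄, h₄, y₄, hy₄, hs₄⟩ := hG.within
      (fun i : Fin N => (⟨((i : ℕ) + q * q) / (2 * (q * q)), hbd i (q * q) _⟩ :
        Fin (N + q * q + 1)))
      (fun b => by
        simpa [Fin.ext_iff] using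
          card_block_le (N := N) (b := b) (q * q) (by omega : 0 < 2 * (q * q)))
      hy₃
    refine ⟨S₄, (((h₁.trans h₂).trans h₃).trans h₄).mono ?_, y₄, hy₄, fun ω => ?_⟩
    · simp only [sortCost]; apply le_of_eq; ring
    · have cast : ∀ {t : ℕ} {f : Fin N → ℕ} {hf : ∀ i, f i < t} {x y : Fin N → α},
          SortedWithin (fun i => (⟨f i, hf i⟩ : Fin t)) key x y → SortedWithin f key x y := by
        intro t f hf x y h
        obtain ⟨σ, h1, h2⟩ := h.perm
        exact ⟨⟨σ, fun i => congrArg Fin.val (h1 i), h2⟩, fun i j hij => h.mono i j (Fin.ext hij)⟩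
      have k₁ := cast (hs₁ ω)
      have k₂ := cast (hs₂ ω)
      have k₃ := cast (hs₃ ω)
      have k₄ := cast (hs₄ ω)
      simp only [Nat.add_zero] at k₁ k₃
      have hn := nearlySorted_of_blocks_of_classes hq hNr k₁ k₂
      obtain ⟨σ₁, -, p₁⟩ := k₁.perm
      obtain ⟨σ₂, -, p₂⟩ := k₂.perm
      obtain ⟨σ₃, -, p₃⟩ := k₃.perm
      obtain ⟨σ₄, -, p₄⟩ := k₄.perm
      exact ⟨((σ₄.trans σ₃).trans σ₂).trans σ₁, fun i => by simp [p₁, p₂, p₃, p₄],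
        fun i j hij => hn.sorted k₃ k₄ i j hij⟩

end

end Circuit

/-! ### Table lookup -/

namespace Circuit

section

variable {Ω : Type} {L B q J : ℕ} {S : Set (Ω → ℕ)}

/-- Sorting, where the applied permutation is available. -/
theorem exists_step_sort {N : ℕ} {α : Type} [Finite α] (hq : 0 < q) (hL : 2 * (q * q) ≤ L)
    (hB : 0 < B) (hα : N * Nat.card α ≤ B) (hN : N ≤ q ^ J * (2 * (q * q))) (key : α → ℕ)
    {x : Fin N → Ω → α} (hx : ∀ i, Avail S (x i)) :
    ∃ S', Step L B (sortCost J * N) S S' ∧ ∃ σ : Ω → Equiv.Perm (Fin N),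
      (∀ p, Avail S' (fun ω => σ ω p)) ∧ (∀ p, Avail S' (fun ω => x (σ ω p) ω)) ∧
      ∀ ω p p', p ≤ p' → key (x (σ ω p) ω) ≤ key (x (σ ω p') ω) := by
  -- Tagging every value with its index makes the permutation part of the output.
  obtain ⟨S', h, y, hy, hs⟩ := sortsUpTo (Ω := Ω) (key := fun a : Fin N × α => key a.2) hB
    (by simpa [Nat.card_prod] using hα) hq hL J N hN S (fun i ω => (i, x i ω))
    (fun i => (hx i).map fun a => (i, a))
  choose σ h1 h2 using hs
  refine ⟨S', h, σ, fun p => ?_, fun p => ?_, fun ω p p' hpp => ?_⟩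
  · have := (hy p).map Prod.fst
    simpa only [h1] using this
  · have := (hy p).map Prod.snd
    simpa only [h1] using this
  · simpa only [h1] using h2 ω p p' hpp

/-- Undoing a permutation. -/
theorem exists_step_unsort {N : ℕ} {γ : Type} [Finite γ] (hq : 0 < q) (hL : 2 * (q * q) ≤ L)
    (hB : 0 < B) (hγ : N * Nat.card γ ≤ B) (hN : N ≤ q ^ J * (2 * (q * q)))
    {σ : Ω → Equiv.Perm (Fin N)} (hσ : ∀ p, Avail S (fun ω => σ ω p)) {z : Fin N → Ω → γ}
    (hz : ∀ i, Avail S (z i)) :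
    ∃ S', Step L B ((sortCost J + 3) * N) S S' ∧
      ∀ i, Avail S' (fun ω => z ((σ ω).symm i) ω) := by
  have hL2 : 2 ≤ L := by have := Nat.mul_pos hq hq; omega
  have hc : Nat.card (Fin N × γ) ≤ B := by simpa [Nat.card_prod] using hγ
  obtain ⟨S₁, h₁, h₁'⟩ := exists_step_zip (S := S) (L := L) (B := B) hL2 hc hB hσ hz
    (fun _ a b => (a, b))
  obtain ⟨S₂, h₂, y, hy, hs⟩ := sortsUpTo (Ω := Ω) (key := fun a : Fin N × γ => (a.1 : ℕ)) hB hc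
    hq hL J N hN S₁ (fun p ω => (σ ω p, z p ω)) h₁'
  refine ⟨S₂, (h₁.trans h₂).mono (by simp only [Fintype.card_fin]; apply le_of_eq; ring),
    fun i => ?_⟩
  have hyi : ∀ ω, y i ω = (i, z ((σ ω).symm i) ω) := by
    intro ω
    obtain ⟨τ, h1, h2⟩ := hs ω
    -- Sorting by first components makes σ ∘ τ an increasing permutation of `Fin N`, hence the
    -- identity; so position i receives the value kept at σ⁻¹ i.
    have hmono : StrictMono fun p => σ ω (τ p) := by
      refine Monotone.strictMono_of_injective (fun p p' hpp => ?_)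
        ((σ ω).injective.comp τ.injective)
      have := h2 p p' hpp
      simp only [h1] at this
      exact this
    have hid : (fun p => σ ω (τ p)) = id := by
      refine (StrictMono.range_inj hmono strictMono_id).1 ?_
      exact ((σ ω).surjective.comp τ.surjective).range_eq.trans Set.range_id.symm
    have hi : σ ω (τ i) = i := congrFun hid i
    rw [h1, hi, ← hi, Equiv.symm_apply_apply, hi]
  have := (hy i).map Prod.snd
  simpa only [hyi] using this

/-- `f` looks up a value with the given key in the partial association list `d`. -/
structure IsLookup {ι κ β : Type*} (d : ι → Option (κ × β)) (f : κ → Option β) : Prop where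
  exists_of_eq_some : ∀ k b, f k = some b → ∃ i, d i = some (k, b)
  ne_of_eq_none : ∀ k, f k = none → ∀ i b, d i ≠ some (k, b)

/-- The state of the scan that remembers the last entry. -/
theorem scan_spec {β : Type*} {X st : ℕ → Option β} (h0 : st 0 = none)
    (h : ∀ p, st (p + 1) = (X p).or (st p)) (p : ℕ) :
    (st p = none ∧ ∀ p' < p, X p' = none) ∨
      ∃ p' < p, st p = X p' ∧ X p' ≠ none ∧ ∀ p'', p' < p'' → p'' < p → X p'' = none := by
  induction p with
  | zero => exact Or.inl ⟨h0, by simp⟩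
  | succ p ih =>
    rw [h]
    rcases hX : X p with _ | b
    · rw [Option.none_or]
      rcases ih with ⟨h1, h2⟩ | ⟨p', h1, h2, h3, h4⟩
      · refine Or.inl ⟨h1, fun p' hp' => ?_⟩
        rcases Nat.lt_succ_iff_lt_or_eq.1 hp' with hp' | rfl
        exacts [h2 _ hp', hX]
      · refine Or.inr ⟨p', by omega, h2, h3, fun p'' h5 h6 => ?_⟩
        rcases Nat.lt_succ_iff_lt_or_eq.1 h6 with h6 | rfl
        exacts [h4 _ h5 h6, hX]
    · exact Or.inr ⟨p, by omega, by rw [hX]; rfl, by simp [hX], fun p'' h5 h6 => by omega⟩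

/-- The cost per item of `exists_step_lookup`. -/
def lookupCost (J : ℕ) : ℕ := 2 * sortCost J + 9

/-- The entries that `lookup` sorts: data or queries. -/
theorem isLookup_of_sorted {κ β : Type} {N : ℕ} {e : κ → ℕ} (he : Function.Injective e)
    {y : Fin N → Option (κ × β) ⊕ κ} {key : Option (κ × β) ⊕ κ → ℕ}
    (hkd : ∀ k b, key (Sum.inl (some (k, b))) = 2 * e k) (hkq : ∀ k, key (Sum.inr k) = 2 * e k + 1)
    (hy : ∀ p p', p ≤ p' → key (y p) ≤ key (y p')) {X st : ℕ → Option (κ × β)}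
    (hX : ∀ p : Fin N, X p = (y p).elim id fun _ => none) (hXN : ∀ p, N ≤ p → X p = none)
    (h0 : st 0 = none) (hst : ∀ p, st (p + 1) = (X p).or (st p)) :
    ∃ f : κ → Option β, IsLookup (fun p => (y p).elim id fun _ => none) f ∧
      ∀ p k, y p = Sum.inr k →
        f k = (st p).bind fun a => if e a.1 = e k then some a.2 else none := by
  classical
  have hyX : ∀ (p : ℕ) k b, X p = some (k, b) → ∃ h : p < N, y ⟨p, h⟩ = Sum.inl (some (k, b)) := by
    intro p k b hp
    have h : p < N := by
      by_contra hge
      rw [hXN p (not_lt.1 hge)] at hp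
      cases hp
    refine ⟨h, ?_⟩
    have := hX ⟨p, h⟩
    simp only [hp] at this
    rcases hyp : y ⟨p, h⟩ with a | a
    · rw [hyp] at this
      simp only [Sum.elim_inl, id] at this
      rw [this]
    · rw [hyp] at this
      cases this
  have hXy : ∀ (p : Fin N) a, y p = Sum.inl (some a) → X p = some a := by
    intro p a hp
    rw [hX, hp]
    rfl
  -- The value for k is taken from the last entry with key k in sorted order, which is what the scan
  -- remembers at each query for k. So all queries for k get the same answer, even if the key occurs
  -- several times.
  have main : ∀ k, ∃ r : Option β,
      (∀ b, r = some b → ∃ p, (y p).elim id (fun _ => none) = some (k, b)) ∧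
      (r = none → ∀ p b, (y p).elim id (fun _ => none) ≠ some (k, b)) ∧
      ∀ p, y p = Sum.inr k → r = (st p).bind fun a => if e a.1 = e k then some a.2 else none := by
    intro k
    set D : Finset (Fin N) := Finset.univ.filter fun p => ∃ b, y p = Sum.inl (some (k, b)) with hD
    rcases D.eq_empty_or_nonempty with hemp | hne
    · have hno : ∀ (p : ℕ) b, X p ≠ some (k, b) := by
        intro p b hp
        obtain ⟨hp1, hp2⟩ := hyX p k b hp
        have : (⟨p, hp1⟩ : Fin N) ∈ D := by simp only [hD, Finset.mem_filter_univ]; exact ⟨b, hp2⟩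
        rw [hemp] at this
        simp at this
      refine ⟨none, by simp, fun _ p b => by rw [← hX]; exact hno p b, fun p hp => ?_⟩
      rcases scan_spec h0 hst p with ⟨h1, -⟩ | ⟨p', -, h2, -, -⟩
      · rw [h1]; rfl
      · rw [h2]
        rcases hXp : X p' with _ | ⟨k', b⟩
        · rfl
        · have : e k' ≠ e k := fun h => hno p' b (by rw [hXp, he h])
          simp [this]
    · have hmem := D.max'_mem hne
      set m := D.max' hne with hm
      obtain ⟨b, hb⟩ : ∃ b, y m = Sum.inl (some (k, b)) := by
        simpa [hD] using hmem
      refine ⟨some b, ?_, by simp, fun p hp => ?_⟩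
      · rintro b' ⟨⟩
        exact ⟨m, by rw [hb]; rfl⟩
      have hmp : m < p := by
        by_contra hge
        have := hy _ _ (not_lt.1 hge)
        rw [hb, hp, hkd, hkq] at this
        omega
      rcases scan_spec h0 hst p with ⟨-, h2⟩ | ⟨p', h1, h2, h3, h4⟩
      · have := h2 m hmp
        rw [hXy m _ hb] at this
        cases this
      · rcases hXp : X p' with _ | ⟨k', b'⟩
        · exact absurd hXp h3
        obtain ⟨hp'N, hyp'⟩ := hyX p' k' b' hXp
        have hle : (m : ℕ) ≤ p' := by
          by_contra hlt
          have := h4 m (not_le.1 hlt) hmp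
          rw [hXy m _ hb] at this
          cases this
        have hk1 := hy m ⟨p', hp'N⟩ hle
        have hk2 := hy ⟨p', hp'N⟩ p h1.le
        rw [hb, hyp', hkd, hkd] at hk1
        rw [hp, hyp', hkd, hkq] at hk2
        have hkk : k' = k := he (by omega)
        subst hkk
        have hin : (⟨p', hp'N⟩ : Fin N) ∈ D := by
          simp only [hD, Finset.mem_filter_univ]; exact ⟨b', hyp'⟩
        have hle' : (⟨p', hp'N⟩ : Fin N) ≤ m := D.le_max' _ hin
        have heq : (⟨p', hp'N⟩ : Fin N) = m := le_antisymm hle' hle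
        rw [heq, hb] at hyp'
        cases hyp'
        rw [h2, hXp]
        simp
  choose f hf1 hf2 hf3 using main
  exact ⟨f, ⟨hf1, hf2⟩, fun p k hp => hf3 k p hp⟩

/-- Looking up keys in an association list. -/
theorem exists_step_lookup {ι ι' κ β : Type} [Fintype ι] [Fintype ι'] [Finite κ] [Finite β]
    (hq : 0 < q) (hL : 2 * (q * q) ≤ L)
    (hB : (Fintype.card ι + Fintype.card ι' + 1) * ((Nat.card κ + 1) * (Nat.card β + 1)) ≤ B)
    (hN : Fintype.card ι + Fintype.card ι' ≤ q ^ J * (2 * (q * q)))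
    {d : ι → Ω → Option (κ × β)} (hd : ∀ i, Avail S (d i)) {r : ι' → Ω → κ}
    (hr : ∀ i, Avail S (r i)) :
    ∃ S', Step L B (lookupCost J * (Fintype.card ι + Fintype.card ι')) S S' ∧
      ∃ f : Ω → κ → Option β, (∀ ω, IsLookup (fun i => d i ω) (f ω)) ∧
        ∀ i, Avail S' (fun ω => f ω (r i ω)) := by
  classical
  set N := Fintype.card ι + Fintype.card ι' with hNdef
  have hL2 : 2 ≤ L := by have := Nat.mul_pos hq hq; omega
  set kk := Nat.card κ
  set bb := Nat.card β
  have hB1 : N * (kk * bb + 1 + kk) ≤ B := by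
    refine le_trans ?_ hB
    apply Nat.mul_le_mul <;> nlinarith
  have hB2 : N * (bb + 1) ≤ B := by
    refine le_trans ?_ hB
    apply Nat.mul_le_mul <;> nlinarith
  have hB3 : kk * bb + 1 ≤ B := by
    refine le_trans ?_ hB
    calc kk * bb + 1 ≤ 1 * ((kk + 1) * (bb + 1)) := by nlinarith
      _ ≤ _ := Nat.mul_le_mul (by omega) le_rfl
  have hB4 : bb + 1 ≤ B := by
    refine le_trans ?_ hB
    calc bb + 1 ≤ 1 * ((kk + 1) * (bb + 1)) := by nlinarith
      _ ≤ _ := Nat.mul_le_mul (by omega) le_rfl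
  have hBpos : 0 < B := by omega
  rcases Nat.eq_zero_or_pos N with hN0 | hNpos
  · have : IsEmpty ι' := Fintype.card_eq_zero_iff.1 (by omega)
    have : IsEmpty ι := Fintype.card_eq_zero_iff.1 (by omega)
    exact ⟨S, .refl _, fun _ _ => none, fun ω => ⟨by simp, fun k _ i => isEmptyElim i⟩,
      fun i => isEmptyElim i⟩
  let E : ι ⊕ ι' ≃ Fin N := Fintype.equivFinOfCardEq (by simp [hNdef])
  let e : κ → ℕ := fun k => Finite.equivFin κ k
  have he : Function.Injective e := fun a b h => (Finite.equivFin κ).injective (Fin.ext h)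
  -- Codes 2 e k for data and 2 e k + 1 for queries put the entries for a key directly before the
  -- queries for it. Empty entries get code 0, which is harmless since the scan skips them.
  let key : Option (κ × β) ⊕ κ → ℕ := Sum.elim (fun o => o.elim 0 fun a => 2 * e a.1)
    fun k => 2 * e k + 1
  let x : Fin N → Ω → Option (κ × β) ⊕ κ := fun p ω =>
    Sum.elim (fun i => Sum.inl (d i ω)) (fun i => Sum.inr (r i ω)) (E.symm p)
  have hx : ∀ p, Avail S (x p) := by
    intro p
    rcases hp : E.symm p with i | i
    · simpa only [x, hp, Sum.elim_inl] using (hd i).map _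
    · simpa only [x, hp, Sum.elim_inr] using (hr i).map _
  have : Finite (Option (κ × β) ⊕ κ) := inferInstance
  obtain ⟨S₁, h₁, σ, hσ, hxσ, hsort⟩ := exists_step_sort hq hL hBpos
    (by simpa [Nat.card_sum, Nat.card_prod, Finite.card_option] using hB1) hN key hx
  have hS₁ : S₁.Nonempty := by
    obtain ⟨u, hu, -⟩ := hσ ⟨0, hNpos⟩
    exact ⟨u, hu⟩
  let X : ℕ → Ω → Option (κ × β) := fun p ω =>
    if h : p < N then (x (σ ω ⟨p, h⟩) ω).elim id fun _ => none else none
  let st : ℕ → Ω → Option (κ × β) := fun p ω =>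
    Nat.rec none (fun p s => (X p ω).or s) p
  have hXav : ∀ p < N, Avail S₁ (X p) := by
    intro p hp
    simp only [X, hp, dite_true]
    exact (hxσ ⟨p, hp⟩).map fun a => a.elim id fun _ => none
  obtain ⟨S₂, h₂, hst⟩ := exists_step_scan (N := N) (σ := Option (κ × β)) (B := B) (st := st) hL2
    (by simpa [Nat.card_prod, Finite.card_option] using hB3) hBpos hXav
    (avail_const hS₁ _) (fun a s => a.or s) (fun i _ ω => rfl)
  let G : Option (κ × β) ⊕ κ → Option (κ × β) → Option β := fun a s =>
    a.elim (fun _ => none) fun k => s.bind fun a => if e a.1 = e k then some a.2 else none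
  obtain ⟨S₃, h₃, hz⟩ := exists_step_zip (ι := Fin N) (B := B) (S := S₂) hL2
    (by simpa [Finite.card_option] using hB4) hBpos (fun p => (hxσ p).step h₂)
    (fun p => hst (p : ℕ) p.2.le) (fun _ a s => G a s)
  obtain ⟨S₄, h₄, hw⟩ := exists_step_unsort (S := S₃) hq hL hBpos
    (by simpa [Finite.card_option] using hB2) hN (fun p => ((hσ p).step h₂).step h₃) hz
  have hf : ∀ ω, ∃ f : κ → Option β, IsLookup (fun i => d i ω) f ∧
      ∀ p k, x (σ ω p) ω = Sum.inr k → f k = G (x (σ ω p) ω) (st p ω) := by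
    intro ω
    obtain ⟨f, hf, hf'⟩ := isLookup_of_sorted (y := fun p => x (σ ω p) ω) (key := key) he
      (fun k b => rfl) (fun k => rfl) (hsort ω) (X := fun p => X p ω) (st := fun p => st p ω)
      (fun p => by simp [X]) (fun p hp => by simp [X, not_lt.2 hp]) rfl (fun p => rfl)
    refine ⟨f, ⟨fun k b hkb => ?_, fun k hk i b hd => ?_⟩, fun p k hp => ?_⟩
    · obtain ⟨p, hp⟩ := hf.exists_of_eq_some k b hkb
      rcases hi : E.symm (σ ω p) with i | i
      · simp only [x, hi] at hp
        exact ⟨i, hp⟩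
      · simp only [x, hi] at hp
        cases hp
    · refine hf.ne_of_eq_none k hk ((σ ω).symm (E (Sum.inl i))) b ?_
      simp [x, hd]
    · rw [hf' p k hp, hp]
      rfl
  choose f hf hf' using hf
  refine ⟨S₄, (((h₁.trans h₂).trans h₃).trans h₄).mono ?_, f, hf, fun i => ?_⟩
  · simp only [lookupCost, Fintype.card_fin]; apply le_of_eq; ring
  · refine (hw (E (Sum.inr i))).of_det fun ω ω' h => ?_
    have hx' : ∀ ω, x (E (Sum.inr i)) ω = Sum.inr (r i ω) := fun ω => by simp [x]
    have := fun ω => hf' ω ((σ ω).symm (E (Sum.inr i))) (r i ω)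
      (by rw [Equiv.apply_symm_apply, hx'])
    rw [this, this]
    exact h

/-- Prefix counts. -/
theorem exists_step_count {N : ℕ} (hL : 2 ≤ L) (hB : N + 1 ≤ B) {a : Fin N → Ω → Bool}
    (ha : ∀ i, Avail S (a i)) :
    ∃ S', Step L B (3 * N) S S' ∧ ∀ i : Fin N, Avail S' (fun ω =>
      (Finset.univ.filter fun j : Fin N => j < i ∧ a j ω = true).card) := by
  classical
  rcases Nat.eq_zero_or_pos N with hN0 | hNpos
  · subst hN0
    exact ⟨S, .refl _, fun i => i.elim0⟩
  have hS : S.Nonempty := by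
    obtain ⟨u, hu, -⟩ := ha ⟨0, hNpos⟩
    exact ⟨u, hu⟩
  have hle : ∀ (p : ℕ) ω, (Finset.univ.filter fun j : Fin N => (j : ℕ) < p ∧ a j ω = true).card <
      N + 1 := fun p ω => Nat.lt_succ_of_le ((Finset.card_le_univ _).trans (by simp))
  let st : ℕ → Ω → Fin (N + 1) := fun p ω => ⟨_, hle p ω⟩
  have hst : ∀ (p : ℕ) (hp : p < N) ω, (st (p + 1) ω : ℕ) =
      (if a ⟨p, hp⟩ ω = true then 1 else 0) + st p ω := by
    intro p hp ω
    have : (Finset.univ.filter fun j : Fin N => (j : ℕ) < p + 1 ∧ a j ω = true) =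
        (Finset.univ.filter fun j : Fin N => j = ⟨p, hp⟩ ∧ a j ω = true) ∪
        (Finset.univ.filter fun j : Fin N => (j : ℕ) < p ∧ a j ω = true) := by
      ext j
      simp only [Finset.mem_union, Finset.mem_filter_univ, Fin.ext_iff]
      constructor
      · rintro ⟨h1, h2⟩
        rcases Nat.lt_succ_iff_lt_or_eq.1 h1 with h | h
        exacts [Or.inr ⟨h, h2⟩, Or.inl ⟨h, h2⟩]
      · rintro (⟨h1, h2⟩ | ⟨h1, h2⟩)
        exacts [⟨by omega, h2⟩, ⟨by omega, h2⟩]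
    simp only [st]
    rw [this, Finset.card_union_of_disjoint]
    · congr 1
      rw [Finset.filter_and, Finset.filter_eq']
      by_cases h : a ⟨p, hp⟩ ω = true <;> simp [h]
    · rw [Finset.disjoint_left]
      intro j hj hj'
      simp only [Finset.mem_filter_univ, Fin.ext_iff] at hj hj'
      omega
  obtain ⟨S', h, h'⟩ := exists_step_scan (N := N) (σ := Fin (N + 1)) (B := B)
    (x := fun p ω => if h : p < N then a ⟨p, h⟩ ω else false) (st := st) hL (by simpa using hB)
    (by omega) (fun p hp => by simpa only [hp, dite_true] using ha ⟨p, hp⟩)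
    ((avail_const hS (0 : Fin (N + 1))).of_det fun ω ω' _ => by simp [st])
    (fun b s => if hs : (if b = true then 1 else 0) + (s : ℕ) < N + 1 then ⟨_, hs⟩ else 0)
    (fun p hp ω => by
      have h1 := hst p hp ω
      have h2 := (st (p + 1) ω).2
      rw [h1] at h2
      simp only [hp, dite_true, h2]
      exact Fin.ext h1)
  exact ⟨S', h, fun i => (h' i i.2.le).of_det fun ω ω' h => congrArg Fin.val h⟩

/-- Finding a candidate that passes the most tests. -/
theorem exists_step_best {N : ℕ} {Θ α : Type} [Fintype Θ] [Nonempty Θ]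
    (hL : 2 * Fintype.card Θ ≤ L) (hB : N + 1 ≤ B) (hΘ : Fintype.card Θ ≤ B) {x : Fin N → Ω → α}
    (hx : ∀ i, Avail S (x i)) (hS : S.Nonempty) (test : Θ → α → Bool) :
    ∃ S', Step L B (3 * N + 5 * Fintype.card Θ) S S' ∧ ∃ best : Ω → Θ, Avail S' best ∧
      ∀ ω θ, (Finset.univ.filter fun i => test θ (x i ω) = true).card ≤
        (Finset.univ.filter fun i => test (best ω) (x i ω) = true).card := by
  classical
  set h := Fintype.card Θ with hh
  have hpos : 0 < h := Fintype.card_pos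
  have hle : ∀ (p : ℕ) θ ω, (Finset.univ.filter fun j : Fin N =>
      (j : ℕ) < p ∧ test θ (x j ω) = true).card < N + 1 :=
    fun p θ ω => Nat.lt_succ_of_le ((Finset.card_le_univ _).trans (by simp))
  -- All |Θ| counters advance together over blocks of |Θ| values: one gate reads at most 2 |Θ| words
  -- and writes |Θ|, so a full block costs 3 words per value, whatever the size of Θ.
  let C : ℕ → Θ → Ω → Fin (N + 1) := fun b θ ω => ⟨_, hle (b * h) θ ω⟩
  have key : ∀ b : ℕ, ∃ S', Step L B (3 * h * b) S S' ∧ ∀ θ, Avail S' (C b θ) := by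
    intro b
    induction b with
    | zero =>
      exact ⟨S, .refl _, fun θ => (avail_const hS (0 : Fin (N + 1))).of_det fun ω ω' _ => by
        simp [C]⟩
    | succ b ih =>
      obtain ⟨S₁, h₁, h₁'⟩ := ih
      have hcard : Fintype.card {i : Fin N // (i : ℕ) / h = b} ≤ h := by
        simpa using card_block_le (N := N) (n := h) (b := b) 0 hpos
      obtain ⟨S₂, h₂, h₂'⟩ := exists_step_gate (S := S₁) (L := L) (B := B)
        (ι := Θ ⊕ {i : Fin N // (i : ℕ) / h = b}) (κ := Θ) (β := Fin (N + 1))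
        (x := fun i ω => i.elim (fun θ => (Sum.inl (C b θ ω) : Fin (N + 1) ⊕ α))
          (fun i : {i : Fin N // (i : ℕ) / h = b} => Sum.inr (x i.1 ω)))
        (y := C (b + 1)) (by rw [Fintype.card_sum]; omega) (by simpa using hB) (by omega)
        (by
          rintro (θ | i)
          · exact (h₁' θ).map _
          · exact ((hx i).step h₁).map _)
        (by
          intro θ ω ω' hωω
          have hc : ∀ θ, C b θ ω = C b θ ω' := fun θ => by simpa using hωω (Sum.inl θ)
          have hb : ∀ i : Fin N, (i : ℕ) / h = b → x i ω = x i ω' := fun i hi => by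
            simpa using hωω (Sum.inr ⟨i, hi⟩)
          have hC : ∀ ω, (C (b + 1) θ ω : ℕ) = C b θ ω +
              (Finset.univ.filter fun j : Fin N =>
                (j : ℕ) / h = b ∧ test θ (x j ω) = true).card := by
            intro ω
            simp only [C]
            rw [← Finset.card_union_of_disjoint]
            · congr 1
              ext j
              simp only [Finset.mem_union, Finset.mem_filter_univ, ← or_and_right]
              refine and_congr_left fun _ => ?_
              rw [← Nat.div_lt_iff_lt_mul hpos, ← Nat.div_lt_iff_lt_mul hpos]
              omega
            · rw [Finset.disjoint_left]
              intro j hj hj'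
              simp only [Finset.mem_filter_univ] at hj hj'
              have := (Nat.div_lt_iff_lt_mul hpos).2 hj.1
              omega
          apply Fin.ext
          rw [hC, hC, hc]
          congr 2
          ext j
          simp only [Finset.mem_filter_univ]
          refine and_congr_right fun hj => ?_
          rw [hb j hj])
      refine ⟨S₂, (h₁.trans h₂).mono ?_, h₂'⟩
      rw [Fintype.card_sum]
      have : 3 * h * (b + 1) = 3 * h * b + 3 * h := by ring
      omega
  obtain ⟨S₁, h₁, h₁'⟩ := key (N / h + 1)
  have hbest : ∀ c : Θ → Fin (N + 1), ∃ θ, ∀ θ', c θ' ≤ c θ := fun c =>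
    Finite.exists_max c
  choose best hbest using hbest
  obtain ⟨S₂, h₂, h₂'⟩ := exists_step_gate (S := S₁) (L := L) (B := B) (ι := Θ) (κ := Unit)
    (β := Θ) (x := C (N / h + 1)) (y := fun _ ω => best fun θ => C (N / h + 1) θ ω) (by omega)
    (by simpa using hΘ) (by omega) h₁' (by
      intro _ ω ω' hωω
      simp only [hωω])
  refine ⟨S₂, (h₁.trans h₂).mono ?_, _, h₂' (), fun ω θ => ?_⟩
  · have := Nat.mul_div_le N h
    have e : 3 * h * (N / h + 1) = 3 * (h * (N / h)) + 3 * h := by ring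
    rw [e, Fintype.card_unit]
    omega
  · have hall : ∀ θ, (C (N / h + 1) θ ω : ℕ) =
        (Finset.univ.filter fun i => test θ (x i ω) = true).card := by
      intro θ
      simp only [C]
      congr 1
      ext j
      simp only [Finset.mem_filter_univ, and_iff_right_iff_imp]
      intro _
      rw [← Nat.div_lt_iff_lt_mul hpos]
      exact Nat.lt_succ_of_le (Nat.div_le_div_right j.2.le)
    rw [← hall, ← hall]
    exact hbest (fun θ => C (N / h + 1) θ ω) θ

end

end Circuit

/-! ### Matching edges to their endpoints by contraction -/

namespace Orientation

section

variable {E V : Type*}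

/-- A matching of edges `i` (with at most two endpoints `e i false`, `e i true`) to endpoints. -/
structure IsMatching (e : E → Bool → Option V) (y : E → Option Bool) : Prop where
  ne_none : ∀ i b, y i = some b → e i b ≠ none
  inj : ∀ i j b c, y i = some b → y j = some c → e i b = e j c → i = j

open Classical in
/-- The number of matched edges. -/
noncomputable def size [Fintype E] (y : E → Option Bool) : ℕ :=
  (Finset.univ.filter fun i => y i ≠ none).card

open Classical in
/-- The number of edges that have an endpoint. -/
noncomputable def alive [Fintype E] (e : E → Bool → Option V) : ℕ :=
  (Finset.univ.filter fun i => ∃ b, e i b ≠ none).card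

/-- `y` is a maximum matching, provided that some matching misses at most `s` edges. -/
def Good [Fintype E] (e : E → Bool → Option V) (s : ℕ) (y : E → Option Bool) : Prop :=
  (∃ a, IsMatching e a ∧ alive e ≤ size a + s) →
    IsMatching e y ∧ ∀ a, IsMatching e a → size a ≤ size y

open Classical in
/-- The other endpoint of an edge (none for loops). -/
noncomputable def other (e : E → Bool → Option V) (i : E) (b : Bool) : Option V :=
  if e i (!b) = e i b then none else e i (!b)

theorem isMatching_none (e : E → Bool → Option V) : IsMatching e fun _ => none :=
  ⟨by simp, by simp⟩

open Classical in
/-- Contracting one edge costs at most one matched edge. -/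
theorem IsMatching.contract_one [Fintype E] {e : E → Bool → Option V} {a : E → Option Bool}
    (ha : IsMatching e a) {i : E} {b : Bool} {v : V} (hv : e i b = some v)
    {e' : E → Bool → Option V}
    (he' : ∀ f c, e' f c = if f = i then none else
      (e f c).bind fun x => if x = v then other e i b else some x) :
    ∃ a', IsMatching e' a' ∧ size a ≤ size a' + 1 := by
  -- Under `Q` the edge i is matched to its other end. Deleting i frees that end, and an edge
  -- matched to v can keep its place at the merged vertex. Otherwise the edge matched to v, possibly
  -- i itself, is dropped. Either way at most one matched edge is lost.
  let Q : Prop := ∃ c', a i = some c' ∧ e i c' ≠ some v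
  have hQ : Q → ∃ c', a i = some c' ∧ e i c' = other e i b ∧ other e i b ≠ none := by
    rintro ⟨c', h1, h2⟩
    have hc : c' = !b := by
      cases c' <;> cases b <;> simp_all
    subst hc
    have h3 : e i (!b) = other e i b := by
      rw [other, if_neg]
      rw [hv]
      exact h2
    exact ⟨_, h1, h3, h3 ▸ ha.ne_none _ _ h1⟩
  let a' : E → Option Bool := fun f => if f = i then none else
    (a f).bind fun c => if e f c = some v then (if Q then some c else none) else some c
  have ha' : ∀ f c, a' f = some c → f ≠ i ∧ a f = some c ∧ (e f c = some v → Q) := by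
    intro f c h
    simp only [a'] at h
    by_cases hf : f = i
    · simp [hf] at h
    rw [if_neg hf] at h
    rcases hc : a f with _ | c'
    · simp [hc] at h
    · rw [hc, Option.bind_some] at h
      by_cases h1 : e f c' = some v
      · rw [if_pos h1] at h
        by_cases h2 : Q
        · rw [if_pos h2] at h
          exact ⟨hf, h, fun _ => h2⟩
        · simp [h2] at h
      · rw [if_neg h1] at h
        cases h
        exact ⟨hf, rfl, fun h => absurd h h1⟩
  have hev : ∀ f c, f ≠ i → e f c = some v → e' f c = other e i b := by
    intro f c hf h
    rw [he', if_neg hf, h]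
    simp
  have hen : ∀ f c, f ≠ i → e f c ≠ some v → e' f c = e f c := by
    intro f c hf h
    rw [he', if_neg hf]
    rcases hx : e f c with _ | x
    · rfl
    · have : x ≠ v := fun h' => h (by rw [hx, h'])
      simp [this]
  refine ⟨a', ⟨fun f c h => ?_, fun f g c d hf hg hfg => ?_⟩, ?_⟩
  · obtain ⟨h1, h2, h3⟩ := ha' f c h
    by_cases h4 : e f c = some v
    · rw [hev f c h1 h4]
      obtain ⟨-, -, -, h5⟩ := hQ (h3 h4)
      exact h5
    · rw [hen f c h1 h4]
      exact ha.ne_none _ _ h2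
  · obtain ⟨h1, h2, h3⟩ := ha' f c hf
    obtain ⟨k1, k2, k3⟩ := ha' g d hg
    by_cases h4 : e f c = some v <;> by_cases k4 : e g d = some v
    · exact ha.inj _ _ _ _ h2 k2 (h4.trans k4.symm)
    · rw [hev f c h1 h4, hen g d k1 k4] at hfg
      obtain ⟨c', h5, h6, -⟩ := hQ (h3 h4)
      exact absurd (ha.inj _ _ _ _ k2 h5 (hfg.symm.trans h6.symm)) k1
    · rw [hev g d k1 k4, hen f c h1 h4] at hfg
      obtain ⟨c', h5, h6, -⟩ := hQ (k3 k4)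
      exact absurd (ha.inj _ _ _ _ h2 h5 (hfg.trans h6.symm)) h1
    · rw [hen f c h1 h4, hen g d k1 k4] at hfg
      exact ha.inj _ _ _ _ h2 k2 hfg
  · have hone : ((Finset.univ.filter fun f => a f ≠ none) \
        (Finset.univ.filter fun f => a' f ≠ none)).card ≤ 1 := by
      have hmem : ∀ f, f ∈ ((Finset.univ.filter fun f => a f ≠ none) \
        (Finset.univ.filter fun f => a' f ≠ none)) →
          f = i ∧ a i ≠ none ∨ f ≠ i ∧ ¬ Q ∧ ∃ c, a f = some c ∧ e f c = some v := by
        intro f hf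
        simp only [Finset.mem_sdiff, Finset.mem_filter_univ, not_not] at hf
        obtain ⟨h1, h2⟩ := hf
        by_cases hfi : f = i
        · exact Or.inl ⟨hfi, hfi ▸ h1⟩
        · obtain ⟨c, hc⟩ := Option.ne_none_iff_exists'.1 h1
          simp only [a', if_neg hfi, hc, Option.bind_some] at h2
          by_cases h3 : e f c = some v
          · by_cases h4 : Q
            · simp [h3, h4] at h2
            · exact Or.inr ⟨hfi, h4, c, hc, h3⟩
          · simp [h3] at h2
      have hQn : ¬ Q → a i ≠ none → ∃ c, a i = some c ∧ e i c = some v := by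
        intro h1 h2
        obtain ⟨c, hc⟩ := Option.ne_none_iff_exists'.1 h2
        refine ⟨c, hc, ?_⟩
        by_contra h3
        exact h1 ⟨c, hc, h3⟩
      rw [Finset.card_le_one]
      intro f hf g hg
      rcases hmem f hf with ⟨rfl, h1⟩ | ⟨h1, h2, c, h3, h4⟩ <;>
        rcases hmem g hg with ⟨rfl, k1⟩ | ⟨k1, k2, d, k3, k4⟩
      · rfl
      · obtain ⟨c, h3, h4⟩ := hQn k2 h1
        exact ha.inj _ _ _ _ h3 k3 (h4.trans k4.symm)
      · obtain ⟨d, k3, k4⟩ := hQn h2 k1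
        exact ha.inj _ _ _ _ h3 k3 (h4.trans k4.symm)
      · exact ha.inj _ _ _ _ h3 k3 (h4.trans k4.symm)
    have := Finset.card_le_card_sdiff_add_card (s := Finset.univ.filter fun f => a f ≠ none)
      (t := Finset.univ.filter fun f => a' f ≠ none)
    simp only [size]
    omega

/-- Vertices `v` choose edges `i` with `v = e i b`, whose other endpoints choose no edge. -/
structure IsPick (e : E → Bool → Option V) (pk : V → Option (E × Bool)) : Prop where
  ends : ∀ v i b, pk v = some (i, b) → e i b = some v
  head : ∀ v i b u, pk v = some (i, b) → other e i b = some u → pk u = none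

open Classical in
/-- The vertices in `T` are contracted into the other endpoints of the edges they chose. -/
noncomputable def contractOn (T : Finset V) (e : E → Bool → Option V) (pk : V → Option (E × Bool))
    (i : E) (c : Bool) : Option V :=
  if ∃ v ∈ T, ∃ b, pk v = some (i, b) then none
  else (e i c).bind fun v => if v ∈ T then (pk v).elim (some v) fun p => other e p.1 p.2 else some v

open Classical in
/-- The graph in which all choosing vertices are contracted. -/
noncomputable def contract [Fintype V] (e : E → Bool → Option V) (pk : V → Option (E × Bool)) :
    E → Bool → Option V :=
  contractOn (Finset.univ.filter fun v => pk v ≠ none) e pk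

open Classical in
/-- The number of choosing vertices. -/
noncomputable def picks [Fintype V] (pk : V → Option (E × Bool)) : ℕ :=
  (Finset.univ.filter fun v => pk v ≠ none).card

variable {e : E → Bool → Option V} {pk : V → Option (E × Bool)}

/-- If two different ends had chosen the edge, each would be the head of the other, and heads choose
nothing. -/
theorem IsPick.eq_of_edge (h : IsPick e pk) {v v' : V} {i : E} {b b' : Bool}
    (hv : pk v = some (i, b)) (hv' : pk v' = some (i, b')) : v = v' := by
  have h1 := h.ends _ _ _ hv
  have h2 := h.ends _ _ _ hv'
  by_cases hb : b' = b
  · subst hb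
    rw [h1] at h2
    exact Option.some.inj h2
  · have hb' : b' = !b := by cases b <;> cases b' <;> simp_all
    subst hb'
    by_contra hne
    have h3 : other e i b = some v' := by
      rw [other, if_neg, h2]
      rw [h1, h2]
      simpa using fun h => hne h.symm
    have := h.head _ _ _ _ hv h3
    rw [hv'] at this
    cases this

/-- The vertices are contracted one at a time by `IsMatching.contract_one`. A head chooses nothing
and is never contracted itself, so earlier contractions leave both ends of the next chosen edge in
place. -/
theorem exists_isMatching_contractOn [Fintype E] (h : IsPick e pk) {a : E → Option Bool}
    (ha : IsMatching e a) (T : Finset V) (hT : ∀ v ∈ T, pk v ≠ none) :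
    ∃ a', IsMatching (contractOn T e pk) a' ∧ size a ≤ size a' + T.card := by
  classical
  induction T using Finset.induction_on with
  | empty =>
    refine ⟨a, ?_, by simp⟩
    have : contractOn ∅ e pk = e := by
      funext i c
      simp [contractOn]
    rwa [this]
  | insert v T hv ih =>
    obtain ⟨a₁, ha₁, hs₁⟩ := ih fun v hv => hT v (Finset.mem_insert_of_mem hv)
    obtain ⟨⟨i, b⟩, hib⟩ := Option.ne_none_iff_exists'.1 (hT v (Finset.mem_insert_self _ _))
    have hi : ¬ ∃ v ∈ T, ∃ b, pk v = some (i, b) := by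
      rintro ⟨v', hv', b', h'⟩
      exact hv (h.eq_of_edge hib h' ▸ hv')
    have h1 := h.ends _ _ _ hib
    have hv1 : contractOn T e pk i b = some v := by
      simp only [contractOn, if_neg hi, h1, Option.bind_some, if_neg hv]
    have hoth : other (contractOn T e pk) i b = other e i b := by
      rw [other, hv1]
      have h2 : contractOn T e pk i (!b) = (e i (!b)).bind fun v =>
          if v ∈ T then (pk v).elim (some v) fun p => other e p.1 p.2 else some v := by
        simp only [contractOn, if_neg hi]
      rw [h2]
      rcases hu : e i (!b) with _ | u
      · simp [other, hu]
      by_cases huv : u = v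
      · subst huv
        simp [other, hu, h1, hv]
      · have h3 : other e i b = some u := by
          rw [other, if_neg, hu]
          rw [h1, hu]
          simpa using huv
        have huT : u ∉ T := fun h4 => hT u (Finset.mem_insert_of_mem h4) (h.head _ _ _ _ hib h3)
        simp [h3, huT, huv]
    obtain ⟨a₂, ha₂, hs₂⟩ := ha₁.contract_one hv1 (e' := contractOn (insert v T) e pk) (by
      intro f c
      rw [hoth]
      by_cases hfi : f = i
      · have : ∃ v' ∈ insert v T, ∃ b, pk v' = some (f, b) :=
          ⟨v, Finset.mem_insert_self _ _, b, hfi ▸ hib⟩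
        rw [if_pos hfi, contractOn, if_pos this]
      · rw [if_neg hfi]
        by_cases hf : ∃ v ∈ T, ∃ b, pk v = some (f, b)
        · have : ∃ v' ∈ insert v T, ∃ b, pk v' = some (f, b) := by
            obtain ⟨v', hv', h'⟩ := hf
            exact ⟨v', Finset.mem_insert_of_mem hv', h'⟩
          simp only [contractOn, if_pos this, if_pos hf, Option.bind_none]
        · have : ¬ ∃ v' ∈ insert v T, ∃ b, pk v' = some (f, b) := by
            rintro ⟨v', hv', b', h'⟩
            rcases Finset.mem_insert.1 hv' with rfl | hv'
            · rw [hib] at h'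
              cases h'
              exact hfi rfl
            · exact hf ⟨v', hv', b', h'⟩
          simp only [contractOn, if_neg this, if_neg hf]
          rcases hx : e f c with _ | x
          · rfl
          simp only [Option.bind_some, Finset.mem_insert]
          by_cases hxT : x ∈ T
          · have hxv : x ≠ v := fun h => hv (h ▸ hxT)
            simp only [hxT, or_true, if_true]
            obtain ⟨⟨j, d⟩, hjd⟩ := Option.ne_none_iff_exists'.1
              (hT x (Finset.mem_insert_of_mem hxT))
            rw [hjd, Option.elim_some]
            rcases hy : other e j d with _ | y
            · rfl
            · have : y ≠ v := by
                rintro rfl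
                have := h.head _ _ _ _ hjd hy
                rw [hib] at this
                cases this
              simp [this]
          · by_cases hxv : x = v
            · subst hxv
              simp [hxT, hib]
            · simp [hxT, hxv])
    refine ⟨a₂, ha₂, ?_⟩
    rw [Finset.card_insert_of_notMem hv]
    omega

/-- The edge `i` was chosen by its endpoint number `b`. -/
def Picked (e : E → Bool → Option V) (pk : V → Option (E × Bool)) (i : E) (b : Bool) : Prop :=
  (e i b).bind pk = some (i, b)

theorem IsPick.picked_iff (h : IsPick e pk) {i : E} {b : Bool} :
    Picked e pk i b ↔ ∃ v, pk v = some (i, b) := by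
  constructor
  · intro hp
    obtain ⟨v, -, hv⟩ := Option.bind_eq_some_iff.1 hp
    exact ⟨v, hv⟩
  · rintro ⟨v, hv⟩
    rw [Picked, h.ends _ _ _ hv]
    exact hv

open Classical in
/-- Extending a matching of the contracted graph: the chosen edge of a vertex `v` is matched to `v`,
unless `v` is taken by another edge. -/
noncomputable def lift (e : E → Bool → Option V) (pk : V → Option (E × Bool)) (taken : V → Prop)
    (y : E → Option Bool) (i : E) : Option Bool :=
  if Picked e pk i false then some (decide (∃ v, e i false = some v ∧ taken v))
  else if Picked e pk i true then some (!decide (∃ v, e i true = some v ∧ taken v))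
  else y i

theorem lift_cases (h : IsPick e pk) (taken : V → Prop) (y : E → Option Bool) (i : E) (d : Bool)
    (hd : lift e pk taken y i = some d) :
    (∃ v b, pk v = some (i, b) ∧ (¬ taken v ∧ d = b ∨ taken v ∧ d = !b)) ∨
      (∀ b, ¬ Picked e pk i b) ∧ y i = some d := by
  rw [lift] at hd
  by_cases h0 : Picked e pk i false
  · obtain ⟨v, hv⟩ := h.picked_iff.1 h0
    rw [if_pos h0] at hd
    refine Or.inl ⟨v, false, hv, ?_⟩
    by_cases ht : taken v <;> simp_all [h.ends _ _ _ hv]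
  by_cases h1 : Picked e pk i true
  · obtain ⟨v, hv⟩ := h.picked_iff.1 h1
    rw [if_neg h0, if_pos h1] at hd
    refine Or.inl ⟨v, true, hv, ?_⟩
    by_cases ht : taken v <;> simp_all [h.ends _ _ _ hv]
  · rw [if_neg h0, if_neg h1] at hd
    exact Or.inr ⟨by rintro (_ | _) <;> assumption, hd⟩

/-- An assignment that lives on a list of slots. -/
theorem size_eq_of_slots {E' : Type*} [Fintype E] [Fintype E'] {t : E' → Option E}
    (ht : ∀ j j' i, t j = some i → t j' = some i → j = j') {y : E → Option Bool}
    {y' : E' → Option Bool} (h1 : ∀ j i, t j = some i → y i = y' j)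
    (h2 : ∀ i, y i ≠ none → ∃ j, t j = some i) (h3 : ∀ j, t j = none → y' j = none) :
    size y' = size y := by
  classical
  have hsome : ∀ j ∈ (Finset.univ.filter fun j => y' j ≠ none), (t j).isSome := by
    intro j hj
    rw [Finset.mem_filter_univ] at hj
    rw [Option.isSome_iff_ne_none]
    exact fun h => hj (h3 j h)
  refine Finset.card_bij (fun j hj => (t j).get (hsome j hj)) ?_ ?_ ?_
  · intro j hj
    have := h1 j ((t j).get (hsome j hj)) (by simp)
    rw [Finset.mem_filter_univ] at hj ⊢
    rwa [this]
  · intro j hj j' hj' heq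
    exact ht j j' ((t j).get (hsome j hj)) (by simp) (by rw [heq]; simp)
  · intro i hi
    rw [Finset.mem_filter_univ] at hi
    obtain ⟨j, hj⟩ := h2 i hi
    refine ⟨j, ?_, by simp [hj]⟩
    rw [Finset.mem_filter_univ, ← h1 j i hj]
    exact hi

/-- Moving the edges that have endpoints to slots. -/
theorem Good.of_slots {E' : Type*} [Fintype E] [Fintype E'] {t : E' → Option E}
    (ht : ∀ j j' i, t j = some i → t j' = some i → j = j')
    (hal : ∀ i c, e i c ≠ none → ∃ j, t j = some i) {s : ℕ} {y : E → Option Bool}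
    {y' : E' → Option Bool} (hy' : Good (fun j c => (t j).bind fun i => e i c) s y')
    (h1 : ∀ j i, t j = some i → y i = y' j) (h2 : ∀ i, (∀ j, t j ≠ some i) → y i = none) :
    Good e s y := by
  classical
  -- Nothing is lost in passing to the slots: only edges with an endpoint can be matched, and these
  -- all have a slot.
  have hdown : ∀ a, IsMatching e a →
      IsMatching (fun j c => (t j).bind fun i => e i c) (fun j => (t j).bind a) ∧
      size (fun j => (t j).bind a) = size a := by
    intro a ha
    refine ⟨⟨fun j c hj => ?_, fun j j' c c' hj hj' heq => ?_⟩, ?_⟩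
    · obtain ⟨i, hi, hic⟩ := Option.bind_eq_some_iff.1 hj
      simp only [hi, Option.bind_some]
      exact ha.ne_none _ _ hic
    · obtain ⟨i, hi, hic⟩ := Option.bind_eq_some_iff.1 hj
      obtain ⟨i', hi', hic'⟩ := Option.bind_eq_some_iff.1 hj'
      simp only [hi, hi', Option.bind_some] at heq
      have := ha.inj _ _ _ _ hic hic' heq
      subst this
      exact ht _ _ _ hi hi'
    · refine size_eq_of_slots ht (fun j i hj => by simp [hj]) (fun i hi => ?_)
        (fun j hj => by simp [hj])
      obtain ⟨c, hc⟩ := Option.ne_none_iff_exists'.1 hi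
      exact hal i c (ha.ne_none _ _ hc)
  have halive : alive (fun j c => (t j).bind fun i => e i c) ≤ alive e := by
    rw [alive, alive, ← Finset.card_image_of_injective (Finset.univ.filter fun i => ∃ b, e i b ≠ none)
      (Option.some_injective E)]
    have hsome : ∀ j c, ((t j).bind fun i => e i c) ≠ none → ∃ i, t j = some i ∧ e i c ≠ none := by
      intro j c hc
      rcases hj : t j with _ | i
      · simp [hj] at hc
      · exact ⟨i, rfl, by simpa [hj] using hc⟩
    refine Finset.card_le_card_of_injOn t (fun j hj => ?_) (fun j hj j' _ heq => ?_)
    · rw [Finset.mem_coe, Finset.mem_filter_univ] at hj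
      obtain ⟨c, hc⟩ := hj
      obtain ⟨i, hi, hic⟩ := hsome j c hc
      rw [Finset.mem_coe, Finset.mem_image]
      exact ⟨i, by rw [Finset.mem_filter_univ]; exact ⟨c, hic⟩, hi.symm⟩
    · rw [Finset.mem_coe, Finset.mem_filter_univ] at hj
      obtain ⟨c, hc⟩ := hj
      obtain ⟨i, hi, -⟩ := hsome j c hc
      exact ht j j' i hi (heq ▸ hi)
  intro ⟨a, ha, hs⟩
  obtain ⟨h3, h4⟩ := hy' ⟨_, (hdown a ha).1, by rw [(hdown a ha).2]; omega⟩
  have hsz : size y' = size y := by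
    refine size_eq_of_slots ht h1 (fun i hi => ?_) (fun j hj => ?_)
    · by_contra hno
      exact hi (h2 i (not_exists.1 hno))
    · by_contra hne
      obtain ⟨c, hc⟩ := Option.ne_none_iff_exists'.1 hne
      exact h3.ne_none _ _ hc (by simp [hj])
  have hslot : ∀ i c, y i = some c → ∃ j, t j = some i ∧ y' j = some c := by
    intro i c hic
    by_cases hno : ∃ j, t j = some i
    · obtain ⟨j, hj⟩ := hno
      exact ⟨j, hj, by rw [← h1 j i hj, hic]⟩
    · rw [h2 i (not_exists.1 hno)] at hic
      cases hic
  refine ⟨⟨fun i c hic => ?_, fun i i' c c' hic hic' heq => ?_⟩, fun a ha => ?_⟩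
  · obtain ⟨j, hj, hjc⟩ := hslot i c hic
    simpa [hj] using h3.ne_none _ _ hjc
  · obtain ⟨j, hj, hjc⟩ := hslot i c hic
    obtain ⟨j', hj', hjc'⟩ := hslot i' c' hic'
    have := h3.inj _ _ _ _ hjc hjc' (by simpa [hj, hj'] using heq)
    subst this
    rw [hj] at hj'
    cases hj'
    rfl
  · rw [← hsz, ← (hdown a ha).2]
    exact h4 _ (hdown a ha).1

variable [Fintype V]

theorem contract_eq_none (h : IsPick e pk) {i : E} {b : Bool} (hp : Picked e pk i b) (c : Bool) :
    contract e pk i c = none := by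
  obtain ⟨v, hv⟩ := h.picked_iff.1 hp
  rw [contract, contractOn, if_pos ⟨v, by simp [hv], b, hv⟩]

theorem contract_eq (h : IsPick e pk) {i : E} (hp : ∀ b, ¬ Picked e pk i b) (c : Bool) :
    contract e pk i c =
      (e i c).bind fun v => (pk v).elim (some v) fun p => other e p.1 p.2 := by
  classical
  rw [contract, contractOn, if_neg]
  · congr 1
    funext v
    by_cases hv : pk v = none <;> simp [hv]
  · rintro ⟨v, -, b, hv⟩
    exact hp b (h.picked_iff.2 ⟨v, hv⟩)

/-- If v chooses an edge and is taken by an edge j of `y`, then j occupies the head of v in the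
contracted graph; in particular the head exists, since matched ends are not `none`. So nothing else
occupies the head, and at most one of the vertices merged into it is taken. The chosen edge of this
one moves to the head, and the others keep theirs. -/
theorem isMatching_lift (h : IsPick e pk) {y : E → Option Bool} (hy : IsMatching (contract e pk) y)
    {taken : V → Prop} (ht : ∀ v, taken v ↔ ∃ j c, y j = some c ∧ e j c = some v) :
    IsMatching e (lift e pk taken y) := by
  have hnp : ∀ j c, y j = some c → ∀ b, ¬ Picked e pk j b := fun j c hj b hb =>
    hy.ne_none j c hj (contract_eq_none h hb c)
  have hstar : ∀ v, taken v → ∀ p, pk v = some p →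
      ∃ j c, y j = some c ∧ e j c = some v ∧ contract e pk j c = other e p.1 p.2 := by
    intro v hv p hp
    obtain ⟨j, c, h1, h2⟩ := (ht v).1 hv
    refine ⟨j, c, h1, h2, ?_⟩
    rw [contract_eq h (hnp j c h1), h2, Option.bind_some, hp, Option.elim_some]
  have hoth : ∀ v i b, taken v → pk v = some (i, b) → ∃ u, other e i b = some u ∧
      e i (!b) = some u ∧ pk u = none := by
    intro v i b hv hp
    obtain ⟨j, c, h1, h2, h3⟩ := hstar v hv _ hp
    obtain ⟨u, hu⟩ := Option.ne_none_iff_exists'.1 (h3 ▸ hy.ne_none j c h1)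
    refine ⟨u, hu, ?_, h.head _ _ _ _ hp hu⟩
    simp only [other] at hu
    split_ifs at hu
    exact hu
  -- a chosen edge that is matched to the other endpoint, and an edge at that endpoint
  have hcross : ∀ v i b u j c, taken v → pk v = some (i, b) → e i (!b) = some u →
      y j = some c → e j c = some u → False := by
    intro v i b u j c hv hp hu hj hju
    obtain ⟨u', h1, h2, h3⟩ := hoth v i b hv hp
    rw [hu] at h2
    cases h2
    obtain ⟨j', c', k1, k2, k3⟩ := hstar v hv _ hp
    have k4 : contract e pk j c = some u := by
      rw [contract_eq h (hnp j c hj), hju, Option.bind_some, h3, Option.elim_none]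
    have k5 := hy.inj _ _ _ _ hj k1 (k4.trans (k3.trans h1).symm)
    subst k5
    rw [hj] at k1
    cases k1
    rw [hju] at k2
    cases k2
    rw [hp] at h3
    cases h3
  refine ⟨fun i d hd => ?_, fun i i' d d' hd hd' heq => ?_⟩
  · rcases lift_cases h _ _ _ _ hd with ⟨v, b, hv, ⟨-, rfl⟩ | ⟨h1, rfl⟩⟩ | ⟨h1, h2⟩
    · rw [h.ends _ _ _ hv]; simp
    · obtain ⟨u, -, h2, -⟩ := hoth v i b h1 hv
      rw [h2]; simp
    · intro h0
      refine hy.ne_none i d h2 ?_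
      rw [contract_eq h h1, h0]
      rfl
  · rcases lift_cases h _ _ _ _ hd with ⟨v, b, hv, ⟨h1, rfl⟩ | ⟨h1, rfl⟩⟩ | ⟨h1, h2⟩ <;>
      rcases lift_cases h _ _ _ _ hd' with ⟨v', b', hv', ⟨k1, rfl⟩ | ⟨k1, rfl⟩⟩ | ⟨k1, k2⟩
    · rw [h.ends _ _ _ hv, h.ends _ _ _ hv'] at heq
      cases heq
      rw [hv] at hv'
      cases hv'
      rfl
    · obtain ⟨u, -, k3, k4⟩ := hoth _ _ _ k1 hv'
      rw [h.ends _ _ _ hv, k3] at heq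
      cases heq
      rw [hv] at k4
      cases k4
    · rw [h.ends _ _ _ hv] at heq
      exact absurd ((ht v).2 ⟨i', _, k2, heq.symm⟩) h1
    · obtain ⟨u, -, h3, h4⟩ := hoth _ _ _ h1 hv
      rw [h.ends _ _ _ hv', h3] at heq
      cases heq
      rw [hv'] at h4
      cases h4
    · obtain ⟨u, h3, h4, -⟩ := hoth _ _ _ h1 hv
      obtain ⟨u', k3, k4, -⟩ := hoth _ _ _ k1 hv'
      rw [h4, k4] at heq
      cases heq
      obtain ⟨j, c, l1, l2, l3⟩ := hstar _ h1 _ hv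
      obtain ⟨j', c', m1, m2, m3⟩ := hstar _ k1 _ hv'
      have := hy.inj _ _ _ _ l1 m1 ((l3.trans h3).trans (m3.trans k3).symm)
      subst this
      rw [l1] at m1
      cases m1
      rw [l2] at m2
      cases m2
      rw [hv] at hv'
      cases hv'
      rfl
    · obtain ⟨u, -, h4, -⟩ := hoth _ _ _ h1 hv
      exact (hcross _ _ _ _ _ _ h1 hv h4 k2 (heq ▸ h4)).elim
    · rw [h.ends _ _ _ hv'] at heq
      exact absurd ((ht v').2 ⟨i, _, h2, heq⟩) k1
    · obtain ⟨u, -, k4, -⟩ := hoth _ _ _ k1 hv'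
      exact (hcross _ _ _ _ _ _ k1 hv' k4 h2 (heq.symm ▸ k4)).elim
    · by_cases hy' : contract e pk i d = contract e pk i' d'
      · exact hy.inj _ _ _ _ h2 k2 hy'
      · rw [contract_eq h h1, contract_eq h k1, heq] at hy'
        exact absurd rfl hy'

variable [Fintype E]

theorem exists_isMatching_contract (h : IsPick e pk) {a : E → Option Bool}
    (ha : IsMatching e a) :
    ∃ a', IsMatching (contract e pk) a' ∧ size a ≤ size a' + picks pk := by
  classical
  exact exists_isMatching_contractOn h ha _ (by simp)


open Classical in
/-- The number of edges that were chosen is the number of choosing vertices. -/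
theorem card_picked (h : IsPick e pk) :
    (Finset.univ.filter fun i => ∃ b, Picked e pk i b).card = picks pk := by
  symm
  have hpk : ∀ v, v ∈ (Finset.univ.filter fun v => pk v ≠ none) → (pk v).isSome := by
    intro v hv
    rw [Option.isSome_iff_ne_none]
    simpa using hv
  refine Finset.card_bij (fun v hv => ((pk v).get (hpk v hv)).1) ?_ ?_ ?_
  · intro v hv
    rw [Finset.mem_filter_univ]
    refine ⟨((pk v).get (hpk v hv)).2, h.picked_iff.2 ⟨v, ?_⟩⟩
    simp
  · intro v hv v' hv' heq
    obtain ⟨⟨i, b⟩, hib⟩ := Option.isSome_iff_exists.1 (hpk v hv)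
    obtain ⟨⟨i', b'⟩, hib'⟩ := Option.isSome_iff_exists.1 (hpk v' hv')
    simp only [hib, hib', Option.get_some] at heq
    subst heq
    exact h.eq_of_edge hib hib'
  · intro i hi
    rw [Finset.mem_filter_univ] at hi
    obtain ⟨b, hb⟩ := hi
    obtain ⟨v, hv⟩ := h.picked_iff.1 hb
    exact ⟨v, by simp [hv], by simp [hv]⟩

/-- Chosen edges are alive and lose both ends, and contraction gives no end to an edge without ends.
-/
theorem alive_contract_add_picks_le (h : IsPick e pk) :
    alive (contract e pk) + picks pk ≤ alive e := by
  classical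
  rw [← card_picked h, alive, alive, ← Finset.card_union_of_disjoint]
  · refine Finset.card_le_card fun i hi => ?_
    rw [Finset.mem_union, Finset.mem_filter_univ, Finset.mem_filter_univ] at hi
    rw [Finset.mem_filter_univ]
    rcases hi with ⟨c, hc⟩ | ⟨b, hb⟩
    · by_cases hp : ∃ b, Picked e pk i b
      · obtain ⟨b, hb⟩ := hp
        exact absurd (contract_eq_none h hb c) hc
      · rw [contract_eq h (not_exists.1 hp)] at hc
        refine ⟨c, fun h0 => hc ?_⟩
        rw [h0]
        rfl
    · obtain ⟨v, hv⟩ := h.picked_iff.1 hb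
      exact ⟨b, by rw [h.ends _ _ _ hv]; simp⟩
  · rw [Finset.disjoint_left]
    intro i hi hi'
    rw [Finset.mem_filter_univ] at hi hi'
    obtain ⟨c, hc⟩ := hi
    obtain ⟨b, hb⟩ := hi'
    exact hc (contract_eq_none h hb c)

/-- A chosen edge has no ends after the contraction, so `y` leaves it unmatched, while the lift
always matches it. -/
theorem size_lift (h : IsPick e pk) {y : E → Option Bool} (hy : IsMatching (contract e pk) y)
    (taken : V → Prop) : size y + picks pk ≤ size (lift e pk taken y) := by
  classical
  rw [← card_picked h, size, size, ← Finset.card_union_of_disjoint]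
  · refine Finset.card_le_card fun i hi => ?_
    rw [Finset.mem_union, Finset.mem_filter_univ, Finset.mem_filter_univ] at hi
    rw [Finset.mem_filter_univ, lift]
    rcases hi with hi | ⟨b, hb⟩
    · split_ifs <;> simp [hi]
    · cases b <;> simp only [hb, if_true] <;> (try split_ifs) <;> simp
  · rw [Finset.disjoint_left]
    intro i hi hi'
    rw [Finset.mem_filter_univ] at hi hi'
    obtain ⟨b, hb⟩ := hi'
    obtain ⟨c, hc⟩ := Option.ne_none_iff_exists'.1 hi
    exact hy.ne_none i c hc (contract_eq_none h hb c)

/-- If some matching of `e` misses at most `s` edges, the same holds after the contraction. -/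
theorem exists_matching_contract (h : IsPick e pk) {s : ℕ}
    (hs : ∃ a, IsMatching e a ∧ alive e ≤ size a + s) :
    ∃ a, IsMatching (contract e pk) a ∧ alive (contract e pk) ≤ size a + s := by
  obtain ⟨a, ha, hs⟩ := hs
  obtain ⟨a', ha', hs'⟩ := exists_isMatching_contract h ha
  have := alive_contract_add_picks_le h
  exact ⟨a', ha', by omega⟩

/-- Maximum matchings can be lifted. -/
theorem Good.lift (h : IsPick e pk) {s : ℕ} {y : E → Option Bool} (hy : Good (contract e pk) s y)
    {taken : V → Prop} (ht : ∀ v, taken v ↔ ∃ j c, y j = some c ∧ e j c = some v) :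
    Good e s (lift e pk taken y) := by
  intro hs
  obtain ⟨h1, h2⟩ := hy (exists_matching_contract h hs)
  refine ⟨isMatching_lift h h1 ht, fun a ha => ?_⟩
  obtain ⟨a', ha', hs'⟩ := exists_isMatching_contract h ha
  have := h2 a' ha'
  have := size_lift h h1 taken
  omega

end

end Orientation

namespace Orientation

/-! ### Two-colourings -/

/-- The colourings of `x : Fin k → Fin β → ZMod 2` by affine forms in one of the `k` blocks. -/
def affineColor {k β : ℕ} (θ : Fin k × (Fin β → ZMod 2) × ZMod 2) (x : Fin k → Fin β → ZMod 2) :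
    Bool :=
  decide (∑ i, θ.2.1 i * x θ.1 i + θ.2.2 = 1)

/-- Evaluation at x and at y is a group homomorphism from affine forms to (ZMod 2)². It is
surjective because x and y differ in some coordinate, so all four fibres have the same size. -/
theorem card_affine {β : ℕ} {x y : Fin β → ZMod 2} (hxy : x ≠ y) :
    4 * (Finset.univ.filter fun p : (Fin β → ZMod 2) × ZMod 2 =>
      ∑ i, p.1 i * x i + p.2 = 0 ∧ ∑ i, p.1 i * y i + p.2 = 1).card =
      Fintype.card ((Fin β → ZMod 2) × ZMod 2) := by
  classical
  let f : (Fin β → ZMod 2) × ZMod 2 →+ ZMod 2 × ZMod 2 :=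
    { toFun := fun p => (∑ i, p.1 i * x i + p.2, ∑ i, p.1 i * y i + p.2)
      map_zero' := by simp
      map_add' := by
        intro p p'
        simp only [Prod.fst_add, Prod.snd_add, Pi.add_apply, add_mul, Finset.sum_add_distrib,
          Prod.mk_add_mk, Prod.mk.injEq]
        constructor <;> ring }
  have hsurj : Function.Surjective f := by
    rintro ⟨u, v⟩
    obtain ⟨j, hj⟩ := Function.ne_iff.1 hxy
    have h1 : y j = x j + 1 := by
      revert hj
      generalize x j = a
      generalize y j = b
      revert a b
      decide
    refine ⟨(Pi.single j (u + v), u + (u + v) * x j), ?_⟩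
    simp only [f, AddMonoidHom.coe_mk, ZeroHom.coe_mk, Prod.mk.injEq]
    have hs : ∀ z : Fin β → ZMod 2, ∑ i, (Pi.single j (u + v) : Fin β → ZMod 2) i * z i =
        (u + v) * z j := by
      intro z
      rw [Finset.sum_eq_single j]
      · simp
      · intro i _ hij
        simp [Pi.single_eq_of_ne hij]
      · simp
    rw [hs, hs, h1]
    clear hs
    generalize x j = a
    revert a u v
    decide
  have hfib : ∀ z : ZMod 2 × ZMod 2, (Finset.univ.filter fun p => f p = z).card =
      (Finset.univ.filter fun p => f p = (0, 1)).card := fun z =>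
    AddMonoidHom.card_fiber_eq_of_mem_range f (hsurj z) (hsurj (0, 1))
  have htot := Finset.card_eq_sum_card_fiberwise (f := f)
    (s := (Finset.univ : Finset ((Fin β → ZMod 2) × ZMod 2))) (t := Finset.univ) (fun _ _ => by simp)
  rw [Finset.sum_congr rfl (fun z _ => hfib z), Finset.sum_const, Finset.card_univ,
    Finset.card_univ] at htot
  rw [htot]
  have h4 : Fintype.card (ZMod 2 × ZMod 2) = 4 := rfl
  rw [h4, smul_eq_mul]
  congr 2
  ext p
  simp [f]

/-- Only the forms on one block where x and y differ are counted. This loses a factor k, but the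
family has just 2 k 2^β members, exponential in the length of a single block; forms on all
coordinates would be too many for one gate. -/
theorem card_affineColor {k β : ℕ} {x y : Fin k → Fin β → ZMod 2} (hxy : x ≠ y) :
    Fintype.card (Fin k × (Fin β → ZMod 2) × ZMod 2) ≤
      4 * k * (Finset.univ.filter fun θ =>
        affineColor θ x = false ∧ affineColor θ y = true).card := by
  classical
  obtain ⟨j, hj⟩ := Function.ne_iff.1 hxy
  have h := card_affine hj
  have hle : (Finset.univ.filter fun p : (Fin β → ZMod 2) × ZMod 2 =>
      ∑ i, p.1 i * x j i + p.2 = 0 ∧ ∑ i, p.1 i * y j i + p.2 = 1).card ≤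
      (Finset.univ.filter fun θ =>
        affineColor θ x = false ∧ affineColor θ y = true).card := by
    refine Finset.card_le_card_of_injOn (fun p => (j, p)) ?_
      (Prod.mk_right_injective j).injOn
    intro p hp
    rw [Finset.mem_coe, Finset.mem_filter_univ] at hp ⊢
    have h01 : (0 : ZMod 2) ≠ 1 := by decide
    simp [affineColor, hp.1, hp.2]
  rw [Fintype.card_prod, Fintype.card_fin, ← h]
  calc _ = 4 * k * (Finset.univ.filter fun p : (Fin β → ZMod 2) × ZMod 2 =>
      ∑ i, p.1 i * x j i + p.2 = 0 ∧ ∑ i, p.1 i * y j i + p.2 = 1).card := by ring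
    _ ≤ _ := Nat.mul_le_mul le_rfl hle

/-- A small family of two-colourings that separates any two points often. -/
theorem exists_colorings {W : Type} [Finite W] {k β : ℕ} (hW : Nat.card W ≤ 2 ^ (β * k)) :
    ∃ col : Fin k × (Fin β → ZMod 2) × ZMod 2 → W → Bool, ∀ x y, x ≠ y →
      Fintype.card (Fin k × (Fin β → ZMod 2) × ZMod 2) ≤
        4 * k * (Finset.univ.filter fun θ => col θ x = false ∧ col θ y = true).card := by
  have hcard : Nat.card W ≤ Nat.card (Fin k → Fin β → ZMod 2) := by
    refine hW.trans (le_of_eq ?_)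
    simp [Nat.card_eq_fintype_card, ZMod.card, pow_mul]
  obtain ⟨g⟩ : Nonempty (W ↪ (Fin k → Fin β → ZMod 2)) := by
    have := Fintype.ofFinite W
    rw [Nat.card_eq_fintype_card, Nat.card_eq_fintype_card] at hcard
    exact Function.Embedding.nonempty_of_card_le hcard
  exact ⟨fun θ x => affineColor θ (g x), fun x y hxy =>
    card_affineColor fun h => hxy (g.injective h)⟩

/-- The best colouring separates a constant fraction of given pairs. -/
theorem exists_good_coloring {Θ H W : Type*} [Fintype Θ] [Nonempty Θ] [Fintype H] {k : ℕ}
    {col : Θ → W → Bool} (hcol : ∀ x y, x ≠ y → Fintype.card Θ ≤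
      k * (Finset.univ.filter fun θ => col θ x = false ∧ col θ y = true).card)
    {p : H → Option (W × W)} (hp : ∀ h x y, p h = some (x, y) → x ≠ y) :
    ∃ θ, (Finset.univ.filter fun h => (p h).isSome = true).card ≤
      k * (Finset.univ.filter fun h =>
        (p h).elim false (fun a => !col θ a.1 && col θ a.2) = true).card := by
  classical
  by_contra! hcon
  -- Averaging: if every colouring failed, k times the number of separated (colouring, pair)
  -- combinations would be less than |Θ| times the number of pairs, whereas `hcol` gives the
  -- opposite bound for each pair.
  have h1 : ∑ θ : Θ, k * (Finset.univ.filter fun h =>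
        (p h).elim false (fun a => !col θ a.1 && col θ a.2) = true).card <
      ∑ θ : Θ, (Finset.univ.filter fun h => (p h).isSome = true).card :=
    Finset.sum_lt_sum_of_nonempty Finset.univ_nonempty fun θ _ => hcon θ
  rw [← Finset.mul_sum, Finset.sum_const, Finset.card_univ, smul_eq_mul] at h1
  simp only [Finset.card_filter] at h1
  rw [Finset.sum_comm, Finset.mul_sum, Finset.mul_sum] at h1
  refine absurd h1 (not_lt.2 (Finset.sum_le_sum fun h _ => ?_))
  rcases hh : p h with _ | ⟨x, y⟩
  · simp
  · have := hcol x y (hp h x y hh)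
    rw [Finset.card_filter] at this
    simpa only [Option.isSome_some, if_true, Option.elim_some, Bool.and_eq_true,
      Bool.not_eq_true', mul_one] using this

end Orientation

/-! ### One round of contractions -/

namespace Orientation

open Circuit

section

variable {E V : Type*}

open Classical in
/-- The association list that offers each endpoint of each edge to its vertex. -/
noncomputable def offers (e : E → Bool → Option V) (h : E × Bool) :
    Option (Option V × (E × Bool × Option V)) :=
  if e h.1 h.2 = none then none else some (e h.1 h.2, (h.1, h.2, other e h.1 h.2))

open Classical in
/-- Vertices of colour `false` choose the offered edge if its other endpoint has colour `true`. -/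
noncomputable def pickOf (f : Option V → Option (E × Bool × Option V)) (c : Option V → Bool)
    (v : V) : Option (E × Bool) :=
  (f (some v)).bind fun a =>
    if c (some v) = false ∧ c a.2.2 = true then some (a.1, a.2.1) else none

open Classical in
/-- The pair of endpoints of an edge, at its end that is offered to the vertex. -/
noncomputable def offeredPair (h : E × Bool) (x : Option V)
    (l : Option (E × Bool × Option V)) : Option (Option V × Option V) :=
  l.bind fun a => if (a.1, a.2.1) = h then some (x, a.2.2) else none

variable {e : E → Bool → Option V} {f : Option V → Option (E × Bool × Option V)}

theorem lookup_offers (hf : IsLookup (offers e) f) {x : Option V} {a : E × Bool × Option V}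
    (ha : f x = some a) : e a.1 a.2.1 = x ∧ x ≠ none ∧ other e a.1 a.2.1 = a.2.2 := by
  obtain ⟨h, hh⟩ := hf.exists_of_eq_some _ _ ha
  simp only [offers] at hh
  split_ifs at hh with h0
  simp only [Option.some.injEq, Prod.mk.injEq] at hh
  obtain ⟨h1, rfl⟩ := hh
  exact ⟨h1, h1 ▸ h0, rfl⟩

theorem lookup_offers_none (hf : IsLookup (offers e) f) : f none = none := by
  rcases h : f none with _ | a
  · rfl
  · exact absurd rfl (lookup_offers hf h).2.1

theorem lookup_offers_ne_none (hf : IsLookup (offers e) f) {i : E} {b : Bool}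
    (h : e i b ≠ none) : f (e i b) ≠ none := by
  intro h0
  exact hf.ne_of_eq_none _ h0 (i, b) (i, b, other e i b) (by simp [offers, h])

/-- A chooser has colour `false` and the other end of its edge has colour `true`, so heads do not
choose. -/
theorem isPick_pickOf (hf : IsLookup (offers e) f) (c : Option V → Bool) :
    IsPick e (pickOf f c) := by
  constructor
  · intro v i b h
    obtain ⟨a, ha, h⟩ := Option.bind_eq_some_iff.1 h
    split_ifs at h
    cases h
    exact (lookup_offers hf ha).1
  · intro v i b u h hu
    obtain ⟨a, ha, h⟩ := Option.bind_eq_some_iff.1 h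
    split_ifs at h with hc
    cases h
    rw [(lookup_offers hf ha).2.2] at hu
    rw [hu] at hc
    rw [pickOf, Option.bind_eq_none_iff]
    intro a' _
    simp [hc.2]

/-- Colourings are only known to separate different points. Loops are no exception: their other end
counts as `none`, and an offer is never made to `none`. -/
theorem offeredPair_ne (hf : IsLookup (offers e) f) {h : E × Bool} {x y : Option V}
    (hp : offeredPair h (e h.1 h.2) (f (e h.1 h.2)) = some (x, y)) : x ≠ y := by
  obtain ⟨a, ha, hp⟩ := Option.bind_eq_some_iff.1 hp
  split_ifs at hp with hh
  cases hp
  subst hh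
  obtain ⟨-, h2, h3⟩ := lookup_offers hf ha
  rw [← h3, other]
  split_ifs with h4
  · exact h2
  · exact fun h5 => h4 h5.symm

/-- Together with `picked_pickOf` this expresses the contraction by what is known at one end of an
edge: the vertex, the edge offered to it and the colouring. So a circuit can evaluate it end by end
after a single lookup. -/
theorem newEnd_eq (hf : IsLookup (offers e) f) (c : Option V → Bool) (x : Option V) :
    (x.bind fun v => (pickOf f c v).elim (some v) fun p => other e p.1 p.2) =
      (f x).elim x fun a => if c x = false ∧ c a.2.2 = true then a.2.2 else x := by
  classical
  rcases x with _ | v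
  · rw [lookup_offers_none hf]
    rfl
  · rw [Option.bind_some, pickOf]
    rcases h : f (some v) with _ | a
    · rfl
    · simp only [Option.bind_some, Option.elim_some]
      split_ifs with hc
      · exact (lookup_offers hf h).2.2
      · rfl

theorem picked_pickOf (hf : IsLookup (offers e) f) (c : Option V → Bool) (i : E) (b : Bool) :
    Picked e (pickOf f c) i b ↔ (offeredPair (i, b) (e i b) (f (e i b))).elim False
      fun a => c a.1 = false ∧ c a.2 = true := by
  rw [Picked, offeredPair]
  rcases hx : e i b with _ | v
  · simp [lookup_offers_none hf]
  · rw [Option.bind_some, pickOf]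
    rcases h : f (some v) with _ | a
    · simp
    · simp only [Option.bind_some]
      by_cases h1 : c (some v) = false ∧ c a.2.2 = true <;>
        by_cases h2 : (a.1, a.2.1) = (i, b) <;> simp [h1, h2]

variable [Fintype E]

-- A matched vertex has an edge, so it is offered one, and different vertices are offered different
-- edge ends.
open Classical in
theorem size_le_card_offered (hf : IsLookup (offers e) f) {a : E → Option Bool}
    (ha : IsMatching e a) : size a ≤ (Finset.univ.filter fun h : E × Bool =>
      (offeredPair h (e h.1 h.2) (f (e h.1 h.2))).isSome = true).card := by
  have hex : ∀ i, a i ≠ none → ∃ h : E × Bool, ∃ b, a i = some b ∧ e h.1 h.2 = e i b ∧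
      (offeredPair h (e h.1 h.2) (f (e h.1 h.2))).isSome = true := by
    intro i hi
    obtain ⟨b, hb⟩ := Option.ne_none_iff_exists'.1 hi
    obtain ⟨x, hx⟩ := Option.ne_none_iff_exists'.1 (lookup_offers_ne_none hf (ha.ne_none _ _ hb))
    have h1 := (lookup_offers hf hx).1
    refine ⟨(x.1, x.2.1), b, hb, h1, ?_⟩
    simp only [h1, hx]
    simp [offeredPair]
  choose g b hb hg hg' using hex
  refine Finset.card_le_card_of_injOn
    (fun i => if hi : a i ≠ none then g i hi else (i, false)) ?_ ?_
  · intro i hi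
    rw [Finset.mem_coe, Finset.mem_filter_univ] at hi ⊢
    simp only [dif_pos hi]
    exact hg' i hi
  · intro i hi j hj heq
    rw [Finset.mem_coe, Finset.mem_filter_univ] at hi hj
    simp only [dif_pos hi, dif_pos hj] at heq
    refine ha.inj i j _ _ (hb i hi) (hb j hj) ?_
    rw [← hg i hi, ← hg j hj, heq]

variable [Fintype V]

-- Such an edge end is chosen by its vertex, and a vertex chooses only one.
open Classical in
theorem card_offered_le_picks (hf : IsLookup (offers e) f) (c : Option V → Bool) :
    (Finset.univ.filter fun h : E × Bool =>
      (offeredPair h (e h.1 h.2) (f (e h.1 h.2))).elim false (fun a => !c a.1 && c a.2) =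
        true).card ≤ picks (pickOf f c) := by
  have hex : ∀ h : E × Bool, (offeredPair h (e h.1 h.2) (f (e h.1 h.2))).elim false
      (fun a => !c a.1 && c a.2) = true → ∃ v, pickOf f c v = some h := by
    intro h hh
    refine (isPick_pickOf hf c).picked_iff.1 ((picked_pickOf hf c _ _).2 ?_)
    rcases hp : offeredPair h (e h.1 h.2) (f (e h.1 h.2)) with _ | x
    · simp [hp] at hh
    · simpa [hp] using hh
  calc _ ≤ ((Finset.univ.filter fun v => pickOf f c v ≠ none).image (pickOf f c)).card := by
        refine Finset.card_le_card_of_injOn some (fun h hh => ?_) (Option.some_injective _).injOn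
        rw [Finset.mem_coe, Finset.mem_filter_univ] at hh
        obtain ⟨v, hv⟩ := hex h hh
        rw [Finset.mem_coe, Finset.mem_image]
        exact ⟨v, by rw [Finset.mem_filter_univ, hv]; simp, hv⟩
    _ ≤ _ := Finset.card_image_le

end

section

variable {Ω : Type} {L B q J : ℕ} {S : Set (Ω → ℕ)} {V : Type} [Fintype V]

/-- `exists_step_best` for families over any finite type. -/
theorem exists_step_best' {H Θ α : Type} [Fintype H] [Fintype Θ] [Nonempty Θ]
    (hL : 2 * Fintype.card Θ ≤ L) (hB : Fintype.card H + 1 ≤ B) (hΘ : Fintype.card Θ ≤ B)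
    {x : H → Ω → α} (hx : ∀ i, Avail S (x i)) (hS : S.Nonempty) (test : Θ → α → Bool) :
    ∃ S', Step L B (3 * Fintype.card H + 5 * Fintype.card Θ) S S' ∧ ∃ best : Ω → Θ,
      Avail S' best ∧ ∀ ω θ, (Finset.univ.filter fun i => test θ (x i ω) = true).card ≤
        (Finset.univ.filter fun i => test (best ω) (x i ω) = true).card := by
  obtain ⟨S', h, best, hb, hbest⟩ := exists_step_best hL hB hΘ
    (x := fun i => x ((Fintype.equivFin H).symm i)) (fun i => hx _) hS test
  refine ⟨S', h, best, hb, fun ω θ => ?_⟩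
  have key : ∀ θ, (Finset.univ.filter fun i =>
      test θ (x ((Fintype.equivFin H).symm i) ω) = true).card =
      (Finset.univ.filter fun i => test θ (x i ω) = true).card := fun θ =>
    Finset.card_equiv (Fintype.equivFin H).symm (by simp)
  rw [← key, ← key]
  exact hbest ω θ

open Classical in
/-- One round of contractions. -/
theorem exists_step_pick {N D : ℕ} {Θ : Type} [Fintype Θ] [Nonempty Θ]
    {col : Θ → Option V → Bool} (hcol : ∀ x y, x ≠ y → Fintype.card Θ ≤
      D * (Finset.univ.filter fun θ => col θ x = false ∧ col θ y = true).card)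
    (hq : 0 < q) (hL : 2 * (q * q) ≤ L) (hΘL : 2 * Fintype.card Θ ≤ L) (hΘB : Fintype.card Θ ≤ B)
    (hN : 4 * N ≤ q ^ J * (2 * (q * q))) (hB : (4 * N + Fintype.card V + 4) ^ 5 ≤ B)
    (hS : S.Nonempty) {e : Fin N → Ω → Bool → Option V} (he : ∀ i, Avail S (e i)) :
    ∃ S', Step L B ((4 * lookupCost J + 21) * N + 5 * Fintype.card Θ) S S' ∧
      ∃ pk : Ω → V → Option (Fin N × Bool), (∀ ω, IsPick (fun i => e i ω) (pk ω)) ∧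
        (∀ i, Avail S' fun ω => contract (fun i => e i ω) (pk ω) i) ∧
        (∀ i, Avail S' fun ω b => decide (Picked (fun i => e i ω) (pk ω) i b)) ∧
        ∀ ω a, IsMatching (fun i => e i ω) a → size a ≤ D * picks (pk ω) := by
  set X := 4 * N + Fintype.card V + 4 with hX
  have hX1 : 1 ≤ X := by omega
  have hL2 : 2 ≤ L := by have := Nat.mul_pos hq hq; omega
  have hB0 : 0 < B := (Nat.pow_pos hX1).trans_le hB
  have hpow : ∀ k ≤ 5, X ^ k ≤ B := fun k hk => (Nat.pow_le_pow_right hX1 hk).trans hB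
  have hoff : ∀ h : Fin N × Bool, Avail S (fun ω => offers (fun i => e i ω) h) := fun h =>
    (he h.1).of_det fun ω ω' hω => by simp [offers, other, hω]
  have c1 : 2 * N * (Fintype.card V + 1) + 1 ≤ X ^ 2 := by
    rw [hX]; nlinarith
  obtain ⟨S₁, h₁, f, hf, hl⟩ := exists_step_lookup (J := J) (B := B) (ι' := Fin N × Bool) hq hL
    (by
      simp only [Nat.card_eq_fintype_card, Fintype.card_prod, Fintype.card_fin, Fintype.card_bool,
        Fintype.card_option]
      calc _ ≤ X * (X * X ^ 2) := by
            gcongr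
            · omega
            · omega
            · refine le_trans (le_of_eq ?_) c1
              ring
        _ = X ^ 4 := by ring
        _ ≤ B := hpow 4 (by omega))
    (by simp only [Fintype.card_prod, Fintype.card_fin, Fintype.card_bool]; omega) hoff
    (fun h => (he h.1).map fun a => a h.2)
  have hcW : Nat.card ((Bool → Option V) × Option (Fin N × Bool × Option V)) ≤ B := by
    simp only [Nat.card_eq_fintype_card, Fintype.card_prod, Fintype.card_fin, Fintype.card_bool,
        Fintype.card_option, Fintype.card_fun]
    calc _ ≤ X ^ 2 * X ^ 2 := by
          gcongr
          · omega
          · refine le_trans (le_of_eq ?_) c1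
            ring
      _ = X ^ 4 := by ring
      _ ≤ B := hpow 4 (by omega)
  obtain ⟨S₂, h₂, hW⟩ := exists_step_zip (ι := Fin N × Bool) (B := B) hL2 hcW hB0
    (fun h => (he h.1).step h₁) hl (fun _ a b => (a, b))
  obtain ⟨S₃, h₃, θ, hθ, hbest⟩ := exists_step_best' (S := S₂) (B := B) hΘL
    (by
      simp only [Fintype.card_prod, Fintype.card_fin, Fintype.card_bool]
      exact le_trans (by rw [pow_one]; omega) (hpow 1 (by omega))) hΘB
    (x := fun (h : Fin N × Bool) ω => offeredPair h (e h.1 ω h.2) (f ω (e h.1 ω h.2)))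
    (fun h => (hW h).map fun a => offeredPair h (a.1 h.2) a.2)
    (hS.mono (h₁.subset.trans h₂.subset))
    (fun θ p => p.elim false fun a => !col θ a.1 && col θ a.2)
  obtain ⟨S₄, h₄, hZ⟩ := exists_step_zip (ι := Fin N × Bool) (B := B) (β := Option V × Bool) hL2
    (by
      simp only [Nat.card_eq_fintype_card, Fintype.card_prod, Fintype.card_bool,
        Fintype.card_option]
      calc _ ≤ X * X := by gcongr <;> omega
        _ = X ^ 2 := by ring
        _ ≤ B := hpow 2 (by omega)) hB0
    (fun h => (hW h).step h₃) (fun _ => hθ)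
    (fun h a θ => (a.2.elim (a.1 h.2) fun p =>
        if col θ (a.1 h.2) = false ∧ col θ p.2.2 = true then p.2.2 else a.1 h.2,
      (offeredPair h (a.1 h.2) a.2).elim false fun p => !col θ p.1 && col θ p.2))
  obtain ⟨S₅, h₅, hY⟩ := exists_step_zip (ι := Fin N) (B := B)
    (β := (Option V × Bool) × (Option V × Bool)) hL2
    (by
      simp only [Nat.card_eq_fintype_card, Fintype.card_prod, Fintype.card_bool,
        Fintype.card_option]
      calc _ ≤ (X * X) * (X * X) := by gcongr <;> omega
        _ = X ^ 4 := by ring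
        _ ≤ B := hpow 4 (by omega)) hB0
    (fun i => hZ (i, false)) (fun i => hZ (i, true)) (fun _ a b => (a, b))
  have hpick : ∀ ω, IsPick (fun i => e i ω) (pickOf (f ω) (col (θ ω))) := fun ω =>
    isPick_pickOf (hf ω) _
  have hpk : ∀ ω i b, decide (Picked (fun i => e i ω) (pickOf (f ω) (col (θ ω))) i b) =
      (offeredPair (i, b) (e i ω b) (f ω (e i ω b))).elim false
        fun p => !col (θ ω) p.1 && col (θ ω) p.2 := by
    intro ω i b
    rw [Bool.eq_iff_iff, decide_eq_true_iff, picked_pickOf (hf ω)]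
    rcases offeredPair (i, b) (e i ω b) (f ω (e i ω b)) with _ | p <;> simp
  refine ⟨S₅, ((((h₁.trans h₂).trans h₃).trans h₄).trans h₅).mono ?_,
    fun ω => pickOf (f ω) (col (θ ω)), hpick, fun i => ?_, fun i => ?_, fun ω a ha => ?_⟩
  · simp only [Fintype.card_prod, Fintype.card_fin, Fintype.card_bool]
    apply le_of_eq
    ring
  · refine ((hY i).map fun a => fun c : Bool => if a.1.2 || a.2.2 then none
      else bif c then a.2.1 else a.1.1).of_det fun ω ω' h => ?_
    have key : ∀ ω, contract (fun i => e i ω) (pickOf (f ω) (col (θ ω))) i = fun c : Bool =>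
        if (offeredPair (i, false) (e i ω false) (f ω (e i ω false))).elim false
            (fun p => !col (θ ω) p.1 && col (θ ω) p.2) ||
          (offeredPair (i, true) (e i ω true) (f ω (e i ω true))).elim false
            (fun p => !col (θ ω) p.1 && col (θ ω) p.2) then none
        else bif c then (f ω (e i ω true)).elim (e i ω true) fun p =>
            if col (θ ω) (e i ω true) = false ∧ col (θ ω) p.2.2 = true then p.2.2 else e i ω true
          else (f ω (e i ω false)).elim (e i ω false) fun p =>
            if col (θ ω) (e i ω false) = false ∧ col (θ ω) p.2.2 = true then p.2.2
            else e i ω false := by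
      intro ω
      funext c
      rw [← hpk, ← hpk]
      by_cases hp : ∃ b, Picked (fun i => e i ω) (pickOf (f ω) (col (θ ω))) i b
      · obtain ⟨b, hb⟩ := hp
        rw [contract_eq_none (hpick ω) hb, if_pos]
        cases b <;> simp [hb]
      · rw [contract_eq (hpick ω) (not_exists.1 hp), newEnd_eq (hf ω), if_neg]
        · cases c <;> rfl
        · simp only [Bool.or_eq_true, decide_eq_true_iff, not_or]
          exact ⟨not_exists.1 hp _, not_exists.1 hp _⟩
    rw [key, key]
    exact h
  · refine ((hY i).map fun a => fun c : Bool => bif c then a.2.2 else a.1.2).of_det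
      fun ω ω' h => ?_
    have key : ∀ ω, (fun b => decide (Picked (fun i => e i ω) (pickOf (f ω) (col (θ ω))) i b)) =
        fun c : Bool => bif c then (offeredPair (i, true) (e i ω true) (f ω (e i ω true))).elim
            false (fun p => !col (θ ω) p.1 && col (θ ω) p.2)
          else (offeredPair (i, false) (e i ω false) (f ω (e i ω false))).elim false
            (fun p => !col (θ ω) p.1 && col (θ ω) p.2) := by
      intro ω
      funext c
      rw [hpk]
      cases c <;> rfl
    rw [key, key]
    exact h
  · obtain ⟨θ', hθ'⟩ := exists_good_coloring (H := Fin N × Bool) hcol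
      (p := fun h => offeredPair h (e h.1 ω h.2) (f ω (e h.1 ω h.2)))
      (fun h x y hp => offeredPair_ne (e := fun i => e i ω) (hf ω) hp)
    calc size a ≤ _ := size_le_card_offered (e := fun i => e i ω) (hf ω) ha
      _ ≤ _ := hθ'
      _ ≤ D * _ := Nat.mul_le_mul le_rfl (hbest ω θ')
      _ ≤ D * picks (pickOf (f ω) (col (θ ω))) :=
        Nat.mul_le_mul le_rfl (card_offered_le_picks (e := fun i => e i ω) (hf ω) _)

end

end Orientation

/-! ### Maximum matchings by repeated contractions -/

namespace Orientation

open Circuit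

section

variable {Ω : Type} {L B q J : ℕ} {S : Set (Ω → ℕ)}

open Classical in
/-- Collecting the active values in an array of `N'` slots. -/
theorem exists_step_compact {N N' : ℕ} {β : Type} [Finite β] (hq : 0 < q)
    (hL : 2 * (q * q) ≤ L) (hN : N + N' ≤ q ^ J * (2 * (q * q)))
    (hB : (N + N' + 1) * ((N' + 1) * (N * Nat.card β + 1)) ≤ B) (hS : S.Nonempty)
    {x : Fin N → Ω → β} (hx : ∀ i, Avail S (x i)) (act : β → Bool) :
    ∃ S', Step L B (lookupCost J * (N + N') + 6 * N) S S' ∧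
      ∃ t : Fin N' → Ω → Option (Fin N × β), (∀ j, Avail S' (t j)) ∧ ∀ ω,
        (∀ j i b, t j ω = some (i, b) → b = x i ω) ∧
        (∀ j j' i b b', t j ω = some (i, b) → t j' ω = some (i, b') → j = j') ∧
        ((Finset.univ.filter fun i => act (x i ω) = true).card ≤ N' →
          ∀ i, act (x i ω) = true → ∃ j, t j ω = some (i, x i ω)) := by
  have hL2 : 2 ≤ L := by have := Nat.mul_pos hq hq; omega
  have hB1 : N' * (N * Nat.card β) + 1 ≤ B := by
    refine le_trans ?_ hB
    calc N' * (N * Nat.card β) + 1 ≤ 1 * ((N' + 1) * (N * Nat.card β + 1)) := by nlinarith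
      _ ≤ _ := Nat.mul_le_mul (by omega) le_rfl
  have hB2 : N + 1 ≤ B := by
    refine le_trans ?_ hB
    calc N + 1 ≤ (N + N' + 1) * 1 := by omega
      _ ≤ _ := Nat.mul_le_mul le_rfl (Nat.mul_pos (by omega) (by omega))
  have hB0 : 0 < B := by omega
  obtain ⟨S₁, h₁, hc⟩ := exists_step_count (B := B) hL2 hB2 fun i => (hx i).map act
  let r : Fin N → Ω → ℕ := fun i ω =>
    (Finset.univ.filter fun j : Fin N => j < i ∧ act (x j ω) = true).card
  -- The active value of rank k is addressed to slot k. Ranks from N' on are discarded, which loses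
  -- nothing if at most N' values are active.
  obtain ⟨S₂, h₂, hd⟩ := exists_step_zip (ι := Fin N) (B := B) (f := x) (g := r)
    (β := Option (Fin N' × (Fin N × β))) hL2
    (by simpa [Nat.card_prod, Finite.card_option] using hB1) hB0 (fun i => (hx i).step h₁) hc
    (fun i a k => if h : k < N' then (if act a = true then some (⟨k, h⟩, (i, a)) else none)
      else none)
  obtain ⟨S₃, h₃, f, hf, ht⟩ := exists_step_lookup (J := J) (B := B) (ι' := Fin N') (κ := Fin N')
    (β := Fin N × β) hq hL
    (by simpa [Nat.card_prod] using hB)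
    (by simpa using hN) hd (fun j => avail_const (hS.mono (h₁.subset.trans h₂.subset)) j)
  refine ⟨S₃, ((h₁.trans h₂).trans h₃).mono ?_, fun j ω => f ω j, ht, fun ω => ?_⟩
  · simp only [Fintype.card_fin]
    apply le_of_eq
    ring
  have hspec : ∀ j i b, f ω j = some (i, b) → b = x i ω ∧ r i ω = j := by
    intro j i b hj
    obtain ⟨i', hi'⟩ := (hf ω).exists_of_eq_some j (i, b) hj
    split_ifs at hi' with h1 h2
    simp only [Option.some.injEq, Prod.mk.injEq] at hi'
    obtain ⟨h3, rfl, rfl⟩ := hi'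
    exact ⟨rfl, congrArg Fin.val h3⟩
  refine ⟨fun j i b hj => (hspec j i b hj).1, fun j j' i b b' hj hj' => ?_, fun hcard i hi => ?_⟩
  · exact Fin.ext ((hspec j i b hj).2.symm.trans (hspec j' i b' hj').2)
  · have hlt : r i ω < N' := by
      refine lt_of_lt_of_le (Finset.card_lt_card ⟨fun j hj => ?_, fun hsub => ?_⟩) hcard
      · rw [Finset.mem_filter_univ] at hj ⊢
        exact hj.2
      · have := hsub ((Finset.mem_filter_univ i).2 hi)
        rw [Finset.mem_filter_univ] at this
        exact lt_irrefl _ this.1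
    have hinj : ∀ i', act (x i' ω) = true → r i' ω = r i ω → i' = i := by
      have hmono : ∀ a b : Fin N, act (x a ω) = true → a < b → r a ω < r b ω := by
        intro a b ha hab
        refine Finset.card_lt_card ⟨fun j hj => ?_, fun hsub => ?_⟩
        · rw [Finset.mem_filter_univ] at hj ⊢
          exact ⟨hj.1.trans hab, hj.2⟩
        · have := hsub ((Finset.mem_filter_univ a).2 ⟨hab, ha⟩)
          rw [Finset.mem_filter_univ] at this
          exact lt_irrefl _ this.1
      intro i' hi' heq
      rcases lt_trichotomy i' i with h | h | h
      · have := hmono _ _ hi' h; omega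
      · exact h
      · have := hmono _ _ hi h; omega
    refine ⟨⟨r i ω, hlt⟩, ?_⟩
    rcases hfi : f ω ⟨r i ω, hlt⟩ with _ | ⟨i', b⟩
    · refine absurd ?_ ((hf ω).ne_of_eq_none _ hfi i (i, x i ω))
      simp only [hi, if_true, dif_pos hlt]
    · obtain ⟨i'', hi''⟩ := (hf ω).exists_of_eq_some _ _ hfi
      split_ifs at hi'' with h1 h2
      simp only [Option.some.injEq, Prod.mk.injEq, Fin.mk.injEq] at hi''
      obtain ⟨h3, rfl, rfl⟩ := hi''
      have := hinj i'' h2 h3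
      subst this
      exact hfi

/-- Sending values back from the slots. -/
theorem exists_step_return {N N' : ℕ} {γ : Type} [Finite γ] (hq : 0 < q)
    (hL : 2 * (q * q) ≤ L) (hN : N' + N ≤ q ^ J * (2 * (q * q)))
    (hB : (N' + N + 1) * ((N + 1) * (Nat.card γ + 1)) ≤ B) (hS : S.Nonempty)
    {t : Fin N' → Ω → Option (Fin N)} (ht : ∀ j, Avail S (t j))
    (hinj : ∀ ω j j' i, t j ω = some i → t j' ω = some i → j = j')
    {y' : Fin N' → Ω → γ} (hy' : ∀ j, Avail S (y' j)) :
    ∃ S', Step L B (lookupCost J * (N' + N) + 3 * N') S S' ∧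
      ∃ y : Fin N → Ω → Option γ, (∀ i, Avail S' (y i)) ∧ ∀ ω,
        (∀ j i, t j ω = some i → y i ω = some (y' j ω)) ∧
        ∀ i, (∀ j, t j ω ≠ some i) → y i ω = none := by
  have hL2 : 2 ≤ L := by have := Nat.mul_pos hq hq; omega
  have hB1 : N * Nat.card γ + 1 ≤ B := by
    refine le_trans ?_ hB
    calc N * Nat.card γ + 1 ≤ 1 * ((N + 1) * (Nat.card γ + 1)) := by nlinarith
      _ ≤ _ := Nat.mul_le_mul (by omega) le_rfl
  have hB0 : 0 < B := by omega
  obtain ⟨S₁, h₁, hd⟩ := exists_step_zip (ι := Fin N') (B := B) (β := Option (Fin N × γ)) hL2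
    (by simpa [Nat.card_prod, Finite.card_option] using hB1) hB0 ht hy'
    (fun _ a b => a.map fun i => (i, b))
  obtain ⟨S₂, h₂, f, hf, hr⟩ := exists_step_lookup (J := J) (B := B) (ι' := Fin N) (κ := Fin N)
    (β := γ) hq hL (by simpa using hB) (by simpa using hN) hd
    (fun j => avail_const (hS.mono h₁.subset) j)
  refine ⟨S₂, (h₁.trans h₂).mono ?_, fun i ω => f ω i, hr, fun ω => ⟨fun j i hj => ?_,
    fun i hi => ?_⟩⟩
  · simp only [Fintype.card_fin]
    apply le_of_eq
    ring
  · rcases hfi : f ω i with _ | b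
    · refine absurd ?_ ((hf ω).ne_of_eq_none _ hfi j (y' j ω))
      simp [hj]
    · obtain ⟨j', hj'⟩ := (hf ω).exists_of_eq_some _ _ hfi
      obtain ⟨i', hi', h1⟩ := Option.map_eq_some_iff.1 hj'
      simp only [Prod.mk.injEq] at h1
      obtain ⟨rfl, rfl⟩ := h1
      have := hinj ω j j' i' hj hi'
      subst this
      exact hfi
  · rcases hfi : f ω i with _ | b
    · exact hfi
    · obtain ⟨j', hj'⟩ := (hf ω).exists_of_eq_some _ _ hfi
      obtain ⟨i', hi', h1⟩ := Option.map_eq_some_iff.1 hj'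
      simp only [Prod.mk.injEq] at h1
      obtain ⟨rfl, rfl⟩ := h1
      exact absurd hi' (hi j')

theorem exists_good {E V : Type*} [Fintype E] (e : E → Bool → Option V) (s : ℕ) :
    ∃ y, Good e s y := by
  classical
  obtain ⟨y, hy, hmax⟩ := Set.exists_max_image {y | IsMatching e y} size (Set.toFinite _)
    ⟨_, isMatching_none e⟩
  exact ⟨y, fun _ => ⟨hy, hmax⟩⟩

variable {V : Type} [Fintype V]

open Classical in
/-- Lifting a matching of the contracted graph. -/
theorem exists_step_lift {N : ℕ} (hq : 0 < q) (hL : 2 * (q * q) ≤ L)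
    (hN : 4 * N ≤ q ^ J * (2 * (q * q))) (hB : (4 * N + Fintype.card V + 4) ^ 2 * 2 ≤ B)
    {e : Fin N → Ω → Bool → Option V} (he : ∀ i, Avail S (e i))
    {pk : Ω → V → Option (Fin N × Bool)}
    (hpk : ∀ i, Avail S fun ω b => decide (Picked (fun i => e i ω) (pk ω) i b))
    {y : Fin N → Ω → Option Bool} (hy : ∀ i, Avail S (y i)) :
    ∃ S', Step L B ((4 * lookupCost J + 15) * N) S S' ∧ ∃ taken : Ω → V → Prop,
      (∀ ω v, taken ω v ↔ ∃ j c, y j ω = some c ∧ e j ω c = some v) ∧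
      ∀ i, Avail S' fun ω => lift (fun i => e i ω) (pk ω) (taken ω) (fun i => y i ω) i := by
  classical
  set X := 4 * N + Fintype.card V + 4 with hX
  have hL2 : 2 ≤ L := by have := Nat.mul_pos hq hq; omega
  have hX16 : 4 * 4 ≤ X ^ 2 := by rw [pow_two]; exact Nat.mul_le_mul (by omega) (by omega)
  have hXX : X ≤ X ^ 2 := Nat.le_self_pow two_ne_zero X
  have hB0 : 0 < B := by omega
  have hBX : X ≤ B := by omega
  -- Every matched edge registers the endpoint it is matched to, and all edge ends are then looked
  -- up among the registered vertices. The test against `none` keeps `none` from counting as taken,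
  -- also when `y` is no matching.
  obtain ⟨S₁, h₁, hd⟩ := exists_step_zip (ι := Fin N × Bool) (B := B)
    (β := Option (Option V × Unit)) hL2
    (by
      simp only [Nat.card_eq_fintype_card, Fintype.card_prod, Fintype.card_option,
        Fintype.card_unit]
      omega) hB0 (fun h => hy h.1) (fun h => he h.1)
    (fun h a b => if a = some h.2 ∧ b h.2 ≠ none then some (b h.2, ()) else none)
  obtain ⟨S₂, h₂, f, hf, hl⟩ := exists_step_lookup (J := J) (B := B) (ι' := Fin N × Bool)
    (κ := Option V) (β := Unit) hq hL
    (by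
      simp only [Nat.card_eq_fintype_card, Fintype.card_prod, Fintype.card_option,
        Fintype.card_unit, Fintype.card_fin, Fintype.card_bool]
      calc _ ≤ X * (X * 2) := by gcongr <;> omega
        _ = X ^ 2 * 2 := by ring
        _ ≤ B := hB)
    (by simp only [Fintype.card_prod, Fintype.card_fin, Fintype.card_bool]; omega) hd
    (fun h => ((he h.1).map fun a => a h.2).step h₁)
  obtain ⟨S₃, h₃, hT⟩ := exists_step_zip (ι := Fin N) (B := B) (β := Bool × Bool) hL2
    (by simp only [Nat.card_eq_fintype_card, Fintype.card_prod, Fintype.card_bool]; omega) hB0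
    (fun i => hl (i, false)) (fun i => hl (i, true)) (fun _ a b => (a.isSome, b.isSome))
  obtain ⟨S₄, h₄, hP⟩ := exists_step_zip (ι := Fin N) (B := B) (S := S₃)
    (β := Option (Option Bool) × Bool) hL2
    (by
      simp only [Nat.card_eq_fintype_card, Fintype.card_prod, Fintype.card_bool,
        Fintype.card_option]
      omega) hB0
    (fun i => ((hpk i).step h₁).mono (h₂.subset.trans h₃.subset))
    (fun i => ((hy i).step h₁).mono (h₂.subset.trans h₃.subset))
    (fun _ a b => (if a false then none else if a true then none else some b, a false))
  obtain ⟨S₅, h₅, hO⟩ := exists_step_zip (ι := Fin N) (B := B) (β := Option Bool) hL2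
    (by
      simp only [Nat.card_eq_fintype_card, Fintype.card_bool, Fintype.card_option]
      omega) hB0 (fun i => (hT i).step h₄) hP
    (fun _ a b => b.1.elim (if b.2 then some a.1 else some (!a.2)) id)
  have htaken : ∀ ω v, (f ω (some v)).isSome = true ↔
      ∃ j c, y j ω = some c ∧ e j ω c = some v := by
    intro ω v
    constructor
    · intro h
      obtain ⟨u, hu⟩ := Option.isSome_iff_exists.1 h
      obtain ⟨⟨j, c⟩, hj⟩ := (hf ω).exists_of_eq_some _ _ hu
      split_ifs at hj with h1
      simp only [Option.some.injEq, Prod.mk.injEq] at hj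
      exact ⟨j, c, h1.1, hj.1⟩
    · rintro ⟨j, c, h1, h2⟩
      by_contra h3
      rw [Bool.not_eq_true, Option.isSome_eq_false_iff, Option.isNone_iff_eq_none] at h3
      refine (hf ω).ne_of_eq_none _ h3 (j, c) () ?_
      simp [h1, h2]
  have hnone : ∀ ω, f ω none = none := by
    intro ω
    rcases h : f ω none with _ | u
    · rfl
    · obtain ⟨⟨j, c⟩, hj⟩ := (hf ω).exists_of_eq_some _ _ h
      split_ifs at hj with h1
      simp only [Option.some.injEq, Prod.mk.injEq] at hj
      exact absurd hj.1 h1.2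
  have hdec : ∀ ω i b, decide (∃ v, e i ω b = some v ∧ (f ω (some v)).isSome = true) =
      (f ω (e i ω b)).isSome := by
    intro ω i b
    rcases e i ω b with _ | v
    · simp [hnone]
    · simp
  refine ⟨S₅, ((((h₁.trans h₂).trans h₃).trans h₄).trans h₅).mono ?_,
    fun ω v => (f ω (some v)).isSome = true, htaken, fun i => ?_⟩
  · simp only [Fintype.card_prod, Fintype.card_fin, Fintype.card_bool]
    apply le_of_eq
    ring
  · refine (hO i).of_det fun ω ω' h => ?_
    have key : ∀ ω, lift (fun i => e i ω) (pk ω) (fun v => (f ω (some v)).isSome = true)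
        (fun i => y i ω) i =
        Option.elim (if decide (Picked (fun i => e i ω) (pk ω) i false) then none
          else if decide (Picked (fun i => e i ω) (pk ω) i true) then none else some (y i ω))
          (if decide (Picked (fun i => e i ω) (pk ω) i false) then
            some (f ω (e i ω false)).isSome else some (!(f ω (e i ω true)).isSome)) id := by
      intro ω
      rw [lift, ← hdec, ← hdec]
      by_cases h1 : Picked (fun i => e i ω) (pk ω) i false
      · simp [h1]
      · by_cases h2 : Picked (fun i => e i ω) (pk ω) i true <;> simp [h1, h2]
    rw [key, key]
    exact h

/-- The cost per edge of one round. -/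
def roundCost (J : ℕ) : ℕ := 12 * lookupCost J + 60

/-- Maximum matchings of `N` edges. -/
theorem exists_step_matching {n s D T : ℕ} {Θ : Type} [Fintype Θ] [Nonempty Θ]
    {col : Θ → Option V → Bool} (hcol : ∀ x y, x ≠ y → Fintype.card Θ ≤
      D * (Finset.univ.filter fun θ => col θ x = false ∧ col θ y = true).card)
    (hq : 0 < q) (hL : 2 * (q * q) ≤ L) (hΘL : 2 * Fintype.card Θ ≤ L) (hΘB : Fintype.card Θ ≤ B)
    (hn : 4 * n ≤ q ^ J * (2 * (q * q))) (hB : (4 * n + Fintype.card V + 4) ^ 5 ≤ B)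
    (hTL : T ≤ L) (hTs : 2 * s ≤ T) (hTD : 2 * D ≤ T) (hTΘ : Fintype.card Θ ≤ T) (hD : 0 < D)
    (N : ℕ) (hN : N ≤ n) :
    ∀ (S : Set (Ω → ℕ)), S.Nonempty → ∀ e : Fin N → Ω → Bool → Option V, (∀ i, Avail S (e i)) →
    ∃ S', Step L B ((4 * D * roundCost J + 2) * N) S S' ∧ ∃ y : Fin N → Ω → Option Bool,
      (∀ i, Avail S' (y i)) ∧ ∀ ω, Good (fun i => e i ω) s (fun i => y i ω) := by
  classical
  induction N using Nat.strong_induction_on with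
  | _ N ih =>
  intro S hS e he
  set X := 4 * n + Fintype.card V + 4 with hX
  have hX1 : 1 ≤ X := by omega
  have hpow : ∀ k ≤ 5, X ^ k ≤ B := fun k hk => (Nat.pow_le_pow_right hX1 hk).trans hB
  have hB0 : 0 < B := (Nat.pow_pos hX1).trans_le hB
  have hX16 : 4 * 4 ≤ X ^ 2 := by rw [pow_two]; exact Nat.mul_le_mul (by omega) (by omega)
  -- At most T ≤ L edges fit into a single gate, which outputs a maximum matching outright.
  rcases le_or_gt N T with hNT | hNT
  · choose g hg using fun e : Fin N → Bool → Option V => exists_good e s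
    obtain ⟨S', h, hy⟩ := exists_step_gate (S := S) (L := L) (B := B) (ι := Fin N) (κ := Fin N)
      (β := Option Bool) (y := fun i ω => g (fun i => e i ω) i)
      (by rw [Fintype.card_fin]; omega)
      (by
        simp only [Nat.card_eq_fintype_card, Fintype.card_bool, Fintype.card_option]
        exact le_trans (by omega) (hpow 2 (by omega))) hB0 he (by
        intro k ω ω' h
        simp only [h])
    refine ⟨S', h.mono ?_, _, hy, fun ω => hg _⟩
    rw [Fintype.card_fin, add_mul]
    omega
  obtain ⟨S₁, h₁, pk, hpk, hc, hp, hcount⟩ := exists_step_pick (J := J) hcol hq hL hΘL hΘB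
    (by omega : 4 * N ≤ _) ((Nat.pow_le_pow_left (by omega) 5).trans hB) hS he
  have hS₁ := hS.mono h₁.subset
  -- Here N > 2 s. If all N edges are alive and some matching misses at most s of them, it matches
  -- at least half, so at least N / (2 D) edges are chosen and the survivors fit into N' slots. With
  -- fewer live edges this remains true, as shown below.
  set N' := N - N / (2 * D) with hN'
  have hdiv1 : 1 ≤ N / (2 * D) := (Nat.one_le_div_iff (by omega)).2 (by omega)
  have hdivle : N / (2 * D) ≤ N := Nat.div_le_self _ _
  have hcardE : N * (Fintype.card V + 1) ^ 2 + 1 ≤ X ^ 3 := by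
    calc N * (Fintype.card V + 1) ^ 2 + 1 ≤ (N + 1) * (Fintype.card V + 1) ^ 2 := by
          rw [add_mul, one_mul]; gcongr; exact Nat.one_le_pow _ _ (by omega)
      _ ≤ X * X ^ 2 := by gcongr <;> omega
      _ = X ^ 3 := by ring
  obtain ⟨S₂, h₂, t, ht, htspec⟩ := exists_step_compact (J := J) (L := L) (B := B) (N' := N')
    (β := Bool → Option V) hq hL (by omega)
    (by
      simp only [Nat.card_eq_fintype_card, Fintype.card_bool, Fintype.card_option,
        Fintype.card_fun]
      calc _ ≤ X * (X * X ^ 3) := by gcongr <;> omega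
        _ = X ^ 5 := by ring
        _ ≤ B := hB) hS₁ hc (fun a => (a false).isSome || (a true).isSome)
  have hS₂ := hS₁.mono h₂.subset
  obtain ⟨S₃, h₃, y', hy', hgood⟩ := ih N' (by omega) (by omega) S₂ hS₂
    (fun j ω c => (t j ω).bind fun a => a.2 c)
    (fun j => (ht j).map fun o => fun c => o.bind fun a => a.2 c)
  have hinj : ∀ ω j j' i, (t j ω).map Prod.fst = some i → (t j' ω).map Prod.fst = some i →
      j = j' := by
    intro ω j j' i hj hj'
    obtain ⟨⟨i₁, b₁⟩, h1, rfl⟩ := Option.map_eq_some_iff.1 hj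
    obtain ⟨⟨i₂, b₂⟩, h2, h3⟩ := Option.map_eq_some_iff.1 hj'
    simp only at h3
    subst h3
    exact (htspec ω).2.1 _ _ _ _ _ h1 h2
  obtain ⟨S₄, h₄, z, hz, hzspec⟩ := exists_step_return (J := J) (L := L) (B := B)
    (S := S₃) (γ := Option Bool) (t := fun j ω => (t j ω).map Prod.fst) hq hL (by omega)
    (by
      simp only [Nat.card_eq_fintype_card, Fintype.card_bool, Fintype.card_option]
      calc _ ≤ X * (X * X) := by gcongr <;> omega
        _ = X ^ 3 := by ring
        _ ≤ B := hpow 3 (by omega)) (hS₂.mono h₃.subset)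
    (fun j => ((ht j).map _).step h₃) hinj hy'
  have hS₁₄ : S₁ ⊆ S₄ := h₂.subset.trans (h₃.subset.trans h₄.subset)
  obtain ⟨S₅, h₅, taken, htaken, hout⟩ := exists_step_lift (J := J) (L := L) (B := B) (S := S₄)
    hq hL (by omega : 4 * N ≤ _)
    (by
      calc _ ≤ X ^ 2 * X := by gcongr <;> omega
        _ = X ^ 3 := by ring
        _ ≤ B := hpow 3 (by omega))
    (fun i => (he i).mono (h₁.subset.trans hS₁₄)) (fun i => (hp i).mono hS₁₄)
    (fun i => (hz i).map Option.join)
  refine ⟨S₅, ((((h₁.trans h₂).trans h₃).trans h₄).trans h₅).mono ?_, _, hout, fun ω => ?_⟩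
  · have hN'N : N' ≤ N := Nat.sub_le _ _
    -- As N / (2 D) is positive, rounding down loses at most a factor two. The N / (2 D) edges that
    -- disappear can thus pay for the whole round, at 4 D times `roundCost J` each.
    have hkey : N ≤ 4 * D * (N / (2 * D)) := by
      have h1 := Nat.div_add_mod N (2 * D)
      have h2 := Nat.mod_lt N (show 0 < 2 * D by omega)
      have h3 : 2 * D * 1 ≤ 2 * D * (N / (2 * D)) := Nat.mul_le_mul_left _ hdiv1
      have h4 : 4 * D * (N / (2 * D)) = 2 * D * (N / (2 * D)) + 2 * D * (N / (2 * D)) := by ring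
      omega
    have hrec : (4 * D * roundCost J + 2) * N' + roundCost J * N ≤
        (4 * D * roundCost J + 2) * N := by
      have h1 : N' + N / (2 * D) = N := by omega
      calc _ ≤ (4 * D * roundCost J + 2) * N' +
            (4 * D * roundCost J + 2) * (N / (2 * D)) := by
            have := Nat.mul_le_mul_left (roundCost J) hkey
            nlinarith
        _ = _ := by rw [← mul_add, h1]
    have hround : (4 * lookupCost J + 21) * N + 5 * Fintype.card Θ +
        (lookupCost J * (N + N') + 6 * N) + (lookupCost J * (N' + N) + 3 * N') +
        (4 * lookupCost J + 15) * N ≤ roundCost J * N := by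
      have h1 : lookupCost J * N' ≤ lookupCost J * N := Nat.mul_le_mul_left _ hN'N
      have h2 : Fintype.card Θ ≤ N := by omega
      simp only [roundCost]
      nlinarith
    omega
  · rintro ⟨a, ha, hs⟩
    refine Good.lift (hpk ω) (Good.of_slots (t := fun j => (t j ω).map Prod.fst)
      (y' := fun j => y' j ω) (hinj ω) ?_ ?_ ?_
      ?_) (htaken ω) ⟨a, ha, hs⟩
    · intro i c hic
      have hact : ∀ i, ((contract (fun i => e i ω) (pk ω) i false).isSome ||
          (contract (fun i => e i ω) (pk ω) i true).isSome) = true ↔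
          ∃ b, contract (fun i => e i ω) (pk ω) i b ≠ none := by
        intro i
        simp [Option.isSome_iff_ne_none]
      obtain ⟨j, hj⟩ := (htspec ω).2.2 (by
        refine le_trans (le_of_eq ?_) (?_ : alive (contract (fun i => e i ω) (pk ω)) ≤ N')
        · rw [alive]
          congr 1
          ext i
          rw [Finset.mem_filter_univ, Finset.mem_filter_univ, hact]
        · have h1 := alive_contract_add_picks_le (hpk ω)
          have h2 := hcount ω a ha
          have h3 : alive (fun i => e i ω) ≤ N :=
            (Finset.card_le_univ _).trans_eq (Fintype.card_fin N)
          -- Write g = N / (2 D) and p for the number of choices. More than N - g survivors would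
          -- give p < g and N - g + p < alive ≤ size + s ≤ D p + N / 2, so (D - 1) p > N / 2 - g.
          -- But (D - 1) p ≤ (D - 1) g ≤ N / 2 - g, because 2 D g ≤ N.
          by_contra hlt
          have h4 : picks (pk ω) < N / (2 * D) := by omega
          obtain ⟨d, rfl⟩ : ∃ d, D = d + 1 := ⟨D - 1, by omega⟩
          have h5 : d * picks (pk ω) ≤ d * (N / (2 * (d + 1))) := Nat.mul_le_mul_left _ h4.le
          have h6 : 2 * (d + 1) * (N / (2 * (d + 1))) ≤ N := Nat.mul_div_le _ _
          have h7 : 2 * (d + 1) * (N / (2 * (d + 1))) =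
            2 * (d * (N / (2 * (d + 1)))) + 2 * (N / (2 * (d + 1))) := by ring
          have h8 : (d + 1) * picks (pk ω) = d * picks (pk ω) + picks (pk ω) := by ring
          omega) i ((hact i).2 ⟨c, hic⟩)
      exact ⟨j, by simp [hj]⟩
    · have h1 : (fun (j : Fin N') c => ((t j ω).map Prod.fst).bind fun i =>
          contract (fun i => e i ω) (pk ω) i c) = fun j c => (t j ω).bind fun a => a.2 c := by
        funext j c
        rcases h : t j ω with _ | ⟨i, b⟩
        · rfl
        · rw [(htspec ω).1 _ _ _ h]
          rfl
      rw [h1]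
      exact hgood ω
    · intro j i hj
      rw [(hzspec ω).1 j i hj]
      rfl
    · intro i hi
      rw [(hzspec ω).2 i hi]
      rfl

end

end Orientation

/-! ### Circuits for cuckoo tables -/

namespace Cuckoo

open Circuit Orientation

section

variable {n m s : ℕ}

/-- The endpoints of an item: its cells in the two tables. -/
def ends (h₁ h₂ : Fin n → Fin m) (i : Fin n) (b : Bool) : Option (Fin m ⊕ Fin m) :=
  some (bif b then Sum.inr (h₂ i) else Sum.inl (h₁ i))

/-- The cell of an item, from its endpoint (if any) and its rank among the items without one. -/
def cellOf (u v : Fin m) (y : Option Bool) (k : Option (Fin s)) : Option (Loc m s) :=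
  y.elim (k.map fun k => Sum.inr (Sum.inr k))
    fun b => some (bif b then Sum.inr (Sum.inl v) else Sum.inl u)

/-- The number `k` as an element of `Fin s`, if it is one. -/
def toFin? (s k : ℕ) : Option (Fin s) := if h : k < s then some ⟨k, h⟩ else none

/-- The number of earlier items without endpoint. -/
def missRank (y : Fin n → Option Bool) (i : Fin n) : ℕ :=
  (Finset.univ.filter fun j => j < i ∧ (y j).isNone = true).card

/-- A placement yields a matching with at most s unmatched items. So the promise in `Good` holds,
and the maximum matching `y` misses no more items than this one. -/
theorem good_ends {h₁ h₂ : Fin n → Fin m} (hs : StashSuffices h₁ h₂ s)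
    {y : Fin n → Option Bool} (hy : Good (ends h₁ h₂) s y) :
    IsMatching (ends h₁ h₂) y ∧ (Finset.univ.filter fun i => (y i).isNone = true).card ≤ s := by
  classical
  obtain ⟨place, hp⟩ := hs
  have hcompl : ∀ y : Fin n → Option Bool,
      size y + (Finset.univ.filter fun i => (y i).isNone = true).card = n := by
    intro y
    have h1 : (Finset.univ.filter fun i => (y i).isNone = true) =
        Finset.univ.filter fun i => ¬ y i ≠ none := by
      ext i
      simp
    rw [h1, size, Finset.card_filter_add_card_filter_not, Finset.card_univ, Fintype.card_fin]
  let a : Fin n → Option Bool := fun i =>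
    Sum.elim (fun _ => some false) (Sum.elim (fun _ => some true) fun _ => none) (place i)
  have ha : IsMatching (ends h₁ h₂) a := by
    refine ⟨fun i b _ => by simp [ends], fun i j b c hi hj h => hp.injective ?_⟩
    simp only [a] at hi hj
    rcases h1 : place i with u | u | u <;> rcases h2 : place j with v | v | v <;>
      simp only [h1, h2, Sum.elim_inl, Sum.elim_inr, Option.some.injEq, reduceCtorEq] at hi hj <;>
      subst hi <;> subst hj <;> simp [ends] at h ⊢
    · rw [← hp.table₁ _ _ h1, ← hp.table₁ _ _ h2, h]
    · rw [← hp.table₂ _ _ h1, ← hp.table₂ _ _ h2, h]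
  have has : (Finset.univ.filter fun i => (a i).isNone = true).card ≤ s := by
    have hex : ∀ i, (a i).isNone = true → ∃ k, place i = Sum.inr (Sum.inr k) := by
      intro i hi
      simp only [a] at hi
      rcases h : place i with u | u | u <;> simp [h] at hi ⊢
    choose k hk using hex
    have := Fintype.card_le_of_injective
      (fun i : {i // (a i).isNone = true} => k i.1 i.2) fun i j h => by
        refine Subtype.ext (hp.injective ?_)
        rw [hk _ i.2, hk _ j.2]
        simp only at h
        rw [h]
    rwa [Fintype.card_fin, Fintype.card_subtype] at this
  have h1 := hcompl a
  have h2 : alive (ends h₁ h₂) ≤ n := (Finset.card_le_univ _).trans_eq (Fintype.card_fin n)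
  obtain ⟨h3, h4⟩ := hy ⟨a, ha, by omega⟩
  have h5 := h4 a ha
  have h6 := hcompl y
  exact ⟨h3, by omega⟩

/-- The ranks of the unmatched items are strictly increasing and below their number, so they serve
as distinct stash cells. -/
theorem exists_isPlacement {h₁ h₂ : Fin n → Fin m} {y : Fin n → Option Bool}
    (hy : IsMatching (ends h₁ h₂) y)
    (hs : (Finset.univ.filter fun i => (y i).isNone = true).card ≤ s) :
    ∃ place : Fin n → Loc m s, IsPlacement h₁ h₂ place ∧
      ∀ i, cellOf (h₁ i) (h₂ i) (y i) (toFin? s (missRank y i)) = some (place i) := by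
  have hrank : ∀ i, (y i).isNone = true → missRank y i < s := by
    intro i hi
    refine lt_of_lt_of_le (Finset.card_lt_card ⟨fun j hj => ?_, fun hsub => ?_⟩) hs
    · rw [Finset.mem_filter_univ] at hj ⊢
      exact hj.2
    · have := hsub ((Finset.mem_filter_univ i).2 hi)
      rw [Finset.mem_filter_univ] at this
      exact lt_irrefl _ this.1
  have hmono : ∀ a b, (y a).isNone = true → a < b → missRank y a < missRank y b := by
    intro a b ha hab
    refine Finset.card_lt_card ⟨fun j hj => ?_, fun hsub => ?_⟩
    · rw [Finset.mem_filter_univ] at hj ⊢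
      exact ⟨hj.1.trans hab, hj.2⟩
    · have := hsub ((Finset.mem_filter_univ a).2 ⟨hab, ha⟩)
      rw [Finset.mem_filter_univ] at this
      exact lt_irrefl _ this.1
  have hex : ∀ i, ∃ l, cellOf (s := s) (h₁ i) (h₂ i) (y i) (toFin? s (missRank y i)) = some l := by
    intro i
    rcases h : y i with _ | b
    · simp [cellOf, toFin?, hrank i (by simp [h])]
    · simp [cellOf]
  choose place hplace using hex
  refine ⟨place, ⟨fun i j hij => ?_, fun i u hi => ?_, fun i u hi => ?_⟩, hplace⟩
  · have h1 := hplace i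
    have h2 := hplace j
    rw [hij, ← h2] at h1
    rcases hyi : y i with _ | b <;> rcases hyj : y j with _ | c
    · simp only [cellOf, hyi, hyj, toFin?, hrank i (by simp [hyi]), hrank j (by simp [hyj]),
        dif_pos, Option.elim_none, Option.map_some, Option.some.injEq, Sum.inr.injEq,
        Fin.mk.injEq] at h1
      rcases lt_trichotomy i j with h | h | h
      · have := hmono _ _ (by simp [hyi]) h; omega
      · exact h
      · have := hmono _ _ (by simp [hyj]) h; omega
    · simp only [cellOf, hyi, hyj, toFin?, hrank i (by simp [hyi]), dif_pos, Option.elim_none,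
        Option.map_some, Option.elim_some] at h1
      cases c <;> simp at h1
    · simp only [cellOf, hyi, hyj, toFin?, hrank j (by simp [hyj]), dif_pos, Option.elim_none,
        Option.map_some, Option.elim_some] at h1
      cases b <;> simp at h1
    · refine hy.inj i j b c hyi hyj ?_
      simp only [cellOf, hyi, hyj, Option.elim_some] at h1
      cases b <;> cases c <;> simp [ends] at h1 ⊢ <;> exact h1
  · have h1 := hplace i
    rw [hi] at h1
    rcases hyi : y i with _ | b
    · simp [cellOf, hyi, toFin?, hrank i (by simp [hyi])] at h1
    · cases b <;> simp [cellOf, hyi] at h1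
      exact h1
  · have h1 := hplace i
    rw [hi] at h1
    rcases hyi : y i with _ | b
    · simp [cellOf, hyi, toFin?, hrank i (by simp [hyi])] at h1
    · cases b <;> simp [cellOf, hyi] at h1
      exact h1

end

section

variable {Ω : Type} {L B q J : ℕ} {S : Set (Ω → ℕ)}

/-- Available words can be turned into wires. -/
theorem exists_step_words {ι : Type} [Fintype ι] (hL : 1 ≤ L) {u : ι → Ω → ℕ} (hB : 0 < B)
    (hu : ∀ i ω, u i ω < B) (ha : ∀ i, Avail S (u i)) :
    ∃ S', Step L B (2 * Fintype.card ι) S S' ∧ ∀ i, u i ∈ S' := by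
  classical
  obtain ⟨S', h, h'⟩ := exists_step_forall (S := S) (L := L) (B := B) (fun _ : ι => 2)
    (fun i S' => u i ∈ S') (fun i S S' hS h => hS h) (fun i S₁ hS => by
      obtain ⟨v, hv, hvu⟩ := ha i
      let g : List ℕ → ℕ := fun l => if h : ∃ ω, [v ω] = l then u i h.choose else 0
      have hg : ∀ ω, g [v ω] = u i ω := by
        intro ω
        have h : ∃ ω', [v ω'] = [v ω] := ⟨ω, rfl⟩
        simp only [g, dif_pos h]
        exact hvu _ _ (List.singleton_injective h.choose_spec)
      refine ⟨_, ⟨_, le_rfl, Derives.gate .refl [v] (by simpa using hS hv) hL [g] ?_⟩,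
        Or.inr ⟨g, by simp, funext fun ω => (hg ω).symm⟩⟩
      intro g' hg' l
      rw [List.mem_singleton] at hg'
      subst hg'
      simp only [g]
      split_ifs
      exacts [hu _ _, hB])
  exact ⟨S', h.mono (by simp [mul_comm]), h'⟩

/-- The cost per item of a table. -/
def tableCost (D J : ℕ) : ℕ := 4 * D * roundCost J + lookupCost J + 20

/-- A circuit that places the items in the cells of a cuckoo table. -/
theorem exists_step_table {n m s M D T : ℕ} {Θ : Type} [Fintype Θ] [Nonempty Θ]
    {col : Θ → Option (Fin m ⊕ Fin m) → Bool} (hcol : ∀ x y, x ≠ y → Fintype.card Θ ≤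
      D * (Finset.univ.filter fun θ => col θ x = false ∧ col θ y = true).card)
    (hq : 0 < q) (hL : 2 * (q * q) ≤ L) (hΘL : 2 * Fintype.card Θ ≤ L) (hΘB : Fintype.card Θ ≤ B)
    (hn : 4 * n + 2 * m + s ≤ q ^ J * (2 * (q * q))) (hB : (4 * n + 2 * m + s + 4) ^ 5 * (M + 1) ≤ B)
    (hTL : T ≤ L) (hTs : 2 * s ≤ T) (hTD : 2 * D ≤ T) (hTΘ : Fintype.card Θ ≤ T) (hD : 0 < D)
    (hS : S.Nonempty) {x : Fin n → Ω → Fin M} {h₁ h₂ : Fin n → Ω → Fin m}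
    (hx : ∀ i, Avail S (x i)) (hh₁ : ∀ i, Avail S (h₁ i)) (hh₂ : ∀ i, Avail S (h₂ i)) :
    ∃ S', Step L B (tableCost D J * (n + (2 * m + s))) S S' ∧ ∃ out : Loc m s → Ω → ℕ,
      (∀ l, out l ∈ S') ∧ ∀ ω, StashSuffices (fun i => h₁ i ω) (fun i => h₂ i ω) s →
        ∀ mem : ℕ → ℕ, (∀ l : Loc m s, mem l.addr = out l ω) →
          HoldsTable (fun i => (x i ω : ℕ)) (fun i => h₁ i ω) (fun i => h₂ i ω) s mem := by
  classical
  set X := 4 * n + 2 * m + s + 4 with hX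
  have hX1 : 1 ≤ X := by omega
  have hL2 : 2 ≤ L := by have := Nat.mul_pos hq hq; omega
  have hM : ∀ k ≤ 5, X ^ k * (M + 1) ≤ B := fun k hk =>
    (Nat.mul_le_mul_right _ (Nat.pow_le_pow_right hX1 hk)).trans hB
  have hpow : ∀ k ≤ 5, X ^ k ≤ B := fun k hk => (Nat.le_mul_of_pos_right _ (by omega)).trans (hM k hk)
  have hB0 : 0 < B := (Nat.pow_pos hX1).trans_le (hpow 5 le_rfl)
  obtain ⟨S₁, t₁, hH⟩ := exists_step_zip (ι := Fin n) (B := B) (β := Fin m × Fin m) hL2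
    (by
      simp only [Nat.card_eq_fintype_card, Fintype.card_prod, Fintype.card_fin]
      calc _ ≤ X * X := by gcongr <;> omega
        _ = X ^ 2 := by ring
        _ ≤ B := hpow 2 (by omega)) hB0 hh₁ hh₂ (fun _ a b => (a, b))
  obtain ⟨S₂, t₂, y, hy, hgood⟩ := exists_step_matching (s := s) (J := J) hcol hq hL hΘL hΘB
    (n := n) (by omega) (by
      refine le_trans (Nat.pow_le_pow_left ?_ 5) (hpow 5 le_rfl)
      simp only [Fintype.card_sum, Fintype.card_fin]
      omega) hTL hTs hTD hTΘ hD n le_rfl S₁ (hS.mono t₁.subset)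
    (fun i ω => ends (fun i => h₁ i ω) (fun i => h₂ i ω) i)
    (fun i => (hH i).of_det fun ω ω' h => by
      simp only [Prod.mk.injEq] at h
      funext b
      simp [ends, h])
  obtain ⟨S₃, t₃, hr⟩ := exists_step_count (B := B) hL2
    (le_trans (by rw [pow_one]; omega) (hpow 1 (by omega))) fun i => (hy i).map Option.isNone
  obtain ⟨S₄, t₄, hc⟩ := exists_step_zip (ι := Fin n) (B := B)
    (β := Option Bool × Option (Fin s)) hL2
    (by
      simp only [Nat.card_eq_fintype_card, Fintype.card_prod, Fintype.card_option,
        Fintype.card_bool, Fintype.card_fin]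
      calc _ ≤ X * X := by gcongr <;> omega
        _ = X ^ 2 := by ring
        _ ≤ B := hpow 2 (by omega)) hB0 (fun i => (hy i).step t₃) hr
    (fun _ a k => (a, toFin? s k))
  obtain ⟨S₅, t₅, hl⟩ := exists_step_zip (ι := Fin n) (B := B) (β := Option (Loc m s)) hL2
    (by
      simp only [Nat.card_eq_fintype_card, Fintype.card_sum, Fintype.card_option,
        Fintype.card_fin]
      exact le_trans (by rw [pow_one]; omega) (hpow 1 (by omega))) hB0
    (fun i => (((hH i).step t₂).step t₃).step t₄) hc
    (fun _ a c => cellOf a.1 a.2 c.1 c.2)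
  have hSS : S ⊆ S₅ := t₁.subset.trans (t₂.subset.trans (t₃.subset.trans (t₄.subset.trans t₅.subset)))
  have hMM : Nat.card (Option (Loc m s × Fin M)) ≤ B := by
    simp only [Nat.card_eq_fintype_card, Fintype.card_sum, Fintype.card_option,
        Fintype.card_fin, Fintype.card_prod]
    refine le_trans ?_ (hM 1 (by omega))
    rw [pow_one]
    calc _ ≤ X * M + X := Nat.add_le_add (Nat.mul_le_mul_right _ (by omega)) hX1
      _ = _ := by ring
  obtain ⟨S₆, t₆, hd⟩ := exists_step_zip (ι := Fin n) (B := B) (β := Option (Loc m s × Fin M)) hL2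
    hMM hB0 hl (fun i => (hx i).mono hSS) (fun _ a c => a.map fun l => (l, c))
  -- Every cell of the table looks up the item addressed to it; a cell without one finds nothing and
  -- outputs the word `0`.
  obtain ⟨S₇, t₇, f, hf, hq'⟩ := exists_step_lookup (J := J) (B := B) (ι' := Loc m s)
    (κ := Loc m s) (β := Fin M) hq hL (by
      simp only [Nat.card_eq_fintype_card, Fintype.card_sum, Fintype.card_fin]
      calc _ ≤ X * (X * (M + 1)) := by gcongr <;> omega
        _ = X ^ 2 * (M + 1) := by ring
        _ ≤ B := hM 2 (by omega)) (by simp only [Fintype.card_sum, Fintype.card_fin]; omega) hd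
    (fun l => avail_const ((hS.mono hSS).mono t₆.subset) l)
  obtain ⟨S₈, t₈, hout⟩ := exists_step_words (L := L) (B := B)
    (u := fun (l : Loc m s) ω => (f ω l).elim 0 fun a => (a : ℕ)) (by omega) hB0
    (fun l ω => by
      rcases f ω l with _ | a
      · exact hB0
      · have h1 := hM 0 (by omega)
        have h2 := a.2
        rw [pow_zero, one_mul] at h1
        simp only [Option.elim_some]
        omega) (fun l => (hq' l).map fun o => o.elim 0 fun a => (a : ℕ))
  refine ⟨S₈, (((((((t₁.trans t₂).trans t₃).trans t₄).trans t₅).trans t₆).trans t₇).trans t₈).mono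
    ?_, _, hout, fun ω hs mem hmem => ?_⟩
  · simp only [Fintype.card_fin, Fintype.card_sum, tableCost]
    have e1 : (4 * D * roundCost J + lookupCost J + 20) * (n + (2 * m + s)) =
      4 * D * roundCost J * n + 4 * D * roundCost J * (2 * m + s) +
        lookupCost J * (n + (m + (m + s))) + 20 * (n + (2 * m + s)) := by ring
    have e2 : (4 * D * roundCost J + 2) * n = 4 * D * roundCost J * n + 2 * n := by ring
    rw [e1, e2]
    omega
  · obtain ⟨hm, hcard⟩ := good_ends hs (hgood ω)
    obtain ⟨place, hp, hcell⟩ := exists_isPlacement hm hcard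
    have hd' : ∀ i, (Option.map (fun l => (l, x i ω))
        (cellOf (h₁ i ω) (h₂ i ω) (y i ω) (toFin? s (missRank (fun i => y i ω) i)))) =
        some (place i, x i ω) := fun i => by rw [hcell]; rfl
    refine ⟨place, hp, fun i => ?_, fun l hl => ?_⟩
    · rw [hmem]
      rcases h : f ω (place i) with _ | b
      · exact absurd (hd' i) ((hf ω).ne_of_eq_none _ h i (x i ω))
      · obtain ⟨j, hj⟩ := (hf ω).exists_of_eq_some _ _ h
        have h1 := (hd' j).symm.trans hj
        simp only [Option.some.injEq, Prod.mk.injEq] at h1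
        obtain ⟨h1, rfl⟩ := h1
        rw [hp.injective h1]
        rfl
    · rw [hmem]
      rcases h : f ω l with _ | b
      · rfl
      · obtain ⟨j, hj⟩ := (hf ω).exists_of_eq_some _ _ h
        have h1 := (hd' j).symm.trans hj
        simp only [Option.some.injEq, Prod.mk.injEq] at h1
        exact absurd ⟨j, h1.1⟩ hl

end

end Cuckoo

/-! ### Programs -/

namespace Program

open Circuit

/-- An instruction: read a cell, or write a cell according to a table for the private memory. -/
abbrev Instr : Type := ℕ × Option (List ℕ)

/-- Executing an instruction with `L` private words, on memories of words below `B`. -/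
def exec (L B : ℕ) (st : List ℕ × (ℕ → ℕ)) (i : Instr) : List ℕ × (ℕ → ℕ) :=
  i.2.elim ((st.2 i.1 :: st.1).take L, st.2)
    fun T => (st.1, Function.update st.2 i.1 (T.getD (Encodable.encode st.1) 0 % B))

/-- Executing a program. -/
def execAll (L B : ℕ) (P : List Instr) (mem : ℕ → ℕ) : List ℕ × (ℕ → ℕ) :=
  P.foldl (exec L B) ([], mem)

theorem execAll_append {L B : ℕ} (P P' : List Instr) (mem : ℕ → ℕ) :
    execAll L B (P ++ P') mem = P'.foldl (exec L B) (execAll L B P mem) :=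
  List.foldl_append ..

section

variable {Ω : Type} {L B : ℕ}

theorem foldl_exec_reads (as : List ℕ) (st : List ℕ × (ℕ → ℕ)) (h : st.1.length ≤ L) :
    (as.map fun a => ((a, none) : Instr)).foldl (exec L B) st =
      (((as.map st.2).reverse ++ st.1).take L, st.2) := by
  induction as generalizing st with
  | nil => simp [List.take_of_length_le h]
  | cons a as ih =>
    rw [List.map_cons, List.foldl_cons, ih _ (by simp [exec])]
    simp only [exec, Option.elim_none, List.map_cons, List.reverse_cons, List.append_assoc,
      List.cons_append, List.nil_append, Prod.mk.injEq, and_true]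
    rw [List.take_append, List.take_append, List.take_take, Nat.min_eq_left (Nat.sub_le _ _)]

theorem length_execAll_le (P : List Instr) (mem : ℕ → ℕ) : (execAll L B P mem).1.length ≤ L := by
  induction P using List.reverseRecOn with
  | nil => simp [execAll]
  | append_singleton P i ih =>
    rw [execAll_append, List.foldl_cons, List.foldl_nil]
    rcases h : i.2 with _ | T
    · simp [exec, h]
    · simpa [exec, h] using ih

theorem execAll_lt (P : List Instr) {mem : ℕ → ℕ} (hB : 0 < B) (h : ∀ a, mem a < B) (a : ℕ) :
    (execAll L B P mem).2 a < B := by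
  induction P using List.reverseRecOn generalizing a with
  | nil => exact h a
  | append_singleton P i ih =>
    rw [execAll_append, List.foldl_cons, List.foldl_nil]
    rcases h : i.2 with _ | T
    · simpa [exec, h] using ih a
    · simp only [exec, h, Option.elim_some, Function.update_apply]
      split_ifs
      exacts [Nat.mod_lt _ hB, ih a]

/-- Every function can be tabulated on finitely many arguments. -/
theorem exists_table [Finite Ω] (p : Ω → List ℕ) {v : Ω → ℕ}
    (h : ∀ ω ω', p ω = p ω' → v ω = v ω') :
    ∃ T : List ℕ, ∀ ω, T.getD (Encodable.encode (p ω)) 0 = v ω := by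
  classical
  have := Fintype.ofFinite Ω
  refine ⟨(List.range (Finset.univ.sup (fun ω => Encodable.encode (p ω)) + 1)).map fun k =>
    if h : ∃ ω, Encodable.encode (p ω) = k then v h.choose else 0, fun ω => ?_⟩
  have h1 : Encodable.encode (p ω) < Finset.univ.sup (fun ω => Encodable.encode (p ω)) + 1 :=
    Nat.lt_succ_of_le (Finset.le_sup (f := fun ω => Encodable.encode (p ω)) (Finset.mem_univ ω))
  have h2 : ∃ ω', Encodable.encode (p ω') = Encodable.encode (p ω) := ⟨ω, rfl⟩
  rw [List.getD_eq_getElem _ _ (by simpa using h1)]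
  simp only [List.getElem_map, List.getElem_range, dif_pos h2]
  exact h _ _ (Encodable.encode_injective h2.choose_spec)

/-- The table of a write instruction is indexed by codes of private memories, and a finite Ω
produces only finitely many of them. -/
theorem exists_write [Finite Ω] (M : Ω → ℕ → ℕ) (P : List Instr) (a : ℕ) {v : Ω → ℕ}
    (hv : ∀ ω, v ω < B)
    (h : ∀ ω ω', (execAll L B P (M ω)).1 = (execAll L B P (M ω')).1 → v ω = v ω') :
    ∃ T, ∀ ω, execAll L B (P ++ [(a, some T)]) (M ω) =
      ((execAll L B P (M ω)).1, Function.update (execAll L B P (M ω)).2 a (v ω)) := by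
  obtain ⟨T, hT⟩ := exists_table (fun ω => (execAll L B P (M ω)).1) h
  refine ⟨T, fun ω => ?_⟩
  rw [execAll_append, List.foldl_cons, List.foldl_nil]
  simp only [exec, Option.elim_some, hT, Nat.mod_eq_of_lt (hv ω)]

/-- Writing leaves the private memory unchanged, so all outputs of a gate are computed from the same
private words. -/
theorem exists_writes [Finite Ω] (M : Ω → ℕ → ℕ) (vs : List (Ω → ℕ)) (hv : ∀ v ∈ vs, ∀ ω, v ω < B)
    (P : List Instr) (p : ℕ)
    (h : ∀ v ∈ vs, ∀ ω ω', (execAll L B P (M ω)).1 = (execAll L B P (M ω')).1 → v ω = v ω') :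
    ∃ P' : List Instr, P'.length = P.length + vs.length ∧
      (∀ i ∈ P', i ∈ P ∨ i.1 < p + vs.length) ∧
      (∀ ω, ∀ a < p, (execAll L B P' (M ω)).2 a = (execAll L B P (M ω)).2 a) ∧
      ∀ v ∈ vs, ∃ a, p ≤ a ∧ a < p + vs.length ∧ ∀ ω, (execAll L B P' (M ω)).2 a = v ω := by
  induction vs generalizing P p with
  | nil => exact ⟨P, rfl, fun i hi => Or.inl hi, fun _ _ _ => rfl, by simp⟩
  | cons v vs ih =>
    obtain ⟨T, hT⟩ := exists_write M P p (hv v (by simp)) (h v (by simp))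
    obtain ⟨P', h1, h2, h3, h4⟩ := ih (fun v hv' => hv v (by simp [hv'])) (P ++ [(p, some T)])
      (p + 1) (fun v hv' ω ω' heq => h v (by simp [hv']) ω ω' (by simpa only [hT] using heq))
    refine ⟨P', ?_, fun i hi => ?_, fun ω a ha => ?_, fun u hu => ?_⟩
    · rw [h1, List.length_append, List.length_singleton, List.length_cons]
      omega
    · rw [List.length_cons]
      rcases h2 i hi with h | h
      · rcases List.mem_append.1 h with h | h
        · exact Or.inl h
        · rw [List.mem_singleton.1 h]
          right
          simp only
          omega
      · right
        omega
    · rw [h3 ω a (by omega), hT]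
      simp only [Function.update_apply, if_neg ha.ne]
    · rw [List.length_cons]
      rcases List.mem_cons.1 hu with rfl | hu
      · refine ⟨p, le_rfl, by omega, fun ω => ?_⟩
        rw [h3 ω p (by omega), hT]
        simp
      · obtain ⟨a, ha, ha', h5⟩ := h4 u hu
        exact ⟨a, by omega, by omega, h5⟩

/-- Circuits can be evaluated by programs: wires are kept in the cells between `lo` and `p`. -/
theorem exists_of_derives [Finite Ω] (M : Ω → ℕ → ℕ) {S S' : Set (Ω → ℕ)} {c : ℕ}
    (h : Derives L B S c S') {lo p : ℕ} (hlo : lo ≤ p) {P : List Instr}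
    (hS : ∀ u ∈ S, ∃ a, lo ≤ a ∧ a < p ∧ ∀ ω, (execAll L B P (M ω)).2 a = u ω) :
    ∃ P' : List Instr, P'.length ≤ P.length + c ∧ (∀ i ∈ P', i ∈ P ∨ i.1 < p + c) ∧
      ∀ u ∈ S', ∃ a, lo ≤ a ∧ a < p + c ∧ ∀ ω, (execAll L B P' (M ω)).2 a = u ω := by
  induction h with
  | refl => exact ⟨P, le_rfl, fun i hi => Or.inl hi, hS⟩
  | @gate c S' _ fs hfs hL gs hgs ih =>
    obtain ⟨P₁, h1, h2, h3⟩ := ih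
    choose! ad had1 had2 had3 using h3
    have hreads : ∀ ω, execAll L B (P₁ ++ (fs.map ad).map fun a => (a, none)) (M ω) =
        (((fs.map (· ω)).reverse ++ (execAll L B P₁ (M ω)).1).take L,
          (execAll L B P₁ (M ω)).2) := by
      intro ω
      rw [execAll_append, foldl_exec_reads _ _ (length_execAll_le _ _), List.map_map]
      congr 4
      rw [List.map_inj_left]
      intro f hf
      exact had3 f (hfs f hf) ω
    obtain ⟨P₂, h4, h5, h6, h7⟩ := exists_writes M (gs.map fun g ω => g (fs.map (· ω)))
      (by
        intro v hv ω
        obtain ⟨g, hg, rfl⟩ := List.mem_map.1 hv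
        exact hgs g hg _) (P₁ ++ (fs.map ad).map fun a => (a, none)) (p + c) (by
        intro v hv ω ω' heq
        obtain ⟨g, hg, rfl⟩ := List.mem_map.1 hv
        rw [hreads, hreads] at heq
        simp only at heq
        -- At most L words have just been read, so they all stand at the front of the private
        -- memory, before any leftovers, and determine the gate.
        have := congrArg (List.take fs.length) heq
        rw [List.take_take, List.take_take, Nat.min_eq_left hL,
          List.take_append_of_le_length (by simp), List.take_append_of_le_length (by simp),
          List.take_of_length_le (by simp), List.take_of_length_le (by simp),
          List.reverse_inj] at this
        simp only [this])
    rw [List.length_map] at h4 h5 h7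
    refine ⟨P₂, ?_, fun i hi => ?_, ?_⟩
    · rw [h4, List.length_append, List.length_map, List.length_map]
      omega
    · rcases h5 i hi with h | h
      · rcases List.mem_append.1 h with h | h
        · rcases h2 i h with h | h
          · exact Or.inl h
          · right; omega
        · obtain ⟨a, ha, rfl⟩ := List.mem_map.1 h
          obtain ⟨f, hf, rfl⟩ := List.mem_map.1 ha
          have := had2 f (hfs f hf)
          right
          simp only
          omega
      · right; omega
    · rintro u (hu | ⟨g, hg, rfl⟩)
      · refine ⟨ad u, had1 u hu, (had2 u hu).trans_le (by omega), fun ω => ?_⟩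
        rw [h6 ω _ (had2 u hu), hreads]
        exact had3 u hu ω
      · obtain ⟨a, ha, ha', h8⟩ := h7 _ (List.mem_map_of_mem hg)
        exact ⟨a, by omega, by omega, h8⟩

/-- Moving words to other cells. -/
theorem exists_moves [Finite Ω] (M : Ω → ℕ → ℕ) (hL : 0 < L) (hM : ∀ ω a, M ω a < B)
    (mv : List (ℕ × ℕ)) (hmv : ∀ x ∈ mv, ∀ y ∈ mv, x.1 ≠ y.2) (hnd : (mv.map Prod.snd).Nodup)
    (P : List Instr) :
    ∃ P' : List Instr, P'.length = P.length + 2 * mv.length ∧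
      (∀ i ∈ P', i ∈ P ∨ ∃ x ∈ mv, i.1 = x.1 ∨ i.1 = x.2) ∧
      (∀ ω, ∀ a, (∀ x ∈ mv, a ≠ x.2) →
        (execAll L B P' (M ω)).2 a = (execAll L B P (M ω)).2 a) ∧
      ∀ x ∈ mv, ∀ ω, (execAll L B P' (M ω)).2 x.2 = (execAll L B P (M ω)).2 x.1 := by
  induction mv generalizing P with
  | nil => exact ⟨P, rfl, fun i hi => Or.inl hi, fun _ _ _ => rfl, by simp⟩
  | cons x mv ih =>
    have hr : ∀ ω, execAll L B (P ++ [(x.1, none)]) (M ω) =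
        (((execAll L B P (M ω)).2 x.1 :: (execAll L B P (M ω)).1).take L,
          (execAll L B P (M ω)).2) := by
      intro ω
      rw [execAll_append]
      rfl
    obtain ⟨T, hT⟩ := exists_write (L := L) (B := B) M (P ++ [(x.1, none)]) x.2
      (v := fun ω => (execAll L B P (M ω)).2 x.1)
      (fun ω => execAll_lt _ ((Nat.zero_le _).trans_lt (hM ω 0)) (hM ω) _) (by
        intro ω ω' heq
        rw [hr, hr] at heq
        obtain ⟨l, rfl⟩ : ∃ l, L = l + 1 := ⟨L - 1, by omega⟩
        simp only [List.take_succ_cons, List.cons.injEq] at heq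
        exact heq.1)
    rw [List.map_cons, List.nodup_cons] at hnd
    obtain ⟨P', h1, h2, h3, h4⟩ := ih (fun x hx y hy => hmv x (by simp [hx]) y (by simp [hy]))
      hnd.2 (P ++ [(x.1, none)] ++ [(x.2, some T)])
    refine ⟨P', ?_, fun i hi => ?_, fun ω a ha => ?_, fun y hy ω => ?_⟩
    · simp only [h1, List.length_append, List.length_cons, List.length_nil]
      omega
    · rcases h2 i hi with h | ⟨y, hy, h⟩
      · simp only [List.append_assoc, List.mem_append, List.mem_singleton] at h
        rcases h with h | rfl | rfl
        · exact Or.inl h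
        · exact Or.inr ⟨x, by simp, Or.inl rfl⟩
        · exact Or.inr ⟨x, by simp, Or.inr rfl⟩
      · exact Or.inr ⟨y, by simp [hy], h⟩
    · rw [h3 ω a fun x hx => ha x (by simp [hx]), hT, hr]
      simp only [Function.update_apply, if_neg (ha x (by simp))]
    · rcases List.mem_cons.1 hy with rfl | hy
      · rw [h3 ω y.2 (fun z hz heq => hnd.1 (heq ▸ List.mem_map_of_mem hz)), hT]
        simp
      · rw [h4 y hy, hT, hr]
        simp only [Function.update_apply, if_neg (hmv y (by simp [hy]) x (by simp))]

end

end Program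

/-! ### Programs for cuckoo tables -/

namespace Cuckoo

open Circuit Orientation Program

theorem Loc.addr_lt {m s : ℕ} (l : Loc m s) : l.addr < 2 * m + s := by
  rcases l with j | j | j <;> simp only [Loc.addr] <;> omega

theorem Loc.addr_injective {m s : ℕ} : Function.Injective (Loc.addr (m := m) (s := s)) := by
  rintro (i | i | i) (j | j | j) h <;> simp only [Loc.addr] at h <;>
    first
      | (exfalso; omega)
      | (congr; ext; omega)

theorem Loc.exists_addr_eq {m s a : ℕ} (h : a < 2 * m + s) : ∃ l : Loc m s, l.addr = a := by
  rcases lt_or_ge a m with h1 | h1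
  · exact ⟨Sum.inl ⟨a, h1⟩, rfl⟩
  rcases lt_or_ge a (2 * m) with h2 | h2
  · exact ⟨Sum.inr (Sum.inl ⟨a - m, by omega⟩), by simp only [Loc.addr]; omega⟩
  · exact ⟨Sum.inr (Sum.inr ⟨a - 2 * m, by omega⟩), by simp only [Loc.addr]; omega⟩

theorem inputMemory_lt {n m B : ℕ} {x : Fin n → ℕ} {h₁ h₂ : Fin n → Fin m} (hB : 0 < B)
    (hm : m ≤ B) (hx : ∀ i, x i < B) (a : ℕ) : inputMemory x h₁ h₂ a < B := by
  rw [inputMemory]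
  split_ifs
  exacts [hx _, (Fin.is_lt _).trans_le hm, (Fin.is_lt _).trans_le hm, hB]

/-- A program that places the items in the cells of a cuckoo table. -/
theorem exists_program {L B q J n m s M D T : ℕ} {Θ : Type} [Fintype Θ] [Nonempty Θ]
    {col : Θ → Option (Fin m ⊕ Fin m) → Bool} (hcol : ∀ x y, x ≠ y → Fintype.card Θ ≤
      D * (Finset.univ.filter fun θ => col θ x = false ∧ col θ y = true).card)
    (hq : 0 < q) (hL : 2 * (q * q) ≤ L) (hΘL : 2 * Fintype.card Θ ≤ L) (hΘB : Fintype.card Θ ≤ B)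
    (hn : 4 * n + 2 * m + s ≤ q ^ J * (2 * (q * q)))
    (hB : (4 * n + 2 * m + s + 4) ^ 5 * (M + 1) ≤ B)
    (hTL : T ≤ L) (hTs : 2 * s ≤ T) (hTD : 2 * D ≤ T) (hTΘ : Fintype.card Θ ≤ T) (hD : 0 < D)
    (hn1 : 1 ≤ n) :
    ∃ P : List Instr, P.length ≤ 6 * n + (tableCost D J + 2) * (n + (2 * m + s)) ∧
      (∀ i ∈ P, i.1 < 6 * n + (tableCost D J + 2) * (n + (2 * m + s))) ∧
      ∀ (x : Fin n → ℕ) (h₁ h₂ : Fin n → Fin m), (∀ i, x i < M) → StashSuffices h₁ h₂ s →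
        HoldsTable x h₁ h₂ s (execAll L B P (inputMemory x h₁ h₂)).2 := by
  classical
  -- For fixed parameters there are finitely many inputs, as the tables in the write instructions
  -- require.
  let Ω := (Fin n → Fin M) × (Fin n → Fin m) × (Fin n → Fin m)
  let mem : Ω → ℕ → ℕ := fun ω => inputMemory (fun i => (ω.1 i : ℕ)) ω.2.1 ω.2.2
  have hMB : (4 * n + 2 * m + s + 4) + M ≤ B := by
    refine le_trans ?_ hB
    have h1 : 4 * n + 2 * m + s + 4 ≤ (4 * n + 2 * m + s + 4) ^ 5 :=
      Nat.le_self_pow (by norm_num) _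
    nlinarith
  have hmem : ∀ ω a, mem ω a < B := fun ω a =>
    inputMemory_lt (by omega) (by omega) (fun i => (ω.1 i).2.trans_le (by omega)) a
  have hL1 : 0 < L := by have := Nat.mul_pos hq hq; omega
  let S : Set (Ω → ℕ) := {u | ∃ j < 3 * n, u = fun ω => mem ω j}
  have hS : S.Nonempty := ⟨_, 0, by omega, rfl⟩
  have hx : ∀ i : Fin n, Avail S fun ω : Ω => ω.1 i := fun i =>
    ⟨_, ⟨3 * i, by omega, rfl⟩, fun ω ω' h => by
      have h1 : 3 * (i : ℕ) / 3 = i := by omega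
      have h2 : 3 * (i : ℕ) % 3 = 0 := by omega
      simp only [mem, inputMemory, h1, h2, i.2, dif_pos, if_true] at h
      exact Fin.ext h⟩
  have hh₁ : ∀ i : Fin n, Avail S fun ω : Ω => ω.2.1 i := fun i =>
    ⟨_, ⟨3 * i + 1, by omega, rfl⟩, fun ω ω' h => by
      have h1 : (3 * (i : ℕ) + 1) / 3 = i := by omega
      have h2 : (3 * (i : ℕ) + 1) % 3 = 1 := by omega
      simp only [mem, inputMemory, h1, h2, i.2, dif_pos, one_ne_zero, if_true, if_false] at h
      exact Fin.ext h⟩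
  have hh₂ : ∀ i : Fin n, Avail S fun ω : Ω => ω.2.2 i := fun i =>
    ⟨_, ⟨3 * i + 2, by omega, rfl⟩, fun ω ω' h => by
      have h1 : (3 * (i : ℕ) + 2) / 3 = i := by omega
      have h2 : (3 * (i : ℕ) + 2) % 3 = 2 := by omega
      simp only [mem, inputMemory, h1, h2, i.2, dif_pos, two_ne_zero, OfNat.ofNat_ne_one,
        if_false] at h
      exact Fin.ext h⟩
  obtain ⟨S', ⟨c, hc, hder⟩, out, hout, hspec⟩ :=
    exists_step_table (J := J) hcol hq hL hΘL hΘB hn hB hTL hTs hTD hTΘ hD hS hx hh₁ hh₂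
  -- The input occupies the first 3 n cells and the table has to occupy the first 2 m + s, so the
  -- two overlap. The input is therefore copied to the cells from lo on, all wires are kept there,
  -- and the outputs are moved down at the end.
  set lo := 3 * n + 2 * m + s with hlo
  obtain ⟨P₁, l₁, a₁, -, v₁⟩ := exists_moves (B := B) mem hL1 hmem
    ((List.range (3 * n)).map fun j => (j, lo + j))
    (by
      simp only [List.mem_map, List.mem_range]
      rintro - ⟨j, hj, rfl⟩ - ⟨j', hj', rfl⟩
      simp only
      omega)
    (by
      rw [List.map_map]
      refine List.Nodup.map (fun a b h => ?_) List.nodup_range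
      simpa using h) []
  obtain ⟨P₂, l₂, a₂, v₂⟩ := exists_of_derives mem hder (lo := lo) (p := lo + 3 * n) (by omega)
    (P := P₁) (by
      rintro u ⟨j, hj, rfl⟩
      refine ⟨lo + j, by omega, by omega, fun ω => ?_⟩
      exact v₁ (j, lo + j) (List.mem_map.2 ⟨j, List.mem_range.2 hj, rfl⟩) ω)
  choose ad ad1 ad2 ad3 using fun l => v₂ (out l) (hout l)
  obtain ⟨P₃, l₃, a₃, -, v₃⟩ := exists_moves (B := B) mem hL1 hmem
    ((Finset.univ : Finset (Loc m s)).toList.map fun l => (ad l, l.addr))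
    (by
      simp only [List.mem_map, Finset.mem_toList]
      rintro - ⟨j, hj, rfl⟩ - ⟨j', hj', rfl⟩
      have := ad1 j
      have := j'.addr_lt
      simp only
      omega)
    (by
      rw [List.map_map]
      exact List.Nodup.map Loc.addr_injective (Finset.nodup_toList _)) P₂
  have hlen : c + 2 * (m + (m + s)) ≤ (tableCost D J + 2) * (n + (2 * m + s)) := by
    rw [add_mul]
    omega
  have hlo' : lo + 3 * n + c ≤ 6 * n + (tableCost D J + 2) * (n + (2 * m + s)) := by
    omega
  refine ⟨P₃, ?_, fun i hi => ?_, fun x h₁ h₂ hxM hs => ?_⟩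
  · simp only [List.length_map, Finset.length_toList, Finset.card_univ, Fintype.card_sum,
      Fintype.card_fin, List.length_range, List.length_nil] at l₁ l₃
    omega
  · rcases a₃ i hi with h | ⟨p, hp, h⟩
    · rcases a₂ i h with h | h
      · rcases a₁ i h with h | ⟨p, hp, h⟩
        · simp at h
        · obtain ⟨j, hj, rfl⟩ := List.mem_map.1 hp
          rw [List.mem_range] at hj
          simp only at h
          omega
      · omega
    · obtain ⟨l, -, rfl⟩ := List.mem_map.1 hp
      have := ad2 l
      have := l.addr_lt
      simp only at h
      omega
  · refine hspec (fun i => ⟨x i, hxM i⟩, h₁, h₂) hs _ fun l => ?_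
    exact (v₃ (ad l, l.addr) (List.mem_map.2 ⟨l, by simp, rfl⟩)
      (fun i => ⟨x i, hxM i⟩, h₁, h₂)).trans (ad3 l _)

theorem le_pow_self_of_two_le {a q : ℕ} (hq : 2 ≤ q) : a ≤ q ^ a :=
  (Nat.lt_two_pow_self.le).trans (Nat.pow_le_pow_left hq a)

theorem le_of_two_pow_le {n s w A : ℕ} (hw : 1 ≤ w) (hnw : n ≤ 2 ^ w) (hs : 2 ^ s ≤ (3 * n) ^ A) :
    s ≤ 3 * A * w := by
  refine (Nat.pow_le_pow_iff_right (show 1 < 2 by norm_num)).1 (hs.trans ?_)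
  rw [show 3 * A * w = (3 * w) * A by ring, pow_mul]
  refine Nat.pow_le_pow_left ?_ A
  calc 3 * n ≤ 2 ^ (2 * w) * 2 ^ w := by
        refine Nat.mul_le_mul ?_ hnw
        calc 3 ≤ 2 ^ (2 * 1) := by norm_num
          _ ≤ 2 ^ (2 * w) := Nat.pow_le_pow_right (by norm_num) (by omega)
    _ = 2 ^ (3 * w) := by rw [← pow_add]; congr 1; ring

theorem mul_two_pow_le {w : ℕ} (hw : 1 ≤ w) (a : ℕ) : a * 2 ^ w ≤ 2 ^ ((a + 1) * w) := by
  rw [add_mul, one_mul, pow_add, pow_mul]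
  exact Nat.mul_le_mul_right _ (Nat.lt_two_pow_self.le.trans (Nat.le_self_pow (by omega) _))

set_option maxHeartbeats 400000 in
/-- Programs for cuckoo tables with a small private memory. -/
theorem exists_small_program (k K A : ℕ) (hk : 1 ≤ k) :
    ∃ c, ∀ C ≥ c, ∀ n m s w : ℕ, 1 ≤ n → 1 ≤ w → n ≤ 2 ^ w → m ≤ K * n → 2 ^ s ≤ (3 * n) ^ A →
      ∃ (Q : ℕ) (P : List Instr), Q ^ k ≤ n ∧ P.length ≤ c * (n + s) ∧
        (∀ i ∈ P, i.1 < c * (n + s)) ∧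
        ∀ (x : Fin n → ℕ) (h₁ h₂ : Fin n → Fin m), (∀ i, x i < 2 ^ w) → StashSuffices h₁ h₂ s →
          HoldsTable x h₁ h₂ s
            (execAll (c * Q) (2 ^ (C * w)) P (inputMemory x h₁ h₂)).2 := by
  -- The number k' of blocks is chosen so that the 2 m + 1 elements of `Option (Fin m ⊕ Fin m)` can
  -- be written with k' digits in base q, using n ≤ q ^ (2 k) and 2 K + 1 ≤ q ^ (2 K + 1). The depth
  -- J of the sorting gives q ^ J room for all items and cells. The three conditions on c are for
  -- the number of accesses, the private space and the word length.
  obtain ⟨k', hk'⟩ : ∃ k', k' = 2 * k + (2 * K + 1) := ⟨_, rfl⟩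
  obtain ⟨J, hJ⟩ : ∃ J, J = 2 * k + (4 + 2 * K) + (A * (2 + 2 * k) + 1) := ⟨_, rfl⟩
  obtain ⟨t, ht⟩ : ∃ t, t = tableCost (4 * k') J + 2 := ⟨_, rfl⟩
  obtain ⟨b, hb⟩ : ∃ b, b = 8 + 2 * K + 3 * A := ⟨_, rfl⟩
  obtain ⟨c, hc₁, hc₂, hc₃⟩ : ∃ c, 6 + t * (2 * K + 1) ≤ c ∧
      8 + 20 * k' + 4 * (A * (1 + 2 * k)) + 4 * A ≤ c ∧ 5 * (b + 1) + 2 + (4 * k' + 1) ≤ c :=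
    ⟨6 + t * (2 * K + 1) + (8 + 20 * k' + 4 * (A * (1 + 2 * k)) + 4 * A) +
      (5 * (b + 1) + 2 + (4 * k' + 1)), by omega, by omega, by omega⟩
  refine ⟨c, fun C hC n m s w hn hw hnw hm hs => ?_⟩
  -- Rounding γ down gives Q ^ k ≤ n for Q = 2 ^ (2 γ), while the exponent γ + 1 in q gives n ≤ q ^
  -- (2 k). Both bounds are compatible because q² = 4 Q.
  obtain ⟨γ, hγ⟩ : ∃ γ, γ = Nat.log 2 n / (2 * k) := ⟨_, rfl⟩
  obtain ⟨q, hq⟩ : ∃ q, q = 2 ^ (γ + 1) := ⟨_, rfl⟩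
  obtain ⟨Q, hQ⟩ : ∃ Q, Q = (2 ^ γ) ^ 2 := ⟨_, rfl⟩
  have hq2 : 2 ≤ q := by
    rw [hq, pow_succ]
    exact Nat.le_mul_of_pos_left _ (Nat.pow_pos (by norm_num))
  have hqQ : q * q = 4 * Q := by
    rw [hq, hQ]
    ring
  have hq2Q : q ≤ 2 * Q := by
    have : 2 * q ≤ q * q := Nat.mul_le_mul_right _ hq2
    omega
  have hQn : Q ^ k ≤ n := by
    rw [hQ, ← pow_mul, ← pow_mul, hγ]
    calc 2 ^ (Nat.log 2 n / (2 * k) * (2 * k)) ≤ 2 ^ Nat.log 2 n :=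
          Nat.pow_le_pow_right (by norm_num) (Nat.div_mul_le_self _ _)
      _ ≤ n := Nat.pow_log_le_self 2 (by omega)
  have hQn' : Q ≤ n := (Nat.le_self_pow (by omega) Q).trans hQn
  have hlog : Nat.log 2 n + 1 ≤ (γ + 1) * (2 * k) := by
    have := Nat.lt_mul_div_succ (Nat.log 2 n) (show 0 < 2 * k by omega)
    rw [mul_comm, hγ]
    exact this
  have hnq : n ≤ q ^ (2 * k) := by
    rw [hq, ← pow_mul]
    exact (Nat.lt_pow_succ_log_self (by norm_num) n).le.trans
      (Nat.pow_le_pow_right (by norm_num) hlog)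
  -- The stash is logarithmic, hence linear in γ + 1 ≤ q; so 2 s edges fit into one gate, which is
  -- what `exists_program` needs to end the rounds.
  have hsβ : s ≤ A * (2 + (γ + 1) * (2 * k)) := by
    refine (Nat.pow_le_pow_iff_right (show 1 < 2 by norm_num)).1 (hs.trans ?_)
    rw [mul_comm A, pow_mul]
    refine Nat.pow_le_pow_left ?_ A
    rw [pow_add, pow_mul, ← hq]
    exact Nat.mul_le_mul (by norm_num) hnq
  have hγq : γ + 1 ≤ q := hq ▸ Nat.lt_two_pow_self.le
  have hsq : s ≤ A * (2 + 2 * k) * q := by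
    refine hsβ.trans ?_
    rw [mul_assoc]
    refine Nat.mul_le_mul_left _ ?_
    rw [add_mul 2 (2 * k), mul_comm (2 * k) q]
    exact Nat.add_le_add (by omega) (Nat.mul_le_mul_right _ hγq)
  have hsw : s ≤ 3 * A * w := le_of_two_pow_le hw hnw hs
  obtain ⟨col, hcol⟩ := exists_colorings (W := Option (Fin m ⊕ Fin m)) (k := k') (β := γ + 1) (by
    simp only [Nat.card_eq_fintype_card, Fintype.card_option, Fintype.card_sum, Fintype.card_fin]
    rw [pow_mul, ← hq, hk', pow_add]
    calc m + m + 1 ≤ n * (2 * K + 1) := by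
          rw [show n * (2 * K + 1) = 2 * (K * n) + n by ring]
          omega
      _ ≤ _ := Nat.mul_le_mul hnq (le_pow_self_of_two_le hq2))
  have hΘ : Fintype.card (Fin k' × (Fin (γ + 1) → ZMod 2) × ZMod 2) = 2 * k' * q := by
    simp only [Fintype.card_prod, Fintype.card_fin, Fintype.card_fun, ZMod.card]
    rw [← hq]
    ring
  have hk'0 : 0 < k' := by omega
  have : Nonempty (Fin k' × (Fin (γ + 1) → ZMod 2) × ZMod 2) := ⟨⟨0, hk'0⟩, 0, 0⟩
  have hkq : 2 * k' * q ≤ 4 * (k' * Q) := by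
    calc 2 * k' * q ≤ 2 * k' * (2 * Q) := Nat.mul_le_mul_left _ hq2Q
      _ = _ := by ring
  have hkQ : k' ≤ k' * Q := Nat.le_mul_of_pos_right _ (by omega)
  have hcQ : 8 * Q + 20 * (k' * Q) + 4 * (A * (1 + 2 * k) * Q) + 4 * (A * Q) ≤ c * Q := by
    refine le_trans (le_of_eq ?_) (Nat.mul_le_mul_right Q hc₂)
    ring
  have hsQ : s ≤ 2 * (A * (1 + 2 * k) * Q) + 2 * (A * Q) := by
    refine hsq.trans ((Nat.mul_le_mul_left _ hq2Q).trans (le_of_eq ?_))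
    ring
  have hsize : 6 * n + t * (n + (2 * m + s)) ≤ c * (n + s) := by
    have e1 : n + (2 * m + s) ≤ (2 * K + 1) * (n + s) := by
      rw [show (2 * K + 1) * (n + s) = 2 * (K * n) + n + (2 * (K * s) + s) by ring]
      omega
    have e2 := Nat.mul_le_mul_left t e1
    have e3 : (6 + t * (2 * K + 1)) * (n + s) ≤ c * (n + s) := Nat.mul_le_mul_right _ hc₁
    have e4 : (6 + t * (2 * K + 1)) * (n + s) = 6 * n + 6 * s +
      t * ((2 * K + 1) * (n + s)) := by ring
    omega
  have hpow : ∀ a, a ≤ c → 2 ^ (a * w) ≤ 2 ^ (C * w) := fun a ha =>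
    Nat.pow_le_pow_right (by norm_num) (Nat.mul_le_mul_right _ (ha.trans hC))
  have hle : ∀ a, a * 2 ^ w ≤ 2 ^ ((a + 1) * w) := mul_two_pow_le hw
  have hL : 2 * (q * q) ≤ c * Q := by omega
  have hΘL : 2 * (2 * k' * q) ≤ c * Q := by omega
  have hΘB : 2 * k' * q ≤ 2 ^ (C * w) := by
    refine le_trans ?_ ((hle (4 * k')).trans (hpow _ (by omega)))
    calc 2 * k' * q ≤ 4 * (k' * Q) := hkq
      _ = 4 * k' * Q := by ring
      _ ≤ 4 * k' * 2 ^ w := Nat.mul_le_mul_left _ (hQn'.trans hnw)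
  have hlarge : 4 * n + 2 * m + s ≤ q ^ J * (2 * (q * q)) := by
    have e1 : (4 + 2 * K) * n ≤ q ^ (2 * k + (4 + 2 * K)) := by
      rw [mul_comm, pow_add]
      exact Nat.mul_le_mul hnq (le_pow_self_of_two_le hq2)
    have e2 : s ≤ q ^ (A * (2 + 2 * k) + 1) := by
      rw [pow_succ]
      exact hsq.trans (Nat.mul_le_mul_right _ (le_pow_self_of_two_le hq2))
    have e3 : q ^ (2 * k + (4 + 2 * K)) ≤ q ^ J := Nat.pow_le_pow_right (by omega) (by omega)
    have e4 : q ^ (A * (2 + 2 * k) + 1) ≤ q ^ J := Nat.pow_le_pow_right (by omega) (by omega)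
    have e5 : q ^ J * 2 ≤ q ^ J * (2 * (q * q)) := Nat.mul_le_mul_left _ (by omega)
    have e6 : (4 + 2 * K) * n = 4 * n + 2 * (K * n) := by ring
    omega
  have hB : (4 * n + 2 * m + s + 4) ^ 5 * (2 ^ w + 1) ≤ 2 ^ (C * w) := by
    have e1 : 4 * n + 2 * m + s + 4 ≤ 2 ^ ((b + 1) * w) := by
      refine le_trans ?_ (hle b)
      have e2 : m ≤ K * 2 ^ w := hm.trans (Nat.mul_le_mul_left _ hnw)
      have e3 : s ≤ 3 * (A * 2 ^ w) := by
        rw [← mul_assoc]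
        exact hsw.trans (Nat.mul_le_mul_left _ Nat.lt_two_pow_self.le)
      have e4 : b * 2 ^ w = 8 * 2 ^ w + 2 * (K * 2 ^ w) + 3 * (A * 2 ^ w) := by rw [hb]; ring
      omega
    have e2 : 2 ^ w + 1 ≤ 2 ^ (2 * w) := by
      rw [two_mul, pow_add]
      have h1 : 2 ≤ 2 ^ w := Nat.le_self_pow (by omega) 2
      have h2 : 2 ^ w * 2 ≤ 2 ^ w * 2 ^ w := Nat.mul_le_mul_left _ h1
      omega
    calc _ ≤ (2 ^ ((b + 1) * w)) ^ 5 * 2 ^ (2 * w) := Nat.mul_le_mul (Nat.pow_le_pow_left e1 5) e2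
      _ = 2 ^ ((5 * (b + 1) + 2) * w) := by rw [← pow_mul, ← pow_add]; congr 1; ring
      _ ≤ _ := hpow _ (by omega)
  obtain ⟨P, h1, h2, h3⟩ := exists_program (L := c * Q) (B := 2 ^ (C * w)) (q := q)
    (J := J) (n := n) (m := m) (s := s) (M := 2 ^ w) (D := 4 * k') (T := c * Q) hcol (by omega) hL
    (hΘ ▸ hΘL) (hΘ ▸ hΘB) hlarge hB le_rfl (by omega) (by omega) (by omega) (by omega) hn
  rw [← ht] at h1 h2
  exact ⟨Q, P, hQn, h1.trans hsize, fun i hi => (h2 i hi).trans_le hsize, h3⟩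

end Cuckoo

/-! ### Searching for a program -/

section

variable {α β : Type*} [Primcodable α] [Primcodable β]

open Primrec

theorem PrimrecPred.imp {p q : α → Prop} (hp : PrimrecPred p) (hq : PrimrecPred q) :
    PrimrecPred fun a => p a → q a :=
  (hp.not.or hq).of_eq fun _ => imp_iff_not_or.symm

theorem PrimrecPred.forall_mem {l : α → List β} {p : α → β → Prop} (hl : Primrec l)
    (hp : PrimrecPred fun x : α × β => p x.1 x.2) : PrimrecPred fun a => ∀ b ∈ l a, p a b :=
  (PrimrecRel.forall_mem_list (R := fun b a => p a b) (hp.comp (Primrec.pair snd fst))).comp hl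
    Primrec.id

theorem PrimrecPred.exists_mem {l : α → List β} {p : α → β → Prop} (hl : Primrec l)
    (hp : PrimrecPred fun x : α × β => p x.1 x.2) : PrimrecPred fun a => ∃ b ∈ l a, p a b :=
  (PrimrecRel.exists_mem_list (R := fun b a => p a b) (hp.comp (Primrec.pair snd fst))).comp hl
    Primrec.id

theorem PrimrecPred.ball_lt {n : α → ℕ} {p : α → ℕ → Prop} (hn : Primrec n)
    (hp : PrimrecPred fun x : α × ℕ => p x.1 x.2) : PrimrecPred fun a => ∀ i < n a, p a i :=
  (PrimrecPred.forall_mem (list_range.comp hn) hp).of_eq fun a => by simp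

theorem PrimrecPred.bex_lt {n : α → ℕ} {p : α → ℕ → Prop} (hn : Primrec n)
    (hp : PrimrecPred fun x : α × ℕ => p x.1 x.2) : PrimrecPred fun a => ∃ i < n a, p a i :=
  (PrimrecPred.exists_mem (list_range.comp hn) hp).of_eq fun a => by simp

theorem Primrec.nat_pow' : Primrec₂ ((· ^ ·) : ℕ → ℕ → ℕ) :=
  Primrec₂.unpaired'.1 Nat.Primrec.pow

/-- Objects with a primitive recursive property can be found by search. -/
theorem exists_computable_choice {R : α → β → Prop} (hR : PrimrecRel R) (h : ∀ a, ∃ b, R a b) :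
    ∃ F : α → β, Computable F ∧ ∀ a, R a (F a) := by
  classical
  have hf : Computable₂ fun (a : α) (k : ℕ) =>
      (Encodable.decode (α := β) k).bind fun b => Option.guard (R a) b := by
    refine Primrec.to_comp ?_
    refine option_bind (Primrec.decode.comp snd) ?_
    exact option_guard (p := fun (x : (α × ℕ) × β) b => R x.1.1 b)
      (hR.comp (fst.comp (fst.comp fst)) snd) snd
  have hdom : ∀ a, (Nat.rfindOpt fun k => (Encodable.decode (α := β) k).bind fun b =>
      Option.guard (R a) b).Dom := by
    intro a
    obtain ⟨b, hb⟩ := h a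
    exact Nat.rfindOpt_dom.2 ⟨Encodable.encode b, b, by simp [hb]⟩
  refine ⟨fun a => (Nat.rfindOpt _).get (hdom a),
    Partrec.of_eq_tot (Partrec.rfindOpt hf) fun a => Part.get_mem _, fun a => ?_⟩
  obtain ⟨k, hk⟩ := Nat.rfindOpt_spec (Part.get_mem (hdom a))
  obtain ⟨b, -, hb⟩ := Option.bind_eq_some_iff.1 hk
  rw [Option.guard_eq_some_iff] at hb
  change R a ((Nat.rfindOpt _).get (hdom a))
  rw [← hb.1]
  simpa using hb.2

/-- All lists of length `n` of numbers below `b`. -/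
def allLists (b : ℕ) : ℕ → List (List ℕ)
  | 0 => [[]]
  | n + 1 => (allLists b n).flatMap fun l => (List.range b).map fun a => a :: l

theorem mem_allLists {b n : ℕ} {l : List ℕ} :
    l ∈ allLists b n ↔ l.length = n ∧ ∀ a ∈ l, a < b := by
  induction n generalizing l with
  | zero =>
    simp only [allLists, List.mem_singleton, List.length_eq_zero_iff]
    exact ⟨fun h => ⟨h, by simp [h]⟩, fun h => h.1⟩
  | succ n ih =>
    simp only [allLists, List.mem_flatMap, List.mem_map, List.mem_range, ih]
    constructor
    · rintro ⟨l', ⟨h1, h2⟩, a, ha, rfl⟩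
      exact ⟨by simp [h1], by simpa [ha] using h2⟩
    · rintro ⟨h1, h2⟩
      cases l with
      | nil => simp at h1
      | cons a l => exact ⟨l, ⟨by simpa using h1, fun x hx => h2 x (by simp [hx])⟩, a,
          h2 a (by simp), rfl⟩

theorem primrec_allLists : Primrec₂ allLists := by
  refine (Primrec.nat_rec (f := fun _ : ℕ => [[]]) (g := fun b p =>
    (p.2 : List (List ℕ)).flatMap fun l => (List.range b).map fun a => a :: l) (Primrec.const _)
    ?_).of_eq fun b n => ?_
  · refine list_flatMap (snd.comp snd) ?_
    refine list_map (list_range.comp (fst.comp fst)) ?_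
    exact list_cons.comp snd (snd.comp fst)
  · induction n with
    | zero => rfl
    | succ n ih => simp only [allLists, ← ih]

end

/-! ### Primitive recursive simulation of programs -/

namespace Program

open Primrec

/-- Executing an instruction on a memory that is given by a list. -/
def execList (L B : ℕ) (st : List ℕ × List ℕ) (i : Instr) : List ℕ × List ℕ :=
  i.2.elim ((st.2.getD i.1 0 :: st.1).take L, st.2)
    fun T => (st.1, st.2.set i.1 (T.getD (Encodable.encode st.1) 0 % B))

/-- The final memory of a program, on the first `N` cells. -/
def finalList (L B N : ℕ) (P : List Instr) (inp : List ℕ) : List ℕ :=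
  (P.foldl (execList L B) ([], (List.range N).map fun a => inp.getD a 0)).2

/-- All addresses are below N, so the list never has to grow, and the cells outside it stay `0`. -/
theorem getD_finalList {L B N : ℕ} {P : List Instr} (hP : ∀ i ∈ P, i.1 < N) {inp : List ℕ}
    (hN : inp.length ≤ N) {mem : ℕ → ℕ} (hmem : ∀ a, mem a = inp.getD a 0) (a : ℕ) :
    (finalList L B N P inp).getD a 0 = (execAll L B P mem).2 a := by
  suffices h : (P.foldl (execList L B) ([], (List.range N).map fun a => inp.getD a 0)).1 =
      (execAll L B P mem).1 ∧
      (P.foldl (execList L B) ([], (List.range N).map fun a => inp.getD a 0)).2.length = N ∧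
      ∀ a, (P.foldl (execList L B) ([], (List.range N).map fun a => inp.getD a 0)).2.getD a 0 =
        (execAll L B P mem).2 a from h.2.2 a
  clear a
  induction P using List.reverseRecOn with
  | nil =>
    refine ⟨rfl, by simp, fun a => ?_⟩
    simp only [List.foldl_nil, execAll, hmem]
    rcases lt_or_ge a N with h | h
    · rw [List.getD_eq_getElem _ _ (by simpa using h)]
      simp
    · rw [List.getD_eq_default _ _ (by simpa using h), List.getD_eq_default _ _ (hN.trans h)]
  | append_singleton P i ih =>
    obtain ⟨h1, h2, h3⟩ := ih fun i hi => hP i (by simp [hi])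
    have hi := hP i (by simp)
    rw [execAll_append, List.foldl_append]
    simp only [List.foldl_cons, List.foldl_nil]
    rcases h : i.2 with _ | T
    · simp only [execList, exec, h, Option.elim_none, h1, h2, h3]
      simp
    · simp only [execList, exec, h, Option.elim_some, h1, List.length_set, h2, true_and]
      intro a
      rw [Function.update_apply]
      split_ifs with ha
      · subst ha
        rw [List.getD_eq_getElem _ _ (by rw [List.length_set]; omega), List.getElem_set_self]
      · rw [← h3]
        simp only [List.getD_eq_getElem?_getD, List.getElem?_set_ne (Ne.symm ha)]

theorem primrec_finalList {α : Type*} [Primcodable α] {L B N : α → ℕ} {P : α → List Instr}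
    {inp : α → List ℕ} (hL : Primrec L) (hB : Primrec B) (hN : Primrec N) (hP : Primrec P)
    (hi : Primrec inp) : Primrec fun a => finalList (L a) (B a) (N a) (P a) (inp a) := by
  refine snd.comp (list_foldl (h := fun a p => execList (L a) (B a) p.1 p.2) hP (Primrec.pair (Primrec.const []) ?_) ?_)
  · exact list_map (list_range.comp hN) ((list_getD 0).comp (hi.comp fst) snd)
  · have h1 : Primrec fun x : α × (List ℕ × List ℕ) × Instr => x.2.1.1 :=
      fst.comp (fst.comp snd)
    have h2 : Primrec fun x : α × (List ℕ × List ℕ) × Instr => x.2.1.2 :=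
      snd.comp (fst.comp snd)
    have h3 : Primrec fun x : α × (List ℕ × List ℕ) × Instr => x.2.2.1 :=
      fst.comp (snd.comp snd)
    refine (option_casesOn (snd.comp (snd.comp snd))
      (Primrec.pair (list_take.comp (hL.comp fst)
        (list_cons.comp ((list_getD 0).comp h2 h3) h1)) h2)
      (Primrec.pair (h1.comp fst) (list_set.comp (h2.comp fst) (Primrec.pair (h3.comp fst)
        (nat_mod.comp ((list_getD 0).comp snd (Primrec.encode.comp (h1.comp fst)))
          (hB.comp (fst.comp fst)))))).to₂).of_eq fun x => ?_
    simp only [execList]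
    cases x.2.2.2 <;> rfl

end Program

/-! ### Correctness of a program as a finite check -/

namespace Cuckoo

open Primrec Program

/-- The list `inp` consists of `n` items with two hash values. -/
def IsInput (n m w : ℕ) (inp : List ℕ) : Prop :=
  ∀ i < n, inp.getD (3 * i) 0 < 2 ^ w ∧ inp.getD (3 * i + 1) 0 < m ∧ inp.getD (3 * i + 2) 0 < m

/-- The list `p` contains the addresses of the cells for the items in a legal placement. -/
def IsAddrList (n m : ℕ) (inp p : List ℕ) : Prop :=
  (∀ i < n, ∀ j < n, p.getD i 0 = p.getD j 0 → i = j) ∧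
    ∀ i < n, (p.getD i 0 < m → inp.getD (3 * i + 1) 0 = p.getD i 0) ∧
      (m ≤ p.getD i 0 → p.getD i 0 < 2 * m → m + inp.getD (3 * i + 2) 0 = p.getD i 0)

/-- The items are stored at the addresses in the list `p`. -/
def IsStored (n m s : ℕ) (inp p mem : List ℕ) : Prop :=
  (∀ i < n, mem.getD (p.getD i 0) 0 = inp.getD (3 * i) 0) ∧
    ∀ a < 2 * m + s, mem.getD a 0 = 0 ∨ ∃ i < n, p.getD i 0 = a

/-- The program `P` with `L` private words places the items correctly. -/
def IsCorrect (L B N n m s w : ℕ) (P : List Instr) : Prop :=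
  -- The number 2 ^ w + m bounds both items and hash values; `IsInput` then selects the lists that
  -- are inputs.
  ∀ inp ∈ allLists (2 ^ w + m) (3 * n), IsInput n m w inp →
    (∃ p ∈ allLists (2 * m + s) n, IsAddrList n m inp p) →
      ∃ p ∈ allLists (2 * m + s) n, IsAddrList n m inp p ∧
        IsStored n m s inp p (finalList L B N P inp)

section

variable {α : Type*} [Primcodable α] {n m s w : α → ℕ} {inp p mem : α → List ℕ}

theorem primrecPred_isInput (hn : Primrec n) (hm : Primrec m) (hw : Primrec w)
    (hi : Primrec inp) : PrimrecPred fun a => IsInput (n a) (m a) (w a) (inp a) := by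
  have h3 : Primrec fun x : α × ℕ => 3 * x.2 := nat_mul.comp (Primrec.const 3) snd
  have hg := hi.comp (fst (α := α) (β := ℕ))
  refine PrimrecPred.ball_lt hn (.and ?_ (.and ?_ ?_))
  · exact nat_lt.comp ((list_getD 0).comp hg h3)
      (Primrec.nat_pow'.comp (Primrec.const 2) (hw.comp fst))
  · exact nat_lt.comp ((list_getD 0).comp hg (nat_add.comp h3 (Primrec.const 1)))
      (hm.comp fst)
  · exact nat_lt.comp ((list_getD 0).comp hg (nat_add.comp h3 (Primrec.const 2)))
      (hm.comp fst)

theorem primrecPred_isAddrList (hn : Primrec n) (hm : Primrec m) (hi : Primrec inp)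
    (hp : Primrec p) : PrimrecPred fun a => IsAddrList (n a) (m a) (inp a) (p a) := by
  have h3 : Primrec fun x : α × ℕ => 3 * x.2 := nat_mul.comp (Primrec.const 3) snd
  have hg := hi.comp (fst (α := α) (β := ℕ))
  have hm' := hm.comp (fst (α := α) (β := ℕ))
  have hpi : Primrec fun x : α × ℕ => (p x.1).getD x.2 0 := (list_getD 0).comp (hp.comp fst) snd
  refine .and (PrimrecPred.ball_lt hn (PrimrecPred.ball_lt (hn.comp fst) (.imp ?_ ?_)))
    (PrimrecPred.ball_lt hn (.and (.imp ?_ ?_) (.imp ?_ (.imp ?_ ?_))))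
  · exact Primrec.eq.comp (hpi.comp fst) (hpi.comp (Primrec.pair (fst.comp fst) snd))
  · exact Primrec.eq.comp (snd.comp fst) snd
  · exact nat_lt.comp hpi hm'
  · exact Primrec.eq.comp ((list_getD 0).comp hg (nat_add.comp h3 (Primrec.const 1))) hpi
  · exact nat_le.comp hm' hpi
  · exact nat_lt.comp hpi (nat_mul.comp (Primrec.const 2) hm')
  · exact Primrec.eq.comp
      (nat_add.comp hm' ((list_getD 0).comp hg (nat_add.comp h3 (Primrec.const 2)))) hpi

theorem primrecPred_isStored (hn : Primrec n) (hm : Primrec m) (hs : Primrec s)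
    (hi : Primrec inp) (hp : Primrec p) (hmem : Primrec mem) :
    PrimrecPred fun a => IsStored (n a) (m a) (s a) (inp a) (p a) (mem a) := by
  have hpi : Primrec fun x : α × ℕ => (p x.1).getD x.2 0 := (list_getD 0).comp (hp.comp fst) snd
  refine .and (PrimrecPred.ball_lt hn ?_) (PrimrecPred.ball_lt
    (nat_add.comp (nat_mul.comp (Primrec.const 2) hm) hs) (.or ?_ (PrimrecPred.bex_lt
      (hn.comp fst) ?_)))
  · exact Primrec.eq.comp ((list_getD 0).comp (hmem.comp fst) hpi)
      ((list_getD 0).comp (hi.comp fst) (nat_mul.comp (Primrec.const 3) snd))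
  · exact Primrec.eq.comp ((list_getD 0).comp (hmem.comp fst) snd) (Primrec.const 0)
  · exact Primrec.eq.comp (hpi.comp (Primrec.pair (fst.comp fst) snd)) (snd.comp fst)

theorem primrecPred_isCorrect {L B N : α → ℕ} {P : α → List Instr} (hL : Primrec L)
    (hB : Primrec B) (hN : Primrec N) (hn : Primrec n) (hm : Primrec m) (hs : Primrec s)
    (hw : Primrec w) (hP : Primrec P) :
    PrimrecPred fun a => IsCorrect (L a) (B a) (N a) (n a) (m a) (s a) (w a) (P a) := by
  have hl : Primrec fun a => allLists (2 * m a + s a) (n a) :=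
    primrec_allLists.comp (nat_add.comp (nat_mul.comp (Primrec.const 2) hm) hs) hn
  refine PrimrecPred.forall_mem (primrec_allLists.comp
    (nat_add.comp (Primrec.nat_pow'.comp (Primrec.const 2) hw) hm)
    (nat_mul.comp (Primrec.const 3) hn)) (.imp ?_ (.imp ?_ ?_))
  · exact primrecPred_isInput (hn.comp fst) (hm.comp fst) (hw.comp fst) snd
  · refine PrimrecPred.exists_mem (hl.comp fst) ?_
    exact primrecPred_isAddrList (hn.comp (fst.comp fst)) (hm.comp (fst.comp fst)) (snd.comp fst)
      snd
  · refine PrimrecPred.exists_mem (hl.comp fst) (.and ?_ ?_)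
    · exact primrecPred_isAddrList (hn.comp (fst.comp fst)) (hm.comp (fst.comp fst))
        (snd.comp fst) snd
    · have h := fst.comp (fst (α := α × List ℕ) (β := List ℕ))
      refine primrecPred_isStored (hn.comp h) (hm.comp h) (hs.comp h) (snd.comp fst) snd ?_
      exact primrec_finalList (hL.comp h) (hB.comp h) (hN.comp h) (hP.comp h) (snd.comp fst)

end

/-- The list of the words of the input. -/
def inputList {n m : ℕ} (x : Fin n → ℕ) (h₁ h₂ : Fin n → Fin m) : List ℕ :=
  (List.range (3 * n)).map (inputMemory x h₁ h₂)

section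

variable {n m s w : ℕ} {x : Fin n → ℕ} {h₁ h₂ : Fin n → Fin m}

theorem getD_inputList (a : ℕ) : (inputList x h₁ h₂).getD a 0 = inputMemory x h₁ h₂ a := by
  rcases lt_or_ge a (3 * n) with h | h
  · rw [List.getD_eq_getElem _ _ (by simpa [inputList] using h)]
    simp [inputList]
  · rw [List.getD_eq_default _ _ (by simpa [inputList] using h), inputMemory, dif_neg (by omega)]

theorem inputMemory_item (i : Fin n) : inputMemory x h₁ h₂ (3 * i) = x i := by
  have h1 : 3 * (i : ℕ) / 3 = i := by omega
  have h2 : 3 * (i : ℕ) % 3 = 0 := by omega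
  simp only [inputMemory, h1, h2, i.2, dif_pos, if_true]

theorem inputMemory_hash₁ (i : Fin n) : inputMemory x h₁ h₂ (3 * i + 1) = h₁ i := by
  have h1 : (3 * (i : ℕ) + 1) / 3 = i := by omega
  have h2 : (3 * (i : ℕ) + 1) % 3 = 1 := by omega
  simp only [inputMemory, h1, h2, i.2, dif_pos, one_ne_zero, if_true, if_false]

theorem inputMemory_hash₂ (i : Fin n) : inputMemory x h₁ h₂ (3 * i + 2) = h₂ i := by
  have h1 : (3 * (i : ℕ) + 2) / 3 = i := by omega
  have h2 : (3 * (i : ℕ) + 2) % 3 = 2 := by omega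
  simp only [inputMemory, h1, h2, i.2, dif_pos, two_ne_zero, OfNat.ofNat_ne_one, if_false]

theorem isInput_inputList (hx : ∀ i, x i < 2 ^ w) : IsInput n m w (inputList x h₁ h₂) := by
  intro i hi
  lift i to Fin n using hi
  rw [getD_inputList, getD_inputList, getD_inputList, inputMemory_item, inputMemory_hash₁,
    inputMemory_hash₂]
  exact ⟨hx i, (h₁ i).2, (h₂ i).2⟩

theorem inputList_mem (hx : ∀ i, x i < 2 ^ w) :
    inputList x h₁ h₂ ∈ allLists (2 ^ w + m) (3 * n) := by
  refine mem_allLists.2 ⟨by simp [inputList], fun a ha => ?_⟩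
  obtain ⟨a, -, rfl⟩ := List.mem_map.1 ha
  exact inputMemory_lt (Nat.add_pos_left (Nat.pow_pos (by norm_num)) _) (Nat.le_add_left _ _)
    (fun i => (hx i).trans_le (Nat.le_add_right _ _)) a

/-- The list of the addresses of a placement. -/
def addrList (place : Fin n → Loc m s) : List ℕ := List.ofFn fun i => (place i).addr

theorem getD_addrList (place : Fin n → Loc m s) (i : Fin n) :
    (addrList place).getD i 0 = (place i).addr := by
  rw [List.getD_eq_getElem _ _ (by simp [addrList])]
  simp [addrList]

theorem addrList_mem (place : Fin n → Loc m s) : addrList place ∈ allLists (2 * m + s) n := by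
  refine mem_allLists.2 ⟨by simp [addrList], fun a ha => ?_⟩
  obtain ⟨i, rfl⟩ := List.mem_ofFn.1 ha
  exact (place i).addr_lt

theorem exists_addrList {p : List ℕ} (hp : p ∈ allLists (2 * m + s) n) :
    ∃ place : Fin n → Loc m s, p = addrList place := by
  obtain ⟨h1, h2⟩ := mem_allLists.1 hp
  subst h1
  choose l hl using fun i : Fin p.length => Loc.exists_addr_eq (h2 p[i] (List.getElem_mem _))
  refine ⟨l, ?_⟩
  simp only [addrList, hl]
  exact List.ofFn_getElem.symm

theorem isAddrList_iff (place : Fin n → Loc m s) :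
    IsAddrList n m (inputList x h₁ h₂) (addrList place) ↔ IsPlacement h₁ h₂ place := by
  have key : ∀ i : Fin n, (((place i).addr < m → (h₁ i : ℕ) = (place i).addr) ∧
      (m ≤ (place i).addr → (place i).addr < 2 * m → m + (h₂ i : ℕ) = (place i).addr)) ↔
      (∀ j, place i = Sum.inl j → h₁ i = j) ∧ ∀ j, place i = Sum.inr (Sum.inl j) → h₂ i = j := by
    intro i
    rcases place i with u | u | u
    · have := u.2
      simp only [Loc.addr, Fin.ext_iff, Sum.inl.injEq, reduceCtorEq, IsEmpty.forall_iff,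
        implies_true, and_true]
      exact ⟨fun h j hj => (h.1 this).trans hj,
        fun h => ⟨fun _ => h _ rfl, fun h' => absurd this h'.not_gt⟩⟩
    · have := u.2
      simp only [Loc.addr, Fin.ext_iff, Sum.inr.injEq, Sum.inl.injEq, reduceCtorEq,
        IsEmpty.forall_iff, implies_true, true_and]
      refine ⟨fun h j hj => ?_, fun h => ?_⟩
      · have := h.2 (by omega) (by omega)
        omega
      · have := h _ rfl
        omega
    · simp only [Loc.addr, Sum.inr.injEq, reduceCtorEq, IsEmpty.forall_iff, implies_true,
        and_true, iff_true]
      omega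
  constructor
  · rintro ⟨ha, hb⟩
    have hk := fun i : Fin n => (key i).1 (by
      have := hb i i.2
      rwa [getD_addrList, getD_inputList, getD_inputList, inputMemory_hash₁,
        inputMemory_hash₂] at this)
    refine ⟨fun i j h => Fin.ext (ha i i.2 j j.2 ?_), fun i => (hk i).1, fun i => (hk i).2⟩
    rw [getD_addrList, getD_addrList, h]
  · rintro ⟨ha, hb, hc⟩
    refine ⟨fun i hi j hj h => ?_, fun i hi => ?_⟩
    · lift i to Fin n using hi
      lift j to Fin n using hj
      rw [getD_addrList, getD_addrList] at h
      exact congrArg Fin.val (ha (Loc.addr_injective h))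
    · lift i to Fin n using hi
      rw [getD_addrList, getD_inputList, getD_inputList, inputMemory_hash₁, inputMemory_hash₂]
      exact (key i).2 ⟨hb i, hc i⟩

theorem isStored_iff (place : Fin n → Loc m s) {l : List ℕ} {mem : ℕ → ℕ}
    (hl : ∀ a, l.getD a 0 = mem a) :
    IsStored n m s (inputList x h₁ h₂) (addrList place) l ↔
      (∀ i, mem (place i).addr = x i) ∧ ∀ l, l ∉ Set.range place → mem l.addr = 0 := by
  refine and_congr ?_ ?_
  · constructor
    · intro h i
      have := h i i.2
      rwa [getD_addrList, hl, getD_inputList, inputMemory_item] at this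
    · intro h i hi
      lift i to Fin n using hi
      rw [getD_addrList, hl, getD_inputList, inputMemory_item, h]
  · constructor
    · intro h l hr
      rcases h l.addr l.addr_lt with h | ⟨i, hi, h⟩
      · rwa [hl] at h
      · lift i to Fin n using hi
        rw [getD_addrList] at h
        exact absurd ⟨i, Loc.addr_injective h⟩ hr
    · intro h a ha
      obtain ⟨l, rfl⟩ := Loc.exists_addr_eq ha
      by_cases hr : l ∈ Set.range place
      · obtain ⟨i, rfl⟩ := hr
        exact Or.inr ⟨i, i.2, getD_addrList place i⟩
      · rw [hl]
        exact Or.inl (h l hr)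

end

theorem exists_inputList {n m w : ℕ} {inp : List ℕ} (hmem : inp ∈ allLists (2 ^ w + m) (3 * n))
    (h : IsInput n m w inp) : ∃ (x : Fin n → ℕ) (h₁ h₂ : Fin n → Fin m),
      (∀ i, x i < 2 ^ w) ∧ inp = inputList x h₁ h₂ := by
  refine ⟨fun i => inp.getD (3 * i) 0, fun i => ⟨inp.getD (3 * i + 1) 0, (h i i.2).2.1⟩,
    fun i => ⟨inp.getD (3 * i + 2) 0, (h i i.2).2.2⟩, fun i => (h i i.2).1, ?_⟩
  refine List.ext_getElem (by simp [inputList, (mem_allLists.1 hmem).1]) fun a ha ha' => ?_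
  have h3 : a < 3 * n := by rwa [(mem_allLists.1 hmem).1] at ha
  simp only [inputList, List.getElem_map, List.getElem_range, inputMemory]
  rw [dif_pos (by omega : a / 3 < n), ← List.getD_eq_getElem _ 0 ha]
  split_ifs with h1 h2 <;> congr 1 <;> omega

/-- Inputs and placements correspond to lists of bounded length and entries. This turns
quantification over functions into a finite check, and the equivalence is needed both ways: for the
search to succeed and for its result to be correct. -/
theorem isCorrect_iff {L B N n m s w : ℕ} {P : List Instr} (hP : ∀ i ∈ P, i.1 < N)
    (hN : 3 * n ≤ N) :
    IsCorrect L B N n m s w P ↔ ∀ (x : Fin n → ℕ) (h₁ h₂ : Fin n → Fin m), (∀ i, x i < 2 ^ w) →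
      StashSuffices h₁ h₂ s → HoldsTable x h₁ h₂ s (execAll L B P (inputMemory x h₁ h₂)).2 := by
  have hfin : ∀ (x : Fin n → ℕ) (h₁ h₂ : Fin n → Fin m) (a : ℕ),
      (finalList L B N P (inputList x h₁ h₂)).getD a 0 =
        (execAll L B P (inputMemory x h₁ h₂)).2 a := fun x h₁ h₂ =>
    getD_finalList hP (by simpa [inputList] using hN) fun a => (getD_inputList a).symm
  constructor
  · rintro h x h₁ h₂ hx ⟨place, hp⟩
    obtain ⟨p, hpm, hp1, hp2⟩ := h _ (inputList_mem hx) (isInput_inputList hx)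
      ⟨_, addrList_mem place, (isAddrList_iff place).2 hp⟩
    obtain ⟨place', rfl⟩ := exists_addrList hpm
    exact ⟨place', (isAddrList_iff place').1 hp1, (isStored_iff place' (hfin x h₁ h₂)).1 hp2⟩
  · rintro h inp hinp hin ⟨p, hpm, hp⟩
    obtain ⟨x, h₁, h₂, hx, rfl⟩ := exists_inputList hinp hin
    obtain ⟨place, rfl⟩ := exists_addrList hpm
    obtain ⟨place', h1, h2⟩ := h x h₁ h₂ hx ⟨place, (isAddrList_iff place).1 hp⟩
    exact ⟨_, addrList_mem place', (isAddrList_iff place').2 h1,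
      (isStored_iff place' (hfin x h₁ h₂)).2 h2⟩

end Cuckoo

/-! ### The algorithm -/

namespace Program

open Primrec

/-- The next request of the machine that executes the program `code.2` with `c * code.1` private
words; the private memory holds four parameters, the program counter and these words. -/
def nextRequest (C : ℕ) (code : ℕ × List Instr) (l : List ℕ) : Option (ℕ × Option ℕ) :=
  -- At the start only the four parameters are present, and the default value `0` serves as the
  -- program counter. A counter past the end of the program means halt. The reduction modulo 2 ^ (C
  -- w) bounds the written words on arbitrary memories.
  (code.2[l.getD 4 0]?).map fun i =>
    (i.1, i.2.map fun T => T.getD (Encodable.encode (l.drop 5)) 0 % 2 ^ (C * l.getD 3 0))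

/-- The next contents of the private memory, if the word `v` is read. -/
def nextPriv (c : ℕ) (code : ℕ × List Instr) (x : List ℕ × ℕ) : List ℕ :=
  x.1.take 4 ++ (x.1.getD 4 0 + 1) :: (code.2[x.1.getD 4 0]?).elim [] fun i =>
    i.2.elim ((x.2 :: x.1.drop 5).take (c * code.1)) fun _ => x.1.drop 5

theorem primrec_nextRequest (C : ℕ) : Primrec₂ (nextRequest C) := by
  refine option_map (list_getElem?.comp (snd.comp fst)
    ((list_getD 0).comp snd (Primrec.const 4))) (Primrec.pair (fst.comp snd) ?_)
  refine option_map (snd.comp snd) ?_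
  have h : Primrec fun x : (((ℕ × List Instr) × List ℕ) × Instr) × List ℕ => x.1.1.2 :=
    snd.comp (fst.comp fst)
  exact nat_mod.comp ((list_getD 0).comp snd
      (Primrec.encode.comp (list_drop.comp (Primrec.const 5) h)))
    (Primrec.nat_pow'.comp (Primrec.const 2)
      (nat_mul.comp (Primrec.const C) ((list_getD 0).comp h (Primrec.const 3))))

theorem primrec_nextPriv (c : ℕ) : Primrec₂ (nextPriv c) := by
  have h : Primrec fun x : (ℕ × List Instr) × (List ℕ × ℕ) => x.2.1 := fst.comp snd
  have hpc : Primrec fun x : (ℕ × List Instr) × (List ℕ × ℕ) => x.2.1.getD 4 0 :=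
    (list_getD 0).comp h (Primrec.const 4)
  have hd : Primrec fun x : (ℕ × List Instr) × (List ℕ × ℕ) => x.2.1.drop 5 :=
    list_drop.comp (Primrec.const 5) h
  refine list_append.comp (list_take.comp (Primrec.const 4) h)
    (list_cons.comp (nat_add.comp hpc (Primrec.const 1)) ?_)
  refine (option_casesOn (list_getElem?.comp (snd.comp fst) hpc) (Primrec.const [])
    (option_casesOn (snd.comp snd) (list_take.comp (nat_mul.comp (Primrec.const c)
      (fst.comp (fst.comp fst))) (list_cons.comp (snd.comp (snd.comp fst)) (hd.comp fst)))
      (hd.comp (fst.comp fst)).to₂).to₂).of_eq fun x => ?_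
  cases x.1.2[x.2.1.getD 4 0]? with
  | none => rfl
  | some i => obtain ⟨a, _ | T⟩ := i <;> rfl

/-- The machine that computes a program from the four parameters and executes it. -/
def machine (c C : ℕ) (F : List ℕ → ℕ × List Instr) (hF : Computable F) : Algorithm where
  -- The program itself is not stored: it is recomputed from the parameters at each access, since
  -- private computation is not charged.
  request l := nextRequest C (F (l.take 4)) l
  update l v := nextPriv c (F (l.take 4)) (l, v)
  computable_request := (primrec_nextRequest C).to_comp.comp
    (hF.comp (list_take.comp (Primrec.const 4) Primrec.id).to_comp) Computable.id
  computable_update := (primrec_nextPriv c).to_comp.comp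
    (hF.comp (list_take.comp (Primrec.const 4) fst).to_comp) Computable.id

/-- The private memory of the machine after `t` instructions. -/
def privAt (par : List ℕ) (t : ℕ) (priv : List ℕ) : List ℕ :=
  if t = 0 then par else par ++ t :: priv

section

variable {c C : ℕ} {F : List ℕ → ℕ × List Instr} {hF : Computable F} {n m s w : ℕ}
  {mem : ℕ → ℕ}

theorem privAt_spec {t : ℕ} {priv : List ℕ} (h : t = 0 → priv = []) :
    (privAt [n, m, s, w] t priv).take 4 = [n, m, s, w] ∧
      (privAt [n, m, s, w] t priv).getD 4 0 = t ∧ (privAt [n, m, s, w] t priv).getD 3 0 = w ∧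
      (privAt [n, m, s, w] t priv).drop 5 = priv := by
  rw [privAt]
  split_ifs with ht
  · subst ht
    simp [h rfl]
  · simp

/-- The configuration after `t` instructions. -/
def configAt (c C : ℕ) (code : ℕ × List Instr) (n m s w : ℕ) (mem : ℕ → ℕ) (t : ℕ) :
    Algorithm.Config :=
  ⟨privAt [n, m, s, w] t (execAll (c * code.1) (2 ^ (C * w)) (code.2.take t) mem).1,
    (execAll (c * code.1) (2 ^ (C * w)) (code.2.take t) mem).2⟩

theorem configAt_spec (code : ℕ × List Instr) (t : ℕ) :
    (configAt c C code n m s w mem t).priv.take 4 = [n, m, s, w] ∧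
      (configAt c C code n m s w mem t).priv.getD 4 0 = t ∧
      (configAt c C code n m s w mem t).priv.getD 3 0 = w ∧
      (configAt c C code n m s w mem t).priv.drop 5 =
        (execAll (c * code.1) (2 ^ (C * w)) (code.2.take t) mem).1 :=
  privAt_spec fun h => by simp [h, execAll]

theorem request_configAt (t : ℕ) :
    (machine c C F hF).request (configAt c C (F [n, m, s, w]) n m s w mem t).priv =
      ((F [n, m, s, w]).2[t]?).map fun i => (i.1, i.2.map fun T => T.getD (Encodable.encode
        (execAll (c * (F [n, m, s, w]).1) (2 ^ (C * w)) ((F [n, m, s, w]).2.take t) mem).1) 0 %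
          2 ^ (C * w)) := by
  obtain ⟨h1, h2, h3, h4⟩ := configAt_spec (c := c) (C := C) (n := n) (m := m) (s := s) (w := w)
    (mem := mem) (F [n, m, s, w]) t
  simp only [machine, nextRequest, h1, h2, h3, h4]

theorem step_configAt {t : ℕ} (ht : t < (F [n, m, s, w]).2.length) :
    (machine c C F hF).step (configAt c C (F [n, m, s, w]) n m s w mem t) =
      configAt c C (F [n, m, s, w]) n m s w mem (t + 1) := by
  obtain ⟨h1, h2, h3, h4⟩ := configAt_spec (c := c) (C := C) (n := n) (m := m) (s := s) (w := w)
    (mem := mem) (F [n, m, s, w]) t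
  have hi : (F [n, m, s, w]).2[t]? = some ((F [n, m, s, w]).2[t]) := List.getElem?_eq_getElem ht
  rw [Algorithm.step, request_configAt, hi]
  have hnext : execAll (c * (F [n, m, s, w]).1) (2 ^ (C * w)) ((F [n, m, s, w]).2.take (t + 1))
      mem = exec (c * (F [n, m, s, w]).1) (2 ^ (C * w)) (execAll (c * (F [n, m, s, w]).1)
        (2 ^ (C * w)) ((F [n, m, s, w]).2.take t) mem) (F [n, m, s, w]).2[t] := by
    rw [List.take_succ_eq_append_getElem ht, execAll_append]
    rfl
  have hupd : ∀ v, (machine c C F hF).update (configAt c C (F [n, m, s, w]) n m s w mem t).priv v =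
      [n, m, s, w] ++ (t + 1) :: (F [n, m, s, w]).2[t].2.elim
        ((v :: (execAll (c * (F [n, m, s, w]).1) (2 ^ (C * w))
          ((F [n, m, s, w]).2.take t) mem).1).take (c * (F [n, m, s, w]).1))
        fun _ => (execAll (c * (F [n, m, s, w]).1) (2 ^ (C * w))
          ((F [n, m, s, w]).2.take t) mem).1 := by
    intro v
    simp only [machine, nextPriv, h1, h2, h4, hi, Option.elim_some]
  have hconf : configAt c C (F [n, m, s, w]) n m s w mem (t + 1) = ⟨[n, m, s, w] ++ (t + 1) ::
      (exec (c * (F [n, m, s, w]).1) (2 ^ (C * w)) (execAll (c * (F [n, m, s, w]).1)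
        (2 ^ (C * w)) ((F [n, m, s, w]).2.take t) mem) (F [n, m, s, w]).2[t]).1,
      (exec (c * (F [n, m, s, w]).1) (2 ^ (C * w)) (execAll (c * (F [n, m, s, w]).1)
        (2 ^ (C * w)) ((F [n, m, s, w]).2.take t) mem) (F [n, m, s, w]).2[t]).2⟩ := by
    rw [← hnext]
    rfl
  rw [hconf]
  rcases h : (F [n, m, s, w]).2[t] with ⟨a, _ | T⟩
  · simp only [Option.map_some, Option.map_none, hupd, h]
    rfl
  · simp only [Option.map_some, hupd, h]
    rfl

theorem run_machine (t : ℕ) : (machine c C F hF).run [n, m, s, w] mem t =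
    configAt c C (F [n, m, s, w]) n m s w mem (min t (F [n, m, s, w]).2.length) := by
  induction t with
  | zero =>
    simp [Algorithm.run, configAt, privAt, execAll]
  | succ t ih =>
    rw [Algorithm.run, Function.iterate_succ_apply', ← Algorithm.run, ih]
    rcases lt_or_ge t (F [n, m, s, w]).2.length with h | h
    · rw [Nat.min_eq_left h.le, Nat.min_eq_left h, step_configAt h]
    · rw [Nat.min_eq_right h, Nat.min_eq_right (h.trans (Nat.le_succ t)), Algorithm.step,
        request_configAt, List.getElem?_eq_none le_rfl]
      rfl

/-- Address and kind of an access are parts of the instruction; the memory contents only influence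
the word that is written. This is data-obliviousness. -/
theorem access_machine (t : ℕ) : (machine c C F hF).access [n, m, s, w] mem t =
    ((F [n, m, s, w]).2[t]?).map fun i => (i.1, i.2.isSome) := by
  rw [Algorithm.access, run_machine, request_configAt, Option.map_map]
  rcases lt_or_ge t (F [n, m, s, w]).2.length with h | h
  · rw [Nat.min_eq_left h.le]
    congr 1
    funext i
    simp
  · rw [Nat.min_eq_right h, List.getElem?_eq_none h, List.getElem?_eq_none le_rfl]
    rfl

theorem priv_run_machine (t : ℕ) :
    ((machine c C F hF).run [n, m, s, w] mem t).priv.length ≤ c * (F [n, m, s, w]).1 + 5 := by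
  rw [run_machine]
  simp only [configAt, privAt]
  have := length_execAll_le (L := c * (F [n, m, s, w]).1) (B := 2 ^ (C * w))
    ((F [n, m, s, w]).2.take (min t (F [n, m, s, w]).2.length)) mem
  split_ifs
  · simp only [List.length_cons, List.length_nil]
    omega
  · simp only [List.length_append, List.length_cons, List.length_nil]
    omega

end

theorem execAll_priv_lt {L B : ℕ} (P : List Instr) {mem : ℕ → ℕ} (hB : 0 < B)
    (h : ∀ a, mem a < B) : ∀ q ∈ (execAll L B P mem).1, q < B := by
  induction P using List.reverseRecOn with
  | nil => simp [execAll]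
  | append_singleton P i ih =>
    rw [execAll_append, List.foldl_cons, List.foldl_nil]
    rcases hi : i.2 with _ | T
    · simp only [exec, hi, Option.elim_none]
      intro q hq
      rcases List.mem_cons.1 (List.mem_of_mem_take hq) with rfl | hq
      · exact execAll_lt P hB h _
      · exact ih q hq
    · simpa [exec, hi] using ih

end Program

/-! ### Search for the program and choice of constants -/

namespace Cuckoo

open Program Primrec

/-- The parameters for which there is a program. -/
def IsParam (K A : ℕ) (par : List ℕ) : Prop :=
  1 ≤ par.getD 0 0 ∧ 1 ≤ par.getD 3 0 ∧ par.getD 0 0 ≤ 2 ^ par.getD 3 0 ∧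
    par.getD 1 0 ≤ K * par.getD 0 0 ∧ 2 ^ par.getD 2 0 ≤ (3 * par.getD 0 0) ^ A

/-- A program (with a measure of its private space) that can be used for the parameters `par`. -/
def IsCode (k c C : ℕ) (par : List ℕ) (code : ℕ × List Instr) : Prop :=
  code.1 ^ k ≤ par.getD 0 0 ∧ code.2.length ≤ c * (par.getD 0 0 + par.getD 2 0) ∧
    (∀ i ∈ code.2, i.1 < c * (par.getD 0 0 + par.getD 2 0)) ∧
    IsCorrect (c * code.1) (2 ^ (C * par.getD 3 0))
      (c * (par.getD 0 0 + par.getD 2 0) + 3 * par.getD 0 0) (par.getD 0 0) (par.getD 1 0)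
      (par.getD 2 0) (par.getD 3 0) code.2

/-- With the condition `IsParam` as a premise, every list of numbers admits some code, so that the
search for one is total. -/
theorem primrecRel_isCode (k K A c C : ℕ) :
    PrimrecRel fun par code => IsParam K A par → IsCode k c C par code := by
  have h : ∀ i, Primrec fun x : List ℕ × (ℕ × List Instr) => x.1.getD i 0 := fun i =>
    (list_getD 0).comp fst (Primrec.const i)
  have hN : Primrec fun x : List ℕ × (ℕ × List Instr) => c * (x.1.getD 0 0 + x.1.getD 2 0) :=
    nat_mul.comp (Primrec.const c) (nat_add.comp (h 0) (h 2))
  have hQ : Primrec fun x : List ℕ × (ℕ × List Instr) => x.2.1 := fst.comp snd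
  have hP : Primrec fun x : List ℕ × (ℕ × List Instr) => x.2.2 := snd.comp snd
  refine PrimrecPred.imp (.and ?_ (.and ?_ (.and ?_ (.and ?_ ?_)))) (.and ?_ (.and ?_ (.and ?_ ?_)))
  · exact nat_le.comp (Primrec.const 1) (h 0)
  · exact nat_le.comp (Primrec.const 1) (h 3)
  · exact nat_le.comp (h 0) (Primrec.nat_pow'.comp (Primrec.const 2) (h 3))
  · exact nat_le.comp (h 1) (nat_mul.comp (Primrec.const K) (h 0))
  · exact nat_le.comp (Primrec.nat_pow'.comp (Primrec.const 2) (h 2))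
      (Primrec.nat_pow'.comp (nat_mul.comp (Primrec.const 3) (h 0)) (Primrec.const A))
  · exact nat_le.comp (Primrec.nat_pow'.comp hQ (Primrec.const k)) (h 0)
  · exact nat_le.comp (list_length.comp hP) hN
  · exact PrimrecPred.forall_mem hP (nat_lt.comp (fst.comp snd) (hN.comp fst))
  · exact primrecPred_isCorrect (nat_mul.comp (Primrec.const c) hQ)
      (Primrec.nat_pow'.comp (Primrec.const 2) (nat_mul.comp (Primrec.const C) (h 3)))
      (nat_add.comp hN (nat_mul.comp (Primrec.const 3) (h 0))) (h 0) (h 1) (h 2) (h 3) hP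

/-- `exists_small_program` makes the search succeed and `isCorrect_iff` makes its result usable.
Since c is fixed before C, words can later be enlarged without changing the bounds on time and
private space. -/
theorem exists_search (k K A : ℕ) (hk : 1 ≤ k) : ∃ c, ∀ C ≥ c, ∃ F : List ℕ → ℕ × List Instr,
    Computable F ∧ ∀ n m s w : ℕ, 1 ≤ n → 1 ≤ w → n ≤ 2 ^ w → m ≤ K * n → 2 ^ s ≤ (3 * n) ^ A →
      (F [n, m, s, w]).1 ^ k ≤ n ∧ (F [n, m, s, w]).2.length ≤ c * (n + s) ∧
        (∀ i ∈ (F [n, m, s, w]).2, i.1 < c * (n + s)) ∧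
        ∀ (x : Fin n → ℕ) (h₁ h₂ : Fin n → Fin m), (∀ i, x i < 2 ^ w) → StashSuffices h₁ h₂ s →
          HoldsTable x h₁ h₂ s (execAll (c * (F [n, m, s, w]).1) (2 ^ (C * w))
            (F [n, m, s, w]).2 (inputMemory x h₁ h₂)).2 := by
  obtain ⟨c, hc⟩ := exists_small_program k K A hk
  refine ⟨c, fun C hC => ?_⟩
  obtain ⟨F, hF, hspec⟩ := exists_computable_choice (primrecRel_isCode k K A c C) (by
    intro par
    by_cases hpar : IsParam K A par
    · obtain ⟨h0, h3, h03, h10, h2⟩ := hpar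
      obtain ⟨Q, P, hQ, hP, hP', hx⟩ := hc C hC _ _ _ _ h0 h3 h03 h10 h2
      exact ⟨(Q, P), fun _ => ⟨hQ, hP, hP', (isCorrect_iff
        (fun i hi => (hP' i hi).trans_le (Nat.le_add_right _ _)) (Nat.le_add_left _ _)).2 hx⟩⟩
    · exact ⟨default, fun h => absurd h hpar⟩)
  refine ⟨F, hF, fun n m s w hn hw hnw hm hs => ?_⟩
  obtain ⟨h1, h2, h3, h4⟩ := hspec [n, m, s, w] ⟨hn, hw, hnw, hm, hs⟩
  exact ⟨h1, h2, h3, (isCorrect_iff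
    (fun i hi => (h3 i hi).trans_le (Nat.le_add_right _ _)) (Nat.le_add_left _ _)).1 h4⟩

/-- From 2 ≤ e ≤ 3 follows 2 ^ s ≤ exp s ≤ (e n) ^ ⌈A⌉₊ ≤ (3 n) ^ ⌈A⌉₊. The real bound on s becomes
an inequality of natural numbers, which the search can test. -/
theorem two_pow_le_of_log {n s : ℕ} {A : ℝ} (hn : 1 ≤ n) (h : (s : ℝ) ≤ A * (Real.log n + 1)) :
    2 ^ s ≤ (3 * n) ^ ⌈A⌉₊ := by
  have hn0 : (0 : ℝ) < n := by exact_mod_cast hn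
  have hlog : 0 ≤ Real.log n := Real.log_nonneg (by exact_mod_cast hn)
  have h1 : (s : ℝ) ≤ ⌈A⌉₊ * (Real.log n + 1) :=
    h.trans (mul_le_mul_of_nonneg_right (Nat.le_ceil A) (by linarith))
  have h2 : (2 : ℝ) ^ s ≤ (3 * n) ^ ⌈A⌉₊ := by
    have he : (2 : ℝ) ≤ Real.exp 1 := by linarith [Real.add_one_le_exp 1]
    have he3 : Real.exp 1 ≤ 3 := by linarith [Real.exp_one_lt_d9]
    calc (2 : ℝ) ^ s ≤ Real.exp 1 ^ s := pow_le_pow_left₀ (by norm_num) he s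
      _ = Real.exp s := by rw [← Real.exp_nat_mul, mul_one]
      _ ≤ Real.exp (⌈A⌉₊ * (Real.log n + 1)) := Real.exp_le_exp.2 h1
      _ = (n * Real.exp 1) ^ ⌈A⌉₊ := by
        rw [Real.exp_nat_mul, Real.exp_add, Real.exp_log hn0]
      _ ≤ (3 * n) ^ ⌈A⌉₊ := by
        refine pow_le_pow_left₀ (by positivity) ?_ _
        rw [mul_comm]
        exact mul_le_mul_of_nonneg_right he3 hn0.le
  exact_mod_cast h2

theorem le_rpow_of_pow_ceil_le {n Q : ℕ} {r : ℝ} (hr : 1 < r) (hn : 1 ≤ n)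
    (h : Q ^ ⌈r⌉₊ ≤ n) : (Q : ℝ) ≤ (n : ℝ) ^ (1 / r) := by
  rcases Nat.eq_zero_or_pos Q with rfl | hQ
  · simp only [Nat.cast_zero]
    positivity
  have hQ1 : (1 : ℝ) ≤ Q := by exact_mod_cast hQ
  have h1 : (Q : ℝ) ^ r ≤ n := by
    calc (Q : ℝ) ^ r ≤ (Q : ℝ) ^ (⌈r⌉₊ : ℝ) := Real.rpow_le_rpow_of_exponent_le hQ1 (Nat.le_ceil r)
      _ = ((Q ^ ⌈r⌉₊ : ℕ) : ℝ) := by rw [Real.rpow_natCast]; push_cast; rfl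
      _ ≤ n := by exact_mod_cast h
  calc (Q : ℝ) = ((Q : ℝ) ^ r) ^ (1 / r) := by
        rw [← Real.rpow_mul (by positivity), mul_one_div_cancel (by positivity), Real.rpow_one]
    _ ≤ (n : ℝ) ^ (1 / r) := Real.rpow_le_rpow (by positivity) h1 (by positivity)

end Cuckoo

open Cuckoo Program

theorem mainTheorem2 (r : ℝ) (hr : 1 < r) (K : ℕ) (A : ℝ) :
    ∃ (P : Algorithm) (C : ℕ), 1 ≤ C ∧
      ∀ n m s w : ℕ, 1 ≤ n → 1 ≤ w → n ≤ 2 ^ w → m ≤ K * n →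
        (s : ℝ) ≤ A * (Real.log n + 1) →
        -- the access sequence does not depend on the data
        P.DataOblivious [n, m, s, w] (C * w) ∧
        -- resources, for all contents of the outsourced memory
        (∀ mem : ℕ → ℕ, (∀ a, mem a < 2 ^ (C * w)) →
          P.HaltsWithin [n, m, s, w] mem (C * (n + s)) ∧
          P.PrivateSpaceBounded [n, m, s, w] mem (C * (n : ℝ) ^ (1 / r)) ∧
          P.OutsourcedSpaceBounded [n, m, s, w] mem (C * (n + s)) ∧
          P.WordsBounded [n, m, s, w] mem (C * w)) ∧
        -- inputs are memories of `C * w`-bit words, and on them the algorithm is correct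
        (∀ (x : Fin n → ℕ) (h₁ h₂ : Fin n → Fin m), Function.Injective x →
          (∀ i, 0 < x i ∧ x i < 2 ^ w) →
          (∀ a, Cuckoo.inputMemory x h₁ h₂ a < 2 ^ (C * w)) ∧
          (Cuckoo.StashSuffices h₁ h₂ s →
            Cuckoo.HoldsTable x h₁ h₂ s
              (P.run [n, m, s, w] (Cuckoo.inputMemory x h₁ h₂) (C * (n + s))).mem)) := by
  obtain ⟨c, hc⟩ := exists_search ⌈r⌉₊ K ⌈A⌉₊ (Nat.one_le_ceil_iff.2 (by linarith))
  -- The product a 2 ^ w exceeds all parameters and the program counter, which is at most c (n + s);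
  -- so they fit into C w bits. The summand 5 in C pays for the parameters and the counter in the
  -- private memory.
  obtain ⟨a, ha⟩ : ∃ a, a = K + 3 * ⌈A⌉₊ + c * (1 + 3 * ⌈A⌉₊) + 2 := ⟨_, rfl⟩
  obtain ⟨C, hC⟩ : ∃ C, C = c + 5 + (a + 1) := ⟨_, rfl⟩
  obtain ⟨F, hF, hspec⟩ := hc C (by omega)
  refine ⟨machine c C F hF, C, by omega, fun n m s w hn hw hnw hm hs => ?_⟩
  have hs2 := two_pow_le_of_log hn hs
  obtain ⟨hQ, hlen, haddr, hcorrect⟩ := hspec n m s w hn hw hnw hm hs2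
  have hCc : c * (n + s) ≤ C * (n + s) := Nat.mul_le_mul_right _ (by omega)
  have hbig : a * 2 ^ w ≤ 2 ^ (C * w) := (mul_two_pow_le hw a).trans
    (Nat.pow_le_pow_right (by norm_num) (Nat.mul_le_mul_right _ (by omega)))
  have hw2 : w < 2 ^ w := Nat.lt_two_pow_self
  have hm2 : m ≤ K * 2 ^ w := hm.trans (Nat.mul_le_mul_left _ hnw)
  have hsw : s ≤ 3 * ⌈A⌉₊ * 2 ^ w :=
    (le_of_two_pow_le hw hnw hs2).trans (Nat.mul_le_mul_left _ hw2.le)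
  have hns : c * (n + s) ≤ c * (1 + 3 * ⌈A⌉₊) * 2 ^ w := by
    rw [mul_assoc, add_mul, one_mul]
    exact Nat.mul_le_mul_left _ (Nat.add_le_add hnw hsw)
  have ha2 : a * 2 ^ w = K * 2 ^ w + 3 * ⌈A⌉₊ * 2 ^ w + c * (1 + 3 * ⌈A⌉₊) * 2 ^ w + 2 * 2 ^ w := by
    rw [ha]; ring
  have hB : 0 < 2 ^ (C * w) := Nat.pow_pos (by norm_num)
  refine ⟨fun mem mem' _ _ => ?_, fun mem hmem => ⟨?_, fun t => ?_, fun t q hq => ?_, fun t =>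
    ⟨fun q hq => ?_, fun b => ?_⟩⟩, fun x h₁ h₂ _ hx => ⟨fun b => ?_, fun hstash => ?_⟩⟩
  · funext t
    rw [access_machine, access_machine]
  · rw [Algorithm.HaltsWithin, run_machine, request_configAt,
      Nat.min_eq_right (hlen.trans hCc), List.getElem?_eq_none le_rfl]
    rfl
  · have h1 : (((machine c C F hF).run [n, m, s, w] mem t).priv.length : ℝ) ≤
        c * ((F [n, m, s, w]).1 : ℝ) + 5 := by exact_mod_cast priv_run_machine t
    have h2 := le_rpow_of_pow_ceil_le hr hn hQ
    have h3 : (1 : ℝ) ≤ (n : ℝ) ^ (1 / r) :=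
      Real.one_le_rpow (by exact_mod_cast hn) (by positivity)
    have h4 : (c : ℝ) * (F [n, m, s, w]).1 ≤ c * (n : ℝ) ^ (1 / r) :=
      mul_le_mul_of_nonneg_left h2 (Nat.cast_nonneg c)
    have h5 : ((c : ℝ) + 5) * (n : ℝ) ^ (1 / r) ≤ C * (n : ℝ) ^ (1 / r) := by
      refine mul_le_mul_of_nonneg_right ?_ (by linarith)
      exact_mod_cast (by omega : c + 5 ≤ C)
    linarith
  · rw [access_machine, Option.mem_def] at hq
    obtain ⟨i, hi, rfl⟩ := Option.map_eq_some_iff.1 hq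
    exact (haddr i (List.mem_of_getElem? hi)).trans_le hCc
  · rw [run_machine] at hq
    simp only [configAt, privAt] at hq
    have hpar : ∀ q ∈ [n, m, s, w], q < 2 ^ (C * w) := by
      simp only [List.mem_cons, List.not_mem_nil, or_false, forall_eq_or_imp, forall_eq]
      omega
    split_ifs at hq with ht
    · exact hpar q hq
    · rcases List.mem_append.1 hq with hq | hq
      · exact hpar q hq
      rcases List.mem_cons.1 hq with rfl | hq
      · have : min t (F [n, m, s, w]).2.length ≤ c * (n + s) := (Nat.min_le_right _ _).trans hlen
        omega
      · exact execAll_priv_lt _ hB hmem q hq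
  · rw [run_machine]
    exact execAll_lt _ hB hmem b
  · exact inputMemory_lt hB (by omega) (fun i => (hx i).2.trans_le (by omega)) b
  · rw [run_machine, Nat.min_eq_right (hlen.trans hCc)]
    simp only [configAt, List.take_length]
    exact hcorrect x h₁ h₂ (fun i => (hx i).2) hstash
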